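/- **Setting.** Let $\lambda,\xi,\eta>0$ and let $3\le d_v<d_c$ be integers. A *$(d_v,d_c)$-regular code* is given by a binary parity-check matrix with $n\ge 1$ columns (variable nodes), each containing $d_v$ ones, and whose rows (check nodes) each contain $d_c$ ones; its Tanner graph is the corresponding bipartite graph, $g$ is the girth of that graph, and $\lfloor (g-2)/4\rfloor$ is the largest number of *independent* decoding iterations. *Channel.* At transmit power $P_T\ge 0$ the decoder sees a uniformly distributed codeword through a binary symmetric channel of flip probability $p_0=\mathbb Q(\sqrt{2\eta P_T})$, where $\mathbb Q(x)=\frac1{\sqrt{2\pi}}\int_x^\infty e^{-u^2/2}\,du$. *Gallager-A decoding.* In iteration $0$ each variable node sends its received bit to its neighbours. In each iteration a check node returns to each neighbour the parity of the messages of its other neighbours, and a variable node then sends to each neighbouring check node its received bit, unless all its other check nodes contradict that bit, in which case it sends the complement. The bit-error probability after $\ell$ iterations is the expected fraction of wrong variable-to-check messages in iteration $\ell$. *Wire Model.* The plane carries horizontal and vertical wiring tracks of width $\lambda$ and spacing $\lambda$; their overlaps are contact squares. Each node of the Tanner graph is a processing node, occupying one contact square if its degree $x$ is at most $4$ and a square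 of side $x\lambda$ otherwise; these squares are disjoint. Each edge is a wire that runs along tracks between its two processing nodes, passes over no processing node, and shares points with other wires only in contact squares, where the two wires cross orthogonally. The decoding power is $\xi A_{\mathrm{wires}}$, where $A_{\mathrm{wires}}$ is the total area occupied by the wires. *Total power.* For a class $\mathcal C$ of codes, $P_{\mathrm{total,min}}(\mathcal C,P_e)$ is the infimum of $P_T+\xi A_{\mathrm{wires}}$ over all $P_T\ge0$, all codes in $\mathcal C$, all numbers of independent Gallager-A iterations with bit-error probability at most $P_e$, and all layouts of the decoder. The power required by uncoded transmission is $P_{\mathrm{unc}}(P_e)=\inf\{P_T\ge 0:\mathbb Q(\sqrt{2\eta P_T})\le P_e\}$. Let $\Gamma=[\log((d_v-1)(d_c-1)),\,3\log(2d_vd_c+1)]$. A *code construction with constant $\gamma$* is a sequence $(C_N)_{N\ge0}$ of $(d_v,d_c)$-regular codes such that $C_N$ allows at least $N$ independent iterations and has blocklength $\Theta(e^{\gamma N})$. **Theorem.** There are absolute constants $0<c_1\le c_2$ such that the following holds for all $3\le d_v<d_c$. 1. For some $\gamma\in\Gamma$ there is a code construction with constant $\gamma$. For all $\lambda,\xi,\eta>0$,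 all $\gamma\in\Gamma$, if $\mathcal C$ is the class of all $(d_v,d_c)$-regular codes, or the set of codes of any code construction with constant $\gamma$, then for all sufficiently small $P_e>0$ $$c_1\,\frac{\frac{\gamma}{\eta}\log\frac1{P_e}}{\log\log\frac1{P_e}}\;\le\; P_{\mathrm{total,min}}(\mathcal C,P_e)\;\le\; c_2\,\frac{\frac{\gamma}{\eta}\log\frac1{P_e}}{\log\log\frac1{P_e}} .$$ 2. For $\mathcal C$ the class of all $(d_v,d_c)$-regular codes, $P_{\mathrm{unc}}(P_e)=\Theta\big(\log\log\frac1{P_e}\cdot P_{\mathrm{total,min}}(\mathcal C,P_e)\big)$ as $P_e\to0$, with constants that depend only on $d_v$ and $d_c$. 3. For all $\lambda,\xi,\eta>0$ and every fixed $P_T\ge0$ there are $a,b,k>0$ such that, for all sufficiently small $P_e>0$, every total power $P_T+\xi A_{\mathrm{wires}}$ with which bit-error probability $P_e$ is achieved at transmit power $P_T$ by a $(d_v,d_c)$-regular code with independent Gallager-A iterations is at least $k\,(1/P_e)^a$ and at least $e^{b P_{\mathrm{unc}}(P_e)}$. For all $\lambda,\xi,\eta>0$, every sufficiently large fixed $P_T$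 achieves every $P_e>0$. -/

import Mathlib

open Filter Topology

noncomputable section

/-! ### Channel -/

/-- Tail probability of the standard normal distribution. -/
def gaussQ (x : ℝ) : ℝ :=
  (1 / Real.sqrt (2 * Real.pi)) * ∫ u in Set.Ioi x, Real.exp (-u ^ 2 / 2)

/-- Flip probability of the binary symmetric channel obtained by hard decisions on BPSK symbols over
the AWGN channel with `E_s / N_0 = η * P_T`. -/
def flipProb (η PT : ℝ) : ℝ := gaussQ (Real.sqrt (2 * (η * PT)))

/-- Probability of the error pattern `e` when the symbols are flipped independently with
probability `p`. -/
def bscProb {n : ℕ} (p : ℝ) (e : Fin n → ZMod 2) : ℝ :=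
  ∏ v, if e v = 0 then 1 - p else p

/-- Power required by uncoded transmission to reach bit-error probability `Pe`. -/
def uncodedPower (η Pe : ℝ) : ℝ := sInf {PT : ℝ | 0 ≤ PT ∧ flipProb η PT ≤ Pe}

/-! ### Codes and their Tanner graphs -/

/-- A binary parity-check matrix with `n` columns (variable nodes) and `m` rows (check nodes). -/
structure Tanner where
  n : ℕ
  m : ℕ
  H : Matrix (Fin m) (Fin n) (ZMod 2)

namespace Tanner

variable (T : Tanner)

def checksOf (v : Fin T.n) : Finset (Fin T.m) := Finset.univ.filter fun c => T.H c v ≠ 0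

def varsOf (c : Fin T.m) : Finset (Fin T.n) := Finset.univ.filter fun v => T.H c v ≠ 0

def edges : Finset (Fin T.n × Fin T.m) := Finset.univ.filter fun e => T.H e.2 e.1 ≠ 0

/-- `(dv, dc)`-regular codes of positive blocklength. -/
def Regular (dv dc : ℕ) : Prop :=
  0 < T.n ∧ (∀ v, (T.checksOf v).card = dv) ∧ (∀ c, (T.varsOf c).card = dc)

/-- The bipartite Tanner graph. -/
def graph : SimpleGraph (Fin T.n ⊕ Fin T.m) :=
  SimpleGraph.fromRel fun a b => ∃ v c, a = Sum.inl v ∧ b = Sum.inr c ∧ T.H c v ≠ 0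

/-- The largest number of independent decoding iterations, `⌊(g - 2) / 4⌋` for girth `g`. -/
def maxIter : ℕ := (T.graph.girth - 2) / 4

def codewords : Finset (Fin T.n → ZMod 2) := Finset.univ.filter fun x => T.H.mulVec x = 0

/-! ### Gallager-A decoding -/

/-- The message from variable node `v` to check node `c` in iteration `ℓ` of Gallager-A decoding, for
the channel output `y`. A check node returns to each neighbour the parity of the messages of its other
neighbours; a variable node sends its channel value unless all the other check nodes
contradict it. -/
def varMsg (y : Fin T.n → ZMod 2) : ℕ → Fin T.n → Fin T.m → ZMod 2
  | 0, v, _ => y v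
  | ℓ + 1, v, c =>
      if ∀ c' ∈ (T.checksOf v).erase c,
          ∑ v' ∈ (T.varsOf c').erase v, varMsg y ℓ v' c' = y v + 1
      then y v + 1 else y v

/-- Average bit-error probability after `ℓ` iterations of Gallager-A decoding over the binary symmetric
channel with flip probability `p`: the expected fraction of edges `(v, c)` on which the estimate
of bit `v` that is sent in iteration `ℓ` is wrong, for a uniformly distributed codeword. -/
def bitErrorProb (p : ℝ) (ℓ : ℕ) : ℝ :=
  (∑ x ∈ T.codewords, ∑ e : Fin T.n → ZMod 2,
    bscProb p e *
      (((T.edges.filter fun a => T.varMsg (x + e) ℓ a.1 a.2 ≠ x a.1).card : ℝ)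
        / (T.edges.card : ℝ)))
    / (T.codewords.card : ℝ)

/-! ### VLSI layouts -/

/-- Number of external connections of a processing node. -/
def degree : Fin T.n ⊕ Fin T.m → ℕ
  | Sum.inl v => (T.checksOf v).card
  | Sum.inr c => (T.varsOf c).card

end Tanner

/-- The plane is cut into cells of side `λ`. The horizontal tracks are the rows of cells with even second
coordinate, the vertical tracks are the columns with even first coordinate (track width and track
spacing are both `λ`), and the contact squares are the cells with two even coordinates. -/
abbrev Cell := ℤ × ℤ

/-- Two neighbouring cells of one track. -/
def Cell.Step (p q : Cell) : Prop :=
  (Even p.1 ∧ p.1 = q.1 ∧ (q.2 = p.2 + 1 ∨ p.2 = q.2 + 1)) ∨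
    (Even p.2 ∧ p.2 = q.2 ∧ (q.1 = p.1 + 1 ∨ p.1 = q.1 + 1))

/-- The square of `s × s` cells with lower left cell `p`. -/
def Cell.square (p : Cell) (s : ℕ) : Set Cell :=
  {q | p.1 ≤ q.1 ∧ q.1 < p.1 + s ∧ p.2 ≤ q.2 ∧ q.2 < p.2 + s}

/-- A route passes straight through `p` in horizontal direction. -/
def Cell.StraightH (r : List Cell) (p : Cell) : Prop :=
  [(p.1 - 1, p.2), p, (p.1 + 1, p.2)] <:+: r ∨ [(p.1 + 1, p.2), p, (p.1 - 1, p.2)] <:+: r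

/-- A route passes straight through `p` in vertical direction. -/
def Cell.StraightV (r : List Cell) (p : Cell) : Prop :=
  [(p.1, p.2 - 1), p, (p.1, p.2 + 1)] <:+: r ∨ [(p.1, p.2 + 1), p, (p.1, p.2 - 1)] <:+: r

/-- Side, in cells, of a processing node with `x` external connections: a single contact square
if `x ≤ 4`, and a square of side `x λ` otherwise. -/
def nodeSide (x : ℕ) : ℕ := if x ≤ 4 then 1 else x

namespace Tanner

/-- A fully parallel planar layout of the decoder: one processing node for each node of the Tanner
graph, one wire for each of its edges. -/
structure Layout (T : Tanner) where
  /-- lower left cell of each processing node -/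
  pos : Fin T.n ⊕ Fin T.m → Cell
  pos_contact : ∀ a, Even (pos a).1 ∧ Even (pos a).2
  nodes_disjoint : ∀ a b, a ≠ b →
    Disjoint (Cell.square (pos a) (nodeSide (T.degree a)))
      (Cell.square (pos b) (nodeSide (T.degree b)))
  /-- the cells of the wire of an edge, from the variable node to the check node -/
  wire : Fin T.n → Fin T.m → List Cell
  /-- the cell of the variable node at which the wire is attached -/
  src : Fin T.n → Fin T.m → Cell
  /-- the cell of the check node at which the wire is attached -/
  dst : Fin T.n → Fin T.m → Cell
  src_mem : ∀ v c, (v, c) ∈ T.edges →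
    src v c ∈ Cell.square (pos (Sum.inl v)) (nodeSide (T.degree (Sum.inl v)))
  dst_mem : ∀ v c, (v, c) ∈ T.edges →
    dst v c ∈ Cell.square (pos (Sum.inr c)) (nodeSide (T.degree (Sum.inr c)))
  wire_ne_nil : ∀ v c, (v, c) ∈ T.edges → wire v c ≠ []
  wire_nodup : ∀ v c, (v, c) ∈ T.edges → (wire v c).Nodup
  /-- wires run along the tracks -/
  wire_chain : ∀ v c, (v, c) ∈ T.edges →
    List.IsChain Cell.Step (src v c :: (wire v c ++ [dst v c]))
  /-- no wire passes over a processing node -/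
  wire_avoids : ∀ v c, (v, c) ∈ T.edges → ∀ p ∈ wire v c, ∀ a,
    p ∉ Cell.square (pos a) (nodeSide (T.degree a))
  /-- distinct wires share a cell only where they cross orthogonally -/
  wire_cross : ∀ v c v' c', (v, c) ∈ T.edges → (v', c') ∈ T.edges → (v, c) ≠ (v', c') →
    ∀ p, p ∈ wire v c → p ∈ wire v' c' →
      (Cell.StraightH (src v c :: (wire v c ++ [dst v c])) p ∧
          Cell.StraightV (src v' c' :: (wire v' c' ++ [dst v' c'])) p) ∨
        (Cell.StraightV (src v c :: (wire v c ++ [dst v c])) p ∧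
          Cell.StraightH (src v' c' :: (wire v' c' ++ [dst v' c'])) p)

/-- Total area occupied by the wires, for feature size `lam`. -/
def Layout.wireArea {T : Tanner} (L : T.Layout) (lam : ℝ) : ℝ :=
  lam ^ 2 * ((T.edges.biUnion fun a => (L.wire a.1 a.2).toFinset).card : ℝ)

end Tanner

/-! ### Total power in the wire model -/

/-- The values of the total power `P_T + ξ * A_wires` with which bit-error probability `Pe` is achieved
at transmit power `PT` by a code of the class `𝒞`, a layout of its decoder, and a number of
independent Gallager-A iterations. -/
def totalPowersAt (𝒞 : Set Tanner) (lam ξ η Pe PT : ℝ) : Set ℝ :=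
  {P | ∃ T ∈ 𝒞, ∃ ℓ ≤ T.maxIter, ∃ L : T.Layout,
    T.bitErrorProb (flipProb η PT) ℓ ≤ Pe ∧ P = PT + ξ * L.wireArea lam}

/-- The optimal total power over the class `𝒞`, with free choice of the transmit power. -/
def totalPowerMin (𝒞 : Set Tanner) (lam ξ η Pe : ℝ) : ℝ :=
  sInf {P | ∃ PT, 0 ≤ PT ∧ P ∈ totalPowersAt 𝒞 lam ξ η Pe PT}

/-- The class of all `(dv, dc)`-regular codes. -/
def regularCodes (dv dc : ℕ) : Set Tanner := {T | T.Regular dv dc}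

/-- A construction of `(dv, dc)`-regular codes with growth rate `γ`: for each `N` a code that allows `N`
independent iterations, of blocklength `Θ(exp (γ N))`. -/
def IsConstruction (dv dc : ℕ) (γ : ℝ) (C : ℕ → Tanner) : Prop :=
  (∀ N, (C N).Regular dv dc ∧ N ≤ (C N).maxIter) ∧
    ∃ a A : ℝ, 0 < a ∧ ∀ N : ℕ,
      a * Real.exp (γ * N) ≤ ((C N).n : ℝ) ∧ ((C N).n : ℝ) ≤ A * Real.exp (γ * N)

/-- The range of the constant `γ`. -/
def gammaRange (dv dc : ℕ) : Set ℝ :=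
  Set.Icc (Real.log (((dv : ℝ) - 1) * ((dc : ℝ) - 1))) (3 * Real.log (2 * (dv : ℝ) * (dc : ℝ) + 1))

/-- The scale `(γ / η) * log (1 / Pe) / log (log (1 / Pe))`. -/
def powerScale (γ η Pe : ℝ) : ℝ :=
  γ / η * Real.log (1 / Pe) / Real.log (Real.log (1 / Pe))

end

/-! ### Tail bounds for the normal distribution -/

/-! Write x = log(1/Pe), y = log x, β = log((dv-1)(dc-1)). Everything rests on two estimates for ℓ
independent iterations.

Error probability. By linearity it does not depend on the transmitted codeword. Without short cycles
the computation tree of a message repeats no channel bit, so its messages are independent and the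
error probability is exactly the density evolution x_ℓ (`Tanner.Regular.bitErrorProb_eq`). With p
the flip probability and M = 2(dv dc)², it satisfies p^(ℓ+1) ≤ x_ℓ ≤ (Mp)^(ℓ+1), the upper bound as
soon as Mp ≤ 1 (`densityEvolution_mem`, `densityEvolution_le`). As log(1/p) is of order η P_T,
reaching Pe requires η P_T (ℓ+1) of order x.

Wire area. The same tree contains ((dv-1)(dc-1))^ℓ = e^(βℓ) distinct variable nodes, so n ≥ e^(βℓ),
and any layout has wire area at least λ²n/4 (`Tanner.Regular.le_wireArea`). Conversely a crude
layout, all nodes in one row and a private track for each edge, has area O(n³)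
(`Tanner.Regular.exists_layout`).

Lower bound: either the area term already exceeds x, or βℓ ≤ y + O(1), and then P_T is at least of
order (β/η) x/y (`eventually_le_of_mem_totalPowersAt`). Upper bound: a construction of rate γ with
about y/(6γ) iterations has area O(e^(y/2)) = O(√x), which is negligible, and needs P_T of order
(γ/η) x/y (`exists_mem_totalPowersAt_le`). The cube in the area only affects the constant. The
constants are absolute because the endpoints of the range of γ differ by a factor of at most 9
(`gammaRange_upper_le`).

Constructions exist by an Erdős–Sachs argument: an edge set of maximal size among those with bounded
degrees and no short cycles must be regular, since otherwise adding or switching edges enlarges it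
(`IsSparse.exists_card_succ`).

Uncoded power is of order x/η, whence the factor y. At fixed P_T the number of iterations must grow
like x, so the area grows like e^(const · x), a power of 1/Pe. -/

lemma integrable_exp_neg_sq_div_two : MeasureTheory.Integrable fun u : ℝ => Real.exp (-u ^ 2 / 2) := by
  have := integrable_exp_neg_mul_sq (b := 1 / 2) (by norm_num)
  refine this.congr (Eventually.of_forall fun u => ?_)
  simp only
  congr 1
  ring

lemma integral_Ioi_exp_neg_sq_div_two :
    ∫ u in Set.Ioi (0 : ℝ), Real.exp (-u ^ 2 / 2) = Real.sqrt (2 * Real.pi) / 2 := by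
  have := integral_gaussian_Ioi (1 / 2)
  rw [show Real.pi / (1 / 2) = 2 * Real.pi by ring] at this
  rw [← this]
  congr 1
  funext u
  congr 1
  ring

lemma integral_Ioi_eq_integral_shift (f : ℝ → ℝ) (x : ℝ) :
    ∫ u in Set.Ioi x, f u = ∫ u in Set.Ioi (0 : ℝ), f (u + x) := by
  have := (MeasureTheory.measurePreserving_add_right MeasureTheory.volume x).setIntegral_preimage_emb
    (measurableEmbedding_addRight x) f (Set.Ioi x)
  rw [← this, Set.preimage_add_const_Ioi, sub_self]

/-- After shifting the integral to the origin, (u + x)² ≥ u² + x² for u, x ≥ 0 splits off the factor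
e^(-x²/2) and leaves half of the Gaussian integral. -/
lemma gaussQ_le {x : ℝ} (hx : 0 ≤ x) : gaussQ x ≤ Real.exp (-x ^ 2 / 2) / 2 := by
  have hpi : 0 < Real.sqrt (2 * Real.pi) := Real.sqrt_pos.mpr (by positivity)
  have h : ∫ u in Set.Ioi x, Real.exp (-u ^ 2 / 2) ≤
      Real.exp (-x ^ 2 / 2) * (Real.sqrt (2 * Real.pi) / 2) := by
    rw [integral_Ioi_eq_integral_shift, ← integral_Ioi_exp_neg_sq_div_two,
      ← MeasureTheory.integral_const_mul]
    refine MeasureTheory.setIntegral_mono_on ?_ ?_ measurableSet_Ioi ?_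
    · exact (integrable_exp_neg_sq_div_two.comp_add_right x).integrableOn
    · exact (integrable_exp_neg_sq_div_two.const_mul _).integrableOn
    · intro u hu
      rw [← Real.exp_add]
      apply Real.exp_le_exp.mpr
      have : 0 ≤ u * x := mul_nonneg (le_of_lt hu) hx
      nlinarith
  unfold gaussQ
  calc _ ≤ 1 / Real.sqrt (2 * Real.pi) *
        (Real.exp (-x ^ 2 / 2) * (Real.sqrt (2 * Real.pi) / 2)) := by gcongr
    _ = _ := by field_simp

lemma sqrt_two_pi_le_exp_one : Real.sqrt (2 * Real.pi) ≤ Real.exp 1 := by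
  rw [Real.sqrt_le_left (Real.exp_pos _).le]
  have h1 := Real.exp_one_gt_d9
  have h2 := Real.pi_lt_d2
  nlinarith

/-- Only the interval (x, x + 1] is kept; there u²/2 ≤ (x + 1)²/2 ≤ x² + 1. The exponent x² in place
of x²/2 costs a constant factor in the power. -/
lemma le_gaussQ {x : ℝ} (hx : 0 ≤ x) : Real.exp (-x ^ 2 - 2) ≤ gaussQ x := by
  have hpi : 0 < Real.sqrt (2 * Real.pi) := Real.sqrt_pos.mpr (by positivity)
  have h : Real.exp (-x ^ 2 - 1) ≤ ∫ u in Set.Ioi x, Real.exp (-u ^ 2 / 2) := by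
    calc Real.exp (-x ^ 2 - 1) = ∫ _u in Set.Ioc x (x + 1), Real.exp (-x ^ 2 - 1) := by simp
      _ ≤ ∫ u in Set.Ioc x (x + 1), Real.exp (-u ^ 2 / 2) := by
          refine MeasureTheory.setIntegral_mono_on (by simp)
            integrable_exp_neg_sq_div_two.integrableOn measurableSet_Ioc ?_
          intro u hu
          apply Real.exp_le_exp.mpr
          have h0 : u ≤ x + 1 := hu.2
          have h1 : 0 ≤ u := hx.trans hu.1.le
          nlinarith [sq_nonneg (x - 1)]
      _ ≤ _ := by
          refine MeasureTheory.setIntegral_mono_set integrable_exp_neg_sq_div_two.integrableOn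
            (Eventually.of_forall fun u => (Real.exp_pos _).le) ?_
          exact Set.Ioc_subset_Ioi_self.eventuallyLE
  unfold gaussQ
  calc Real.exp (-x ^ 2 - 2) = 1 / Real.exp 1 * Real.exp (-x ^ 2 - 1) := by
        rw [one_div, ← Real.exp_neg, ← Real.exp_add]; congr 1; ring
    _ ≤ 1 / Real.sqrt (2 * Real.pi) * ∫ u in Set.Ioi x, Real.exp (-u ^ 2 / 2) := by
        gcongr
        exact sqrt_two_pi_le_exp_one

lemma flipProb_le {η PT : ℝ} (hη : 0 < η) (hP : 0 ≤ PT) :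
    flipProb η PT ≤ Real.exp (-(η * PT)) / 2 := by
  have := gaussQ_le (Real.sqrt_nonneg (2 * (η * PT)))
  rw [Real.sq_sqrt (by positivity)] at this
  unfold flipProb
  convert this using 3
  ring

lemma le_flipProb {η PT : ℝ} (hη : 0 < η) (hP : 0 ≤ PT) :
    Real.exp (-(2 * (η * PT) + 2)) ≤ flipProb η PT := by
  have := le_gaussQ (Real.sqrt_nonneg (2 * (η * PT)))
  rw [Real.sq_sqrt (by positivity)] at this
  unfold flipProb
  convert this using 2
  ring

lemma flipProb_pos {η PT : ℝ} (hη : 0 < η) (hP : 0 ≤ PT) : 0 < flipProb η PT :=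
  (Real.exp_pos _).trans_le (le_flipProb hη hP)

lemma flipProb_le_half {η PT : ℝ} (hη : 0 < η) (hP : 0 ≤ PT) : flipProb η PT ≤ 1 / 2 := by
  have h := flipProb_le hη hP
  have : Real.exp (-(η * PT)) ≤ 1 := Real.exp_le_one_iff.mpr (by have := mul_nonneg hη.le hP; linarith)
  linarith

lemma uncodedPower_le {η Pe : ℝ} (hη : 0 < η) (h0 : 0 < Pe) (h1 : Pe < 1) :
    uncodedPower η Pe ≤ Real.log (1 / Pe) / η := by
  have hL : 0 < Real.log (1 / Pe) := Real.log_pos (by rw [lt_div_iff₀ h0]; linarith)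
  refine csInf_le ⟨0, fun P hP => hP.1⟩ ⟨by positivity, ?_⟩
  refine (flipProb_le hη (by positivity)).trans ?_
  rw [mul_div_cancel₀ _ hη.ne', one_div, Real.log_inv, neg_neg, Real.exp_log h0]
  linarith

lemma le_uncodedPower {η Pe : ℝ} (hη : 0 < η) (h0 : 0 < Pe) (h1 : Pe < 1) :
    (Real.log (1 / Pe) - 2) / (2 * η) ≤ uncodedPower η Pe := by
  have hL : 0 < Real.log (1 / Pe) := Real.log_pos (by rw [lt_div_iff₀ h0]; linarith)
  refine le_csInf ⟨Real.log (1 / Pe) / η, by positivity, ?_⟩ ?_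
  · refine (flipProb_le hη (by positivity)).trans ?_
    rw [mul_div_cancel₀ _ hη.ne', one_div, Real.log_inv, neg_neg, Real.exp_log h0]
    linarith
  · rintro P ⟨hP, hPe⟩
    have h := (le_flipProb hη hP).trans hPe
    rw [← Real.le_log_iff_exp_le h0] at h
    rw [div_le_iff₀ (by positivity), one_div, Real.log_inv]
    linarith

/-! ### Expectations over the binary symmetric channel -/

/-- Expectation of `F` over the error patterns of a binary symmetric channel. -/
noncomputable def bscE {n : ℕ} (p : ℝ) (F : (Fin n → ZMod 2) → ℝ) : ℝ := ∑ e, bscProb p e * F e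

section Expectation

variable {n : ℕ} {p : ℝ}

lemma sum_prod_apply (g : Fin n → ZMod 2 → ℝ) :
    ∑ e : Fin n → ZMod 2, ∏ u, g u (e u) = ∏ u, ∑ a, g u a := by
  rw [Finset.prod_univ_sum, Fintype.piFinset_univ]

lemma sum_zmod_two (f : ZMod 2 → ℝ) : ∑ a, f a = f 0 + f 1 := Fin.sum_univ_two f

lemma sum_bscProb : ∑ e : Fin n → ZMod 2, bscProb p e = 1 := by
  unfold bscProb
  rw [sum_prod_apply fun _ a => if a = 0 then 1 - p else p]
  simp [sum_zmod_two]

lemma bscE_const (a : ℝ) : bscE p (fun _ : Fin n → ZMod 2 => a) = a := by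
  rw [bscE, ← Finset.sum_mul, sum_bscProb, one_mul]

lemma bscE_add (F G : (Fin n → ZMod 2) → ℝ) :
    bscE p (fun e => F e + G e) = bscE p F + bscE p G := by
  simp [bscE, mul_add, Finset.sum_add_distrib]

lemma bscE_sub (F G : (Fin n → ZMod 2) → ℝ) :
    bscE p (fun e => F e - G e) = bscE p F - bscE p G := by
  simp [bscE, mul_sub, Finset.sum_sub_distrib]

lemma bscE_const_mul (a : ℝ) (F : (Fin n → ZMod 2) → ℝ) :
    bscE p (fun e => a * F e) = a * bscE p F := by
  simp only [bscE, Finset.mul_sum]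
  exact Finset.sum_congr rfl fun e _ => by ring

/-- The product of expectations is an expectation over two independent copies of the channel.
Swapping the coordinates in `s` between the copies preserves the weight and turns F(x₁)G(x₂) into
F(x₁)G(x₁). -/
lemma bscE_mul {F G : (Fin n → ZMod 2) → ℝ} {s t : Finset (Fin n)} (hF : DependsOn F (s : Set (Fin n)))
    (hG : DependsOn G (t : Set (Fin n))) (hst : Disjoint s t) :
    bscE p (fun e => F e * G e) = bscE p F * bscE p G := by
  classical
  have hinv : Function.Involutive (fun x : (Fin n → ZMod 2) × (Fin n → ZMod 2) =>
      (s.piecewise x.1 x.2, s.piecewise x.2 x.1)) := by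
    rintro ⟨e, e'⟩
    ext v <;> by_cases hv : v ∈ s <;> simp [hv]
  have h1 : bscE p F * bscE p G =
      ∑ x : (Fin n → ZMod 2) × (Fin n → ZMod 2),
        (bscProb p x.1 * bscProb p x.2) * (F x.1 * G x.2) := by
    rw [bscE, bscE, Finset.sum_mul_sum, Fintype.sum_prod_type]
    exact Finset.sum_congr rfl fun e _ => Finset.sum_congr rfl fun e' _ => by ring
  have h2 : bscE p (fun e => F e * G e) =
      ∑ x : (Fin n → ZMod 2) × (Fin n → ZMod 2),
        (bscProb p x.1 * bscProb p x.2) * (F x.1 * G x.1) := by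
    rw [Fintype.sum_prod_type, bscE]
    refine Finset.sum_congr rfl fun e _ => ?_
    have : ∀ e' : Fin n → ZMod 2, bscProb p e * bscProb p e' * (F e * G e) =
        bscProb p e' * (bscProb p e * (F e * G e)) := fun _ => by ring
    simp only [this]
    rw [← Finset.sum_mul, sum_bscProb, one_mul]
  rw [h1, h2]
  symm
  rw [← Equiv.sum_comp (Function.Involutive.toPerm _ hinv)]
  refine Finset.sum_congr rfl fun x _ => ?_
  have hw : bscProb p (s.piecewise x.1 x.2) * bscProb p (s.piecewise x.2 x.1) =
      bscProb p x.1 * bscProb p x.2 := by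
    unfold bscProb
    rw [← Finset.prod_mul_distrib, ← Finset.prod_mul_distrib]
    refine Finset.prod_congr rfl fun v _ => ?_
    by_cases hv : v ∈ s <;> simp [hv, mul_comm]
  have hF' : F (s.piecewise x.1 x.2) = F x.1 := hF fun v hv => by simp [Finset.mem_coe.mp hv]
  have hG' : G (s.piecewise x.2 x.1) = G x.1 := hG fun v hv => by
    simp [Finset.disjoint_right.mp hst (Finset.mem_coe.mp hv)]
  simp [Function.Involutive.coe_toPerm, hw, hF', hG']

lemma DependsOn.finsetProd {ι : Type*} {S : Finset ι} {F : ι → (Fin n → ZMod 2) → ℝ}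
    {D : ι → Finset (Fin n)} (h : ∀ i ∈ S, DependsOn (F i) (D i : Set (Fin n))) :
    DependsOn (fun e => ∏ i ∈ S, F i e) (S.biUnion D : Set (Fin n)) := by
  intro e e' he
  refine Finset.prod_congr rfl fun i hi => h i hi fun v hv => he v ?_
  simp only [Finset.coe_biUnion, Set.mem_iUnion]
  exact ⟨i, hi, hv⟩

lemma bscE_prod {ι : Type*} {S : Finset ι} {F : ι → (Fin n → ZMod 2) → ℝ}
    {D : ι → Finset (Fin n)} (h : ∀ i ∈ S, DependsOn (F i) (D i : Set (Fin n)))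
    (hD : (S : Set ι).PairwiseDisjoint D) :
    bscE p (fun e => ∏ i ∈ S, F i e) = ∏ i ∈ S, bscE p (F i) := by
  classical
  induction S using Finset.induction_on with
  | empty => simp [bscE_const]
  | insert i S hi ih =>
    simp only [Finset.prod_insert hi]
    rw [bscE_mul (h i (Finset.mem_insert_self i S))
      (DependsOn.finsetProd fun j hj => h j (Finset.mem_insert_of_mem hj)) ?_, ih]
    · exact fun j hj => h j (Finset.mem_insert_of_mem hj)
    · exact hD.subset (by simp)
    · rw [Finset.disjoint_biUnion_right]
      intro j hj
      exact hD (by simp) (by simp [hj]) (by rintro rfl; exact hi hj)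

/-- Indicator of a wrong bit. -/
noncomputable def bitInd (x : ZMod 2) : ℝ := if x = 0 then 0 else 1

lemma zmod_two_cases (x : ZMod 2) : x = 0 ∨ x = 1 := by revert x; decide

@[simp] lemma bitInd_zero : bitInd 0 = 0 := by simp [bitInd]

@[simp] lemma bitInd_one : bitInd 1 = 1 := by simp [bitInd]

/-- In signs ±1 a parity is a product, so expectations of check messages factor over independent
inputs. -/
lemma bitSign_sum {ι : Type*} (S : Finset ι) (f : ι → ZMod 2) :
    1 - 2 * bitInd (∑ i ∈ S, f i) = ∏ i ∈ S, (1 - 2 * bitInd (f i)) := by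
  classical
  induction S using Finset.induction_on with
  | empty => simp
  | insert i S hi ih =>
    rw [Finset.sum_insert hi, Finset.prod_insert hi, ← ih]
    have h2 : (1 : ZMod 2) + 1 = 0 := by decide
    rcases zmod_two_cases (f i) with h | h <;>
      rcases zmod_two_cases (∑ j ∈ S, f j) with h' | h' <;> (simp [h, h', h2]; try norm_num)

lemma bscE_bitInd (v : Fin n) : bscE p (fun e => bitInd (e v)) = p := by
  have h : ∀ e : Fin n → ZMod 2, bscProb p e * bitInd (e v) =
      ∏ u, ((if e u = 0 then 1 - p else p) * if u = v then bitInd (e u) else 1) := fun e => by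
    rw [Finset.prod_mul_distrib, Finset.prod_ite_eq' Finset.univ v]
    simp [bscProb]
  simp only [bscE, h]
  rw [sum_prod_apply fun u a => (if a = 0 then 1 - p else p) * if u = v then bitInd a else 1,
    Finset.prod_eq_single v]
  · simp [sum_zmod_two]
  · intro u _ hu
    simp [sum_zmod_two, hu]
  · simp

end Expectation

/-! ### Reduction to the zero codeword -/

namespace Tanner

variable (T : Tanner)

lemma sum_varsOf_erase_codeword {x : Fin T.n → ZMod 2} (hx : x ∈ T.codewords) {v : Fin T.n}
    {c : Fin T.m} (hv : v ∈ T.varsOf c) : ∑ v' ∈ (T.varsOf c).erase v, x v' = x v := by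
  have h : ∑ v' ∈ T.varsOf c, x v' = 0 := by
    have h0 : T.H.mulVec x c = 0 := by
      rw [(Finset.mem_filter.mp hx).2]; rfl
    rw [← h0, Matrix.mulVec, dotProduct, varsOf, Finset.sum_filter]
    refine Finset.sum_congr rfl fun u _ => ?_
    rcases zmod_two_cases (T.H c u) with h | h <;> simp [h]
  rw [← Finset.add_sum_erase _ _ hv] at h
  generalize ∑ v' ∈ (T.varsOf c).erase v, x v' = s at h ⊢
  generalize x v = a at h ⊢
  revert s a
  decide

lemma mem_varsOf_iff {v : Fin T.n} {c : Fin T.m} : v ∈ T.varsOf c ↔ T.H c v ≠ 0 := by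
  simp [varsOf]

lemma mem_checksOf_iff {v : Fin T.n} {c : Fin T.m} : c ∈ T.checksOf v ↔ T.H c v ≠ 0 := by
  simp [checksOf]

lemma mem_edges_iff {a : Fin T.n × Fin T.m} : a ∈ T.edges ↔ T.H a.2 a.1 ≠ 0 := by
  simp [edges]

/-- Both update rules commute with adding a codeword, because the other bits of a codeword at a
check sum to the bit at `v`. Hence the error pattern alone decides which messages are wrong. -/
lemma varMsg_add_codeword {x : Fin T.n → ZMod 2} (hx : x ∈ T.codewords) (e : Fin T.n → ZMod 2)
    (ℓ : ℕ) (v : Fin T.n) (c : Fin T.m) :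
    T.varMsg (x + e) ℓ v c = x v + T.varMsg e ℓ v c := by
  induction ℓ generalizing v c with
  | zero => simp [varMsg]
  | succ ℓ ih =>
    have h : ∀ c' ∈ (T.checksOf v).erase c,
        (∑ v' ∈ (T.varsOf c').erase v, T.varMsg (x + e) ℓ v' c' = (x + e) v + 1 ↔
          ∑ v' ∈ (T.varsOf c').erase v, T.varMsg e ℓ v' c' = e v + 1) := by
      intro c' hc'
      have hv : v ∈ T.varsOf c' :=
        T.mem_varsOf_iff.mpr (T.mem_checksOf_iff.mp (Finset.mem_of_mem_erase hc'))
      simp only [ih, Finset.sum_add_distrib, T.sum_varsOf_erase_codeword hx hv, Pi.add_apply,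
        add_assoc, add_right_inj]
    rw [varMsg, varMsg, if_congr (forall₂_congr h) rfl rfl]
    split_ifs <;> simp [add_assoc]

lemma zero_mem_codewords : (0 : Fin T.n → ZMod 2) ∈ T.codewords := by simp [codewords]

lemma bitErrorProb_eq (p : ℝ) (ℓ : ℕ) :
    T.bitErrorProb p ℓ =
      (∑ a ∈ T.edges, bscE p (fun e => bitInd (T.varMsg e ℓ a.1 a.2))) / (T.edges.card : ℝ) := by
  have h : ∀ x ∈ T.codewords, ∑ e : Fin T.n → ZMod 2,
      bscProb p e * (((T.edges.filter fun a => T.varMsg (x + e) ℓ a.1 a.2 ≠ x a.1).card : ℝ)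
        / (T.edges.card : ℝ)) =
      (∑ a ∈ T.edges, bscE p (fun e => bitInd (T.varMsg e ℓ a.1 a.2))) / (T.edges.card : ℝ) := by
    intro x hx
    simp only [bscE]
    rw [Finset.sum_comm, Finset.sum_div]
    refine Finset.sum_congr rfl fun e _ => ?_
    rw [← Finset.mul_sum, mul_div_assoc]
    congr 2
    rw [Finset.card_filter, Nat.cast_sum]
    refine Finset.sum_congr rfl fun a _ => ?_
    rw [T.varMsg_add_codeword hx]
    by_cases h : T.varMsg e ℓ a.1 a.2 = 0 <;> simp [h, bitInd]
  rw [bitErrorProb, Finset.sum_congr rfl h, Finset.sum_const, nsmul_eq_mul]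
  have : (T.codewords.card : ℝ) ≠ 0 := by
    exact_mod_cast (Finset.card_pos.mpr ⟨0, T.zero_mem_codewords⟩).ne'
  field_simp

end Tanner

/-! ### Short cycles and paths -/

namespace SimpleGraph

variable {V : Type*} {G : SimpleGraph V}

/-- All cycles of `G` are longer than `r`. -/
def CyclesLongerThan (G : SimpleGraph V) (r : ℕ) : Prop :=
  ∀ ⦃u : V⦄ (w : G.Walk u u), w.IsCycle → r < w.length

lemma CyclesLongerThan.mono {r s : ℕ} (h : G.CyclesLongerThan s) (hrs : r ≤ s) :
    G.CyclesLongerThan r := fun _ w hw => hrs.trans_lt (h w hw)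

lemma Walk.head?_support {u v : V} (p : G.Walk u v) : p.support.head? = some u := by
  cases p <;> simp

/-- Paths in a forest are unique, so the union of the two paths contains a cycle. A cycle uses each
edge once, which bounds its length by the number of edges available. -/
lemma Walk.IsPath.exists_cycle_of_ne {u v : V} {p q : G.Walk u v} (hp : p.IsPath) (hq : q.IsPath)
    (hne : p ≠ q) : ∃ (a : V) (w : G.Walk a a), w.IsCycle ∧ w.length ≤ p.length + q.length := by
  classical
  set S : Set (Sym2 V) := {e | e ∈ p.edges ++ q.edges} with hS
  have hSG : S ⊆ G.edgeSet := by
    intro e he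
    rcases List.mem_append.mp he with h | h
    exacts [p.edges_subset_edgeSet h, q.edges_subset_edgeSet h]
  set K := fromEdgeSet S with hK
  have hKe : K.edgeSet = S := by
    rw [hK, edgeSet_fromEdgeSet]
    ext e
    simp only [Set.mem_sdiff, and_iff_left_iff_imp]
    exact fun he => G.not_isDiag_of_mem_edgeSet (hSG he)
  have hKG : K ≤ G := by rw [← edgeSet_subset_edgeSet, hKe]; exact hSG
  have hp' : ∀ e ∈ p.edges, e ∈ K.edgeSet := fun e he => by
    rw [hKe]; exact List.mem_append_left _ he
  have hq' : ∀ e ∈ q.edges, e ∈ K.edgeSet := fun e he => by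
    rw [hKe]; exact List.mem_append_right _ he
  have hnac : ¬ K.IsAcyclic := by
    intro hac
    have := (hac.subsingleton_path u v).elim ⟨p.transfer K hp', hp.transfer hp'⟩
      ⟨q.transfer K hq', hq.transfer hq'⟩
    have h := congrArg (fun w : K.Path u v => (w : K.Walk u v).support) this
    simp only [Walk.support_transfer] at h
    exact hne (Walk.ext_support h)
  simp only [IsAcyclic, not_forall, not_not] at hnac
  obtain ⟨a, w, hw⟩ := hnac
  refine ⟨a, w.mapLe hKG, hw.mapLe hKG, ?_⟩
  rw [Walk.length_mapLe, ← Walk.length_edges, ← Walk.length_edges p, ← Walk.length_edges q,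
    ← List.length_append]
  refine (List.Nodup.subperm hw.isCircuit.isTrail.edges_nodup ?_).length_le
  intro e he
  have := w.edges_subset_edgeSet he
  rw [hKe] at this
  exact this

/-- Otherwise the part of `p` up to `b` and the edge `ab` would close up to a cycle of length at
most `r`. -/
lemma CyclesLongerThan.notMem_support {r : ℕ} (h : G.CyclesLongerThan r) {a b u : V}
    {p : G.Walk a u} (hp : p.IsPath) (hab : G.Adj a b) (he : s(a, b) ∉ p.edges)
    (hlen : p.length + 1 ≤ r) : b ∉ p.support := by
  classical
  intro hb
  have hc : (Walk.cons hab.symm (p.takeUntil b hb)).IsCycle := by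
    rw [Walk.cons_isCycle_iff]
    refine ⟨hp.takeUntil hb, fun h' => he ?_⟩
    rw [Sym2.eq_swap]
    exact p.edges_takeUntil_subset_edges hb h'
  have h1 := h _ hc
  have h2 := p.length_takeUntil_le_length hb
  rw [Walk.length_cons] at h1
  omega

end SimpleGraph

/-! ### Computation trees -/

namespace Tanner

variable (T : Tanner)

lemma graph_adj_inl_inr {v : Fin T.n} {c : Fin T.m} :
    T.graph.Adj (Sum.inl v) (Sum.inr c) ↔ T.H c v ≠ 0 := by
  simp [graph]

/-- The variable nodes whose channel values enter the message from `v` to `c` in iteration `ℓ`. -/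
def depSet : ℕ → Fin T.n → Fin T.m → Finset (Fin T.n)
  | 0, v, _ => {v}
  | ℓ + 1, v, c => insert v (((T.checksOf v).erase c).biUnion fun c' =>
      ((T.varsOf c').erase v).biUnion fun v' => depSet ℓ v' c')

lemma dependsOn_varMsg (ℓ : ℕ) (v : Fin T.n) (c : Fin T.m) :
    DependsOn (fun y => T.varMsg y ℓ v c) (T.depSet ℓ v c : Set (Fin T.n)) := by
  induction ℓ generalizing v c with
  | zero =>
    intro y y' h
    exact h v (by simp [depSet])
  | succ ℓ ih =>
    intro y y' h
    have hv : y v = y' v := h v (by simp [depSet])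
    have hs : ∀ c' ∈ (T.checksOf v).erase c, ∀ v' ∈ (T.varsOf c').erase v,
        T.varMsg y ℓ v' c' = T.varMsg y' ℓ v' c' := by
      intro c' hc' v' hv'
      refine ih v' c' fun u hu => h u ?_
      simp only [depSet, Finset.coe_insert, Finset.coe_biUnion, Set.mem_insert_iff, Set.mem_iUnion]
      exact Or.inr ⟨c', hc', v', hv', hu⟩
    simp only [varMsg]
    have hcond : ∀ c' ∈ (T.checksOf v).erase c,
        (∑ v' ∈ (T.varsOf c').erase v, T.varMsg y ℓ v' c' = y v + 1 ↔
          ∑ v' ∈ (T.varsOf c').erase v, T.varMsg y' ℓ v' c' = y' v + 1) := fun c' hc' => by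
      rw [Finset.sum_congr rfl (hs c' hc'), hv]
    rw [if_congr (forall₂_congr hcond) rfl rfl, hv]

variable {T}

/-- One level of the computation tree adds two edges in front of a path. The clause on edges lets
`notMem_support` be applied again one level higher. -/
lemma exists_path_cons {r ℓ : ℕ} (hr : T.graph.CyclesLongerThan r) {v v' u : Fin T.n}
    {c' : Fin T.m} (hℓ : 2 * ℓ + 2 ≤ r) (hc' : c' ∈ T.checksOf v)
    (hv' : v' ∈ (T.varsOf c').erase v) {p : T.graph.Walk (Sum.inl v') (Sum.inl u)} (hp : p.IsPath)
    (hlen : p.length ≤ 2 * ℓ) (hc : Sum.inr c' ∉ p.support) :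
    ∃ q : T.graph.Walk (Sum.inl v) (Sum.inl u), q.IsPath ∧ q.length ≤ 2 * ℓ + 2 ∧
      q.support = Sum.inl v :: Sum.inr c' :: p.support ∧
      ∀ c, c ≠ c' → s(Sum.inl v, Sum.inr c) ∉ q.edges := by
  have h1 : T.graph.Adj (Sum.inl v) (Sum.inr c') :=
    T.graph_adj_inl_inr.mpr (T.mem_checksOf_iff.mp hc')
  have h2 : T.graph.Adj (Sum.inr c') (Sum.inl v') :=
    (T.graph_adj_inl_inr.mpr (T.mem_varsOf_iff.mp (Finset.mem_of_mem_erase hv'))).symm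
  have hq : (SimpleGraph.Walk.cons h2 p).IsPath := by
    rw [SimpleGraph.Walk.cons_isPath_iff]; exact ⟨hp, hc⟩
  have hv : Sum.inl v ∉ (SimpleGraph.Walk.cons h2 p).support := by
    refine hr.notMem_support hq h1.symm ?_ (by rw [SimpleGraph.Walk.length_cons]; omega)
    rw [SimpleGraph.Walk.edges_cons, List.mem_cons, not_or]
    constructor
    · have := Finset.ne_of_mem_erase hv'
      simpa using this.symm
    · exact fun h => hc (p.fst_mem_support_of_mem_edges h)
  refine ⟨SimpleGraph.Walk.cons h1 (SimpleGraph.Walk.cons h2 p), ?_, ?_, ?_, ?_⟩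
  · rw [SimpleGraph.Walk.cons_isPath_iff]; exact ⟨hq, hv⟩
  · simp only [SimpleGraph.Walk.length_cons]; omega
  · simp
  · intro c hc he
    rw [SimpleGraph.Walk.edges_cons, List.mem_cons] at he
    rcases he with he | he
    · exact hc (by simpa using he)
    · exact hv (SimpleGraph.Walk.fst_mem_support_of_mem_edges _ he)

/-- That the path avoids `c` is the invariant of the induction: it permits the parent to prepend
`c`. -/
lemma exists_path_of_mem_depSet {ℓ : ℕ} (hr : T.graph.CyclesLongerThan (4 * ℓ)) {v u : Fin T.n}
    {c : Fin T.m} (hc : c ∈ T.checksOf v) (hu : u ∈ T.depSet ℓ v c) :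
    ∃ p : T.graph.Walk (Sum.inl v) (Sum.inl u), p.IsPath ∧ p.length ≤ 2 * ℓ ∧
      Sum.inr c ∉ p.support := by
  induction ℓ generalizing v c with
  | zero =>
    obtain rfl : u = v := by simpa [depSet] using hu
    exact ⟨.nil, by simp, by simp, by simp⟩
  | succ ℓ ih =>
    rw [depSet, Finset.mem_insert] at hu
    rcases hu with rfl | hu
    · exact ⟨.nil, by simp, by simp, by simp⟩
    simp only [Finset.mem_biUnion] at hu
    obtain ⟨c', hc', v', hv', hu⟩ := hu
    have hc'v := Finset.mem_of_mem_erase hc'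
    obtain ⟨p, hp, hlen, hcp⟩ := ih (hr.mono (by omega)) (T.mem_checksOf_iff.mpr
      (T.mem_varsOf_iff.mp (Finset.mem_of_mem_erase hv'))) hu
    obtain ⟨q, hq, hql, -, hqe⟩ := exists_path_cons hr (by omega) hc'v hv' hp hlen hcp
    exact ⟨q, hq, by omega, hr.notMem_support hq
      (T.graph_adj_inl_inr.mpr (T.mem_checksOf_iff.mp hc))
      (hqe c (Finset.ne_of_mem_erase hc').symm) (by omega)⟩

lemma exists_path_of_mem_depSet_child {ℓ : ℕ} (hr : T.graph.CyclesLongerThan (4 * (ℓ + 1)))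
    {v v' u : Fin T.n} {c' : Fin T.m} (hc' : c' ∈ T.checksOf v)
    (hv' : v' ∈ (T.varsOf c').erase v) (hu : u ∈ T.depSet ℓ v' c') :
    ∃ (p : T.graph.Walk (Sum.inl v') (Sum.inl u)) (q : T.graph.Walk (Sum.inl v) (Sum.inl u)),
      q.IsPath ∧ q.length ≤ 2 * ℓ + 2 ∧ q.support = Sum.inl v :: Sum.inr c' :: p.support := by
  obtain ⟨p, hp, hlen, hcp⟩ := exists_path_of_mem_depSet (hr.mono (by omega))
    (T.mem_checksOf_iff.mpr (T.mem_varsOf_iff.mp (Finset.mem_of_mem_erase hv'))) hu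
  obtain ⟨q, hq, hql, hqs, -⟩ := exists_path_cons hr (by omega) hc' hv' hp hlen hcp
  exact ⟨p, q, hq, hql, hqs⟩

lemma notMem_depSet_child {ℓ : ℕ} (hr : T.graph.CyclesLongerThan (4 * (ℓ + 1)))
    {v v' : Fin T.n} {c' : Fin T.m} (hc' : c' ∈ T.checksOf v) (hv' : v' ∈ (T.varsOf c').erase v) :
    v ∉ T.depSet ℓ v' c' := by
  intro hu
  obtain ⟨p, q, hq, -, hs⟩ := exists_path_of_mem_depSet_child hr hc' hv' hu
  have := hq.support_nodup
  rw [hs, List.nodup_cons] at this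
  exact this.1 (List.mem_cons_of_mem _ p.end_mem_support)

/-- A common node would be the end of two paths from `v` that differ in their first two steps.
Together they have length at most 2(2ℓ + 2) = 4(ℓ + 1), so they would produce a forbidden cycle. -/
lemma disjoint_depSet_child {ℓ : ℕ} (hr : T.graph.CyclesLongerThan (4 * (ℓ + 1)))
    {v v₁ v₂ : Fin T.n} {c₁ c₂ : Fin T.m} (hc₁ : c₁ ∈ T.checksOf v)
    (hv₁ : v₁ ∈ (T.varsOf c₁).erase v) (hc₂ : c₂ ∈ T.checksOf v)
    (hv₂ : v₂ ∈ (T.varsOf c₂).erase v) (hne : (c₁, v₁) ≠ (c₂, v₂)) :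
    Disjoint (T.depSet ℓ v₁ c₁) (T.depSet ℓ v₂ c₂) := by
  rw [Finset.disjoint_left]
  intro u hu₁ hu₂
  obtain ⟨p₁, q₁, hq₁, hl₁, hs₁⟩ := exists_path_of_mem_depSet_child hr hc₁ hv₁ hu₁
  obtain ⟨p₂, q₂, hq₂, hl₂, hs₂⟩ := exists_path_of_mem_depSet_child hr hc₂ hv₂ hu₂
  have hq : q₁ ≠ q₂ := by
    rintro rfl
    rw [hs₁] at hs₂
    simp only [List.cons.injEq, Sum.inr.injEq, true_and] at hs₂
    apply hne
    have h := congrArg List.head? hs₂.2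
    rw [p₁.head?_support, p₂.head?_support] at h
    simp only [Option.some.injEq, Sum.inl.injEq] at h
    exact Prod.ext hs₂.1 h
  obtain ⟨a, w, hw, hl⟩ := hq₁.exists_cycle_of_ne hq₂ hq
  have := hr w hw
  omega

end Tanner

/-! ### Density evolution -/

/-- Error probability of the parity of `k` independent bits that are wrong with probability `x`. -/
noncomputable def parityError (k : ℕ) (x : ℝ) : ℝ := (1 - (1 - 2 * x) ^ k) / 2

/-- Density evolution of Gallager-A decoding. -/
noncomputable def densityEvolution (p : ℝ) (dv dc : ℕ) : ℕ → ℝ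
  | 0 => p
  | ℓ + 1 => p * (1 - (1 - parityError (dc - 1) (densityEvolution p dv dc ℓ)) ^ (dv - 1)) +
      (1 - p) * parityError (dc - 1) (densityEvolution p dv dc ℓ) ^ (dv - 1)

namespace Tanner

variable {T : Tanner} {dv dc : ℕ}

/-- The variable nodes whose channel values enter the message from `c'` to `v`. -/
def checkDepSet (T : Tanner) (ℓ : ℕ) (v : Fin T.n) (c' : Fin T.m) : Finset (Fin T.n) :=
  ((T.varsOf c').erase v).biUnion fun v' => T.depSet ℓ v' c'

lemma depSet_succ (ℓ : ℕ) (v : Fin T.n) (c : Fin T.m) :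
    T.depSet (ℓ + 1) v c =
      insert v (((T.checksOf v).erase c).biUnion (T.checkDepSet ℓ v)) := rfl

lemma pairwiseDisjoint_depSet {ℓ : ℕ} (hr : T.graph.CyclesLongerThan (4 * (ℓ + 1)))
    {v : Fin T.n} {c' : Fin T.m} (hc' : c' ∈ T.checksOf v) :
    ((T.varsOf c').erase v : Set (Fin T.n)).PairwiseDisjoint fun v' => T.depSet ℓ v' c' := by
  intro v₁ h₁ v₂ h₂ hne
  exact disjoint_depSet_child hr hc' (by exact_mod_cast h₁) hc' (by exact_mod_cast h₂)
    (by simpa using hne)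

lemma pairwiseDisjoint_checkDepSet {ℓ : ℕ} (hr : T.graph.CyclesLongerThan (4 * (ℓ + 1)))
    (v : Fin T.n) (c : Fin T.m) :
    ((T.checksOf v).erase c : Set (Fin T.m)).PairwiseDisjoint (T.checkDepSet ℓ v) := by
  intro c₁ h₁ c₂ h₂ hne
  simp only [Function.onFun, checkDepSet, Finset.disjoint_biUnion_left,
    Finset.disjoint_biUnion_right]
  intro v₁ hv₁ v₂ hv₂
  have h₁' : c₁ ∈ (T.checksOf v).erase c := by exact_mod_cast h₁
  have h₂' : c₂ ∈ (T.checksOf v).erase c := by exact_mod_cast h₂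
  exact disjoint_depSet_child hr (Finset.mem_of_mem_erase h₁') hv₂
    (Finset.mem_of_mem_erase h₂') hv₁ (by simp [hne])

lemma notMem_biUnion_checkDepSet {ℓ : ℕ} (hr : T.graph.CyclesLongerThan (4 * (ℓ + 1)))
    (v : Fin T.n) (c : Fin T.m) : v ∉ ((T.checksOf v).erase c).biUnion (T.checkDepSet ℓ v) := by
  simp only [checkDepSet, Finset.mem_biUnion, not_exists, not_and]
  exact fun c' hc' v' hv' => notMem_depSet_child hr (Finset.mem_of_mem_erase hc') hv'

lemma Regular.card_erase_checksOf (h : T.Regular dv dc) {v : Fin T.n} {c : Fin T.m}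
    (hc : c ∈ T.checksOf v) : ((T.checksOf v).erase c).card = dv - 1 := by
  rw [Finset.card_erase_of_mem hc, h.2.1]

lemma Regular.card_erase_varsOf (h : T.Regular dv dc) {v : Fin T.n} {c : Fin T.m}
    (hc : c ∈ T.checksOf v) : ((T.varsOf c).erase v).card = dc - 1 := by
  rw [Finset.card_erase_of_mem (T.mem_varsOf_iff.mpr (T.mem_checksOf_iff.mp hc)), h.2.2]

/-- The subtrees below `v` are disjoint, so their sizes add up over (dv - 1)(dc - 1) children at
each level. -/
lemma Regular.pow_le_card_depSet (h : T.Regular dv dc) {ℓ : ℕ}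
    (hr : T.graph.CyclesLongerThan (4 * ℓ)) {v : Fin T.n} {c : Fin T.m} (hc : c ∈ T.checksOf v) :
    ((dv - 1) * (dc - 1)) ^ ℓ ≤ (T.depSet ℓ v c).card := by
  induction ℓ generalizing v c with
  | zero => simp [depSet]
  | succ ℓ ih =>
    calc ((dv - 1) * (dc - 1)) ^ (ℓ + 1)
        = ∑ c' ∈ (T.checksOf v).erase c, ∑ v' ∈ (T.varsOf c').erase v,
            ((dv - 1) * (dc - 1)) ^ ℓ := by
          rw [Finset.sum_congr rfl fun c' hc' => by
            rw [Finset.sum_const, h.card_erase_varsOf (Finset.mem_of_mem_erase hc')]]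
          rw [Finset.sum_const, h.card_erase_checksOf hc, smul_eq_mul, smul_eq_mul]
          ring
      _ ≤ ∑ c' ∈ (T.checksOf v).erase c, ∑ v' ∈ (T.varsOf c').erase v,
            (T.depSet ℓ v' c').card := by
          refine Finset.sum_le_sum fun c' hc' => Finset.sum_le_sum fun v' hv' => ?_
          exact ih (hr.mono (by omega))
            (T.mem_checksOf_iff.mpr (T.mem_varsOf_iff.mp (Finset.mem_of_mem_erase hv')))
      _ = (((T.checksOf v).erase c).biUnion (T.checkDepSet ℓ v)).card := by
          rw [Finset.card_biUnion (pairwiseDisjoint_checkDepSet hr v c)]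
          refine Finset.sum_congr rfl fun c' hc' => ?_
          rw [checkDepSet,
            Finset.card_biUnion (pairwiseDisjoint_depSet hr (Finset.mem_of_mem_erase hc'))]
      _ ≤ _ := by
          rw [depSet_succ]
          exact Finset.card_le_card (Finset.subset_insert _ _)

lemma Regular.exists_mem_checksOf (h : T.Regular dv dc) (hdv : 0 < dv) :
    ∃ (v : Fin T.n) (c : Fin T.m), c ∈ T.checksOf v := by
  have hv := h.2.1 ⟨0, h.1⟩
  obtain ⟨c, hc⟩ := Finset.card_pos.mp (hv ▸ hdv)
  exact ⟨_, c, hc⟩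

lemma Regular.pow_le_n (h : T.Regular dv dc) (hdv : 0 < dv) {ℓ : ℕ}
    (hr : T.graph.CyclesLongerThan (4 * ℓ)) : ((dv - 1) * (dc - 1)) ^ ℓ ≤ T.n := by
  obtain ⟨v, c, hc⟩ := h.exists_mem_checksOf hdv
  exact (h.pow_le_card_depSet hr hc).trans (card_finset_fin_le _)

lemma cyclesLongerThan_of_le_maxIter {ℓ : ℕ} (h : ℓ ≤ T.maxIter) :
    T.graph.CyclesLongerThan (4 * ℓ) := by
  intro u w hw
  have h1 := SimpleGraph.girth_le_length hw
  have h2 := hw.three_le_length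
  unfold maxIter at h
  omega

/-- In a forest the tree bound would hold at every depth, in particular at depth n, where it exceeds
n. This is needed because the girth of an acyclic graph is 0 by convention, which would make
`maxIter` vanish. -/
lemma Regular.not_isAcyclic (h : T.Regular dv dc) (hdv : 3 ≤ dv) (hdc : 3 ≤ dc) :
    ¬ T.graph.IsAcyclic := by
  intro hac
  have h1 := h.pow_le_n (by omega) (ℓ := T.n) fun u w hw => absurd hw (hac w)
  have h2 : 1 < (dv - 1) * (dc - 1) :=
    Nat.lt_of_lt_of_le (by norm_num : 1 < 2 * 2) (Nat.mul_le_mul (by omega) (by omega))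
  have h3 := Nat.lt_pow_self h2 (n := T.n)
  omega

lemma Regular.le_maxIter (h : T.Regular dv dc) (hdv : 3 ≤ dv) (hdc : 3 ≤ dc) {N : ℕ}
    (hr : T.graph.CyclesLongerThan (4 * N + 1)) : N ≤ T.maxIter := by
  obtain ⟨u, w, hw, hlen⟩ := SimpleGraph.exists_girth_eq_length.mpr (h.not_isAcyclic hdv hdc)
  have := hr w hw
  unfold maxIter
  omega

/-- The parity that `c'` sends to `v` after iteration `ℓ`. -/
def checkMsg (T : Tanner) (y : Fin T.n → ZMod 2) (ℓ : ℕ) (v : Fin T.n) (c' : Fin T.m) : ZMod 2 :=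
  ∑ v' ∈ (T.varsOf c').erase v, T.varMsg y ℓ v' c'

lemma dependsOn_checkMsg (ℓ : ℕ) (v : Fin T.n) (c' : Fin T.m) :
    DependsOn (fun y => T.checkMsg y ℓ v c') (T.checkDepSet ℓ v c' : Set (Fin T.n)) := by
  intro y y' h
  refine Finset.sum_congr rfl fun v' hv' => T.dependsOn_varMsg ℓ v' c' fun u hu => h u ?_
  simp only [checkDepSet, Finset.coe_biUnion, Set.mem_iUnion]
  exact ⟨v', hv', hu⟩

/-- With zero transmitted, a message is wrong if the received bit is wrong and not all other checks
are right, or if it is right and all other checks are wrong. In polynomial form the expectation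
factors by independence. -/
lemma bitInd_varMsg_succ (y : Fin T.n → ZMod 2) (ℓ : ℕ) {v : Fin T.n} {c : Fin T.m} :
    bitInd (T.varMsg y (ℓ + 1) v c) =
      bitInd (y v) * (1 - ∏ c' ∈ (T.checksOf v).erase c, (1 - bitInd (T.checkMsg y ℓ v c'))) +
        (1 - bitInd (y v)) * ∏ c' ∈ (T.checksOf v).erase c, bitInd (T.checkMsg y ℓ v c') := by
  have hdef : T.varMsg y (ℓ + 1) v c =
      if ∀ c' ∈ (T.checksOf v).erase c, T.checkMsg y ℓ v c' = y v + 1 then y v + 1 else y v := rfl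
  have h2 : (1 : ZMod 2) + 1 = 0 := by decide
  rw [hdef]
  rcases zmod_two_cases (y v) with hy | hy <;> simp only [hy, h2, zero_add]
  · split_ifs with hall
    · rw [Finset.prod_eq_one (f := fun c' => bitInd (T.checkMsg y ℓ v c'))
        fun c' hc' => by rw [hall c' hc', bitInd_one]]
      simp
    · push Not at hall
      obtain ⟨c', hc', hne⟩ := hall
      rw [Finset.prod_eq_zero (f := fun c' => bitInd (T.checkMsg y ℓ v c')) hc'
        (by rw [(zmod_two_cases _).resolve_right hne, bitInd_zero])]
      simp
  · split_ifs with hall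
    · rw [Finset.prod_congr rfl fun c' hc' => by rw [hall c' hc']]
      simp
    · push Not at hall
      obtain ⟨c', hc', hne⟩ := hall
      rw [Finset.prod_eq_zero (f := fun c' => 1 - bitInd (T.checkMsg y ℓ v c')) hc'
        (by rw [(zmod_two_cases _).resolve_left hne, bitInd_one, sub_self])]
      simp

/-- The channel bit at `v` and the incoming check messages depend on disjoint sets of channel bits,
and so do the inputs of each check. Therefore every product in the recursion can be averaged factor
by factor. -/
theorem Regular.bscE_varMsg (h : T.Regular dv dc) (p : ℝ) {ℓ : ℕ}
    (hr : T.graph.CyclesLongerThan (4 * ℓ)) {v : Fin T.n} {c : Fin T.m} (hc : c ∈ T.checksOf v) :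
    bscE p (fun e => bitInd (T.varMsg e ℓ v c)) = densityEvolution p dv dc ℓ := by
  induction ℓ generalizing v c with
  | zero => exact bscE_bitInd v
  | succ ℓ ih =>
    have hcheck : ∀ c' ∈ (T.checksOf v).erase c, bscE p (fun e => bitInd (T.checkMsg e ℓ v c')) =
        parityError (dc - 1) (densityEvolution p dv dc ℓ) := by
      intro c' hc'
      have hc'v := Finset.mem_of_mem_erase hc'
      have h1 : bscE p (fun e => 1 - 2 * bitInd (T.checkMsg e ℓ v c')) =
          (1 - 2 * densityEvolution p dv dc ℓ) ^ (dc - 1) := by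
        simp only [checkMsg, bitSign_sum]
        rw [bscE_prod (D := fun v' => T.depSet ℓ v' c')
          (F := fun v' e => 1 - 2 * bitInd (T.varMsg e ℓ v' c')) ?_
          (pairwiseDisjoint_depSet hr hc'v)]
        · rw [← h.card_erase_varsOf hc'v, ← Finset.prod_const]
          refine Finset.prod_congr rfl fun v' hv' => ?_
          rw [bscE_sub, bscE_const, bscE_const_mul, ih (hr.mono (by omega))
            (T.mem_checksOf_iff.mpr (T.mem_varsOf_iff.mp (Finset.mem_of_mem_erase hv')))]
        · intro v' _ y y' hy
          simp only
          rw [show T.varMsg y ℓ v' c' = T.varMsg y' ℓ v' c' from T.dependsOn_varMsg ℓ v' c' hy]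
      rw [bscE_sub, bscE_const, bscE_const_mul] at h1
      rw [parityError]
      linarith
    have hdep : ∀ (f : ℝ → ℝ) (c' : Fin T.m), DependsOn (fun e => f (bitInd (T.checkMsg e ℓ v c')))
        (T.checkDepSet ℓ v c' : Set (Fin T.n)) := by
      intro f c' y y' hy
      simp only
      rw [show T.checkMsg y ℓ v c' = T.checkMsg y' ℓ v c' from dependsOn_checkMsg ℓ v c' hy]
    have hdepv : ∀ f : ℝ → ℝ, DependsOn (fun e : Fin T.n → ZMod 2 => f (bitInd (e v)))
        (({v} : Finset (Fin T.n)) : Set (Fin T.n)) := by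
      intro f y y' hy
      simp only
      rw [hy v (by simp)]
    have hprod : ∀ f : ℝ → ℝ, bscE p (fun e => ∏ c' ∈ (T.checksOf v).erase c,
        f (bitInd (T.checkMsg e ℓ v c'))) = ∏ c' ∈ (T.checksOf v).erase c,
          bscE p (fun e => f (bitInd (T.checkMsg e ℓ v c'))) := fun f =>
      bscE_prod (F := fun c' e => f (bitInd (T.checkMsg e ℓ v c')))
        (fun c' _ => hdep f c') (pairwiseDisjoint_checkDepSet hr v c)
    have hdisj : Disjoint {v} (((T.checksOf v).erase c).biUnion (T.checkDepSet ℓ v)) :=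
      Finset.disjoint_singleton_left.mpr (notMem_biUnion_checkDepSet hr v c)
    simp only [bitInd_varMsg_succ]
    have hdep1 : DependsOn (fun e => 1 - ∏ c' ∈ (T.checksOf v).erase c,
        (1 - bitInd (T.checkMsg e ℓ v c')))
        ((((T.checksOf v).erase c).biUnion (T.checkDepSet ℓ v) : Finset _) : Set (Fin T.n)) := by
      intro y y' hy
      exact congrArg (fun z => 1 - z)
        (DependsOn.finsetProd (fun c' _ => hdep (fun x => 1 - x) c') hy)
    rw [bscE_add, bscE_mul (hdepv fun x => x) hdep1 hdisj,
      bscE_mul (hdepv fun x => 1 - x)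
        (DependsOn.finsetProd fun c' _ => hdep (fun x => x) c') hdisj, bscE_sub, bscE_sub,
      bscE_const, hprod fun x => 1 - x, hprod fun x => x, bscE_bitInd,
      Finset.prod_congr rfl hcheck, Finset.prod_congr rfl fun c' hc' => by
        rw [bscE_sub, bscE_const, hcheck c' hc'], Finset.prod_const, Finset.prod_const,
      h.card_erase_checksOf hc]
    rfl

theorem Regular.bitErrorProb_eq (h : T.Regular dv dc) (hdv : 0 < dv) (p : ℝ) {ℓ : ℕ}
    (hℓ : ℓ ≤ T.maxIter) : T.bitErrorProb p ℓ = densityEvolution p dv dc ℓ := by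
  obtain ⟨v, c, hc⟩ := h.exists_mem_checksOf hdv
  have hne : (T.edges.card : ℝ) ≠ 0 := by
    have : 0 < T.edges.card :=
      Finset.card_pos.mpr ⟨(v, c), T.mem_edges_iff.mpr (T.mem_checksOf_iff.mp hc)⟩
    exact_mod_cast this.ne'
  rw [T.bitErrorProb_eq, Finset.sum_congr rfl fun a ha => h.bscE_varMsg p
    (cyclesLongerThan_of_le_maxIter hℓ) (T.mem_checksOf_iff.mpr (T.mem_edges_iff.mp ha)),
    Finset.sum_const, nsmul_eq_mul]
  field_simp

end Tanner

/-! ### Bounds on the density evolution -/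

section DensityEvolution

lemma parityError_mem {k : ℕ} {x : ℝ} (hk : 1 ≤ k) (h0 : 0 ≤ x) (h1 : x ≤ 1 / 2) :
    x ≤ parityError k x ∧ parityError k x ≤ 1 / 2 := by
  have h2 : 0 ≤ 1 - 2 * x := by linarith
  have h3 : (1 - 2 * x) ^ k ≤ 1 - 2 * x := pow_le_of_le_one h2 (by linarith) (by omega)
  have h4 : 0 ≤ (1 - 2 * x) ^ k := pow_nonneg h2 k
  unfold parityError
  constructor <;> linarith

lemma parityError_le_mul {k : ℕ} {x : ℝ} (h1 : x ≤ 1 / 2) : parityError k x ≤ k * x := by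
  have := one_add_mul_le_pow (a := -(2 * x)) (by linarith) k
  rw [← sub_eq_add_neg] at this
  unfold parityError
  linarith

variable {p : ℝ} {dv dc : ℕ}

/-- A wrong received bit stays wrong unless all other checks contradict it, which gives x_{ℓ+1} ≥ p
q ≥ p x_ℓ for the check error q. The bound 1/2 is carried along because it is what makes q ≥ x_ℓ. -/
lemma densityEvolution_mem (h0 : 0 ≤ p) (h1 : p ≤ 1 / 2) (hdv : 2 ≤ dv) (hdc : 2 ≤ dc) (ℓ : ℕ) :
    p ^ (ℓ + 1) ≤ densityEvolution p dv dc ℓ ∧ densityEvolution p dv dc ℓ ≤ 1 / 2 := by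
  induction ℓ with
  | zero => simpa [densityEvolution] using h1
  | succ ℓ ih =>
    rw [densityEvolution]
    have hx0 : 0 ≤ densityEvolution p dv dc ℓ := (pow_nonneg h0 _).trans ih.1
    obtain ⟨hq1, hq2⟩ := parityError_mem (k := dc - 1) (by omega) hx0 ih.2
    generalize parityError (dc - 1) (densityEvolution p dv dc ℓ) = q at *
    have hq0 : 0 ≤ q := hx0.trans hq1
    have hA : (1 - q) ^ (dv - 1) ≤ 1 - q :=
      pow_le_of_le_one (by linarith) (by linarith) (by omega)
    have hB : q ^ (dv - 1) ≤ q := pow_le_of_le_one hq0 (by linarith) (by omega)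
    have hBA : q ^ (dv - 1) ≤ (1 - q) ^ (dv - 1) := pow_le_pow_left₀ hq0 (by linarith) _
    have hB0 : 0 ≤ q ^ (dv - 1) := pow_nonneg hq0 _
    generalize (1 - q) ^ (dv - 1) = A at *
    generalize q ^ (dv - 1) = B at *
    constructor
    · calc p ^ (ℓ + 1 + 1) = p * p ^ (ℓ + 1) := by ring
        _ ≤ p * (1 - A) := by
            have : p ^ (ℓ + 1) ≤ 1 - A := by linarith [ih.1]
            gcongr
        _ ≤ _ := le_add_of_nonneg_right (mul_nonneg (by linarith) hB0)
    -- If A ≤ 1/2, then B ≤ A reduces the claim to p + A(1 - 2p) ≤ 1/2. If A ≥ 1/2, both 1 - A and B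
    -- are at most 1/2.
    · rcases le_total A (1 / 2) with h | h
      · nlinarith
      · nlinarith

/-- The recursion gives x_{ℓ+1} ≤ p dv dc x_ℓ + (dc x_ℓ)². The square uses dv - 1 ≥ 2. The constant
2(dv dc)² is large enough that, after multiplication by it, each term is at most half of the target.
-/
lemma densityEvolution_le (h0 : 0 ≤ p) (hdv : 3 ≤ dv) (hdc : 2 ≤ dc)
    (hp : 2 * ((dv : ℝ) * dc) ^ 2 * p ≤ 1) (ℓ : ℕ) :
    densityEvolution p dv dc ℓ ≤ (2 * ((dv : ℝ) * dc) ^ 2 * p) ^ (ℓ + 1) := by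
  have hv : (3 : ℝ) ≤ dv := by exact_mod_cast hdv
  have hc : (2 : ℝ) ≤ dc := by exact_mod_cast hdc
  set M : ℝ := 2 * ((dv : ℝ) * dc) ^ 2 with hM
  have hM1 : 2 * (dc : ℝ) ^ 2 ≤ M := by
    rw [hM, mul_pow]
    have h1 : (1 : ℝ) ≤ (dv : ℝ) ^ 2 := one_le_pow₀ (by linarith)
    nlinarith [mul_le_mul_of_nonneg_right h1 (sq_nonneg (dc : ℝ))]
  have hM2 : 2 * ((dv : ℝ) * dc) ≤ M := by
    have h1 : (1 : ℝ) ≤ dv * dc := by nlinarith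
    rw [hM]
    nlinarith [mul_le_mul_of_nonneg_right h1 (zero_le_one.trans h1)]
  have hM3 : 8 ≤ M := by nlinarith
  have hp2 : p ≤ 1 / 2 := by nlinarith
  -- The extra factor M makes the induction close: the square term becomes (Mx)² ≤ (Mp)^(2ℓ+2) ≤
  -- (Mp)^(ℓ+2).
  suffices h : M * densityEvolution p dv dc ℓ ≤ (M * p) ^ (ℓ + 1) by
    have hpos := (densityEvolution_mem h0 hp2 (by omega) hdc ℓ (dv := dv)).1
    have : 0 ≤ densityEvolution p dv dc ℓ := (pow_nonneg h0 _).trans hpos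
    nlinarith
  induction ℓ with
  | zero => simp [densityEvolution]
  | succ ℓ ih =>
    rw [densityEvolution]
    obtain ⟨hx1, hx2⟩ := densityEvolution_mem h0 hp2 (by omega) hdc ℓ (dv := dv)
    have hx0 : 0 ≤ densityEvolution p dv dc ℓ := (pow_nonneg h0 _).trans hx1
    generalize densityEvolution p dv dc ℓ = x at *
    obtain ⟨hq1, hq2⟩ := parityError_mem (k := dc - 1) (by omega) hx0 hx2
    have hq3 : parityError (dc - 1) x ≤ dc * x := by
      refine (parityError_le_mul hx2).trans ?_
      gcongr
      omega
    generalize parityError (dc - 1) x = q at *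
    have hq0 : 0 ≤ q := hx0.trans hq1
    have hA : 1 - (1 - q) ^ (dv - 1) ≤ dv * q := by
      have h := one_add_mul_le_pow (a := -q) (by linarith) (dv - 1)
      have h' : ((dv - 1 : ℕ) : ℝ) * q ≤ dv * q := by gcongr; omega
      rw [← sub_eq_add_neg] at h
      linarith
    have hB : q ^ (dv - 1) ≤ q ^ 2 := pow_le_pow_of_le_one hq0 (by linarith) (by omega)
    have hB0 : 0 ≤ q ^ (dv - 1) := pow_nonneg hq0 _
    have hy1 : (M * p) ^ (ℓ + 1) ≤ M * p := pow_le_of_le_one (by positivity) hp (by omega)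
    have hy0 : 0 ≤ (M * p) ^ (ℓ + 1) := by positivity
    have h1 : M * (p * (1 - (1 - q) ^ (dv - 1))) ≤ (M * p) * (M * x) / 2 := by
      calc M * (p * (1 - (1 - q) ^ (dv - 1))) ≤ M * (p * (dv * (dc * x))) := by
            gcongr
            exact hA.trans (by gcongr)
        _ = (M * p) * ((2 * (dv * dc)) * x) / 2 := by ring
        _ ≤ _ := by gcongr
    have h2 : M * ((1 - p) * q ^ (dv - 1)) ≤ (M * x) * (M * x) / 2 := by
      calc M * ((1 - p) * q ^ (dv - 1)) ≤ M * (1 * (dc * x) ^ 2) := by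
            gcongr
            · linarith
            · exact hB.trans (by gcongr)
        _ = (2 * (dc : ℝ) ^ 2 * x) * (M * x) / 2 := by ring
        _ ≤ _ := by gcongr
    have h3 : (M * x) * (M * x) ≤ (M * p) * (M * p) ^ (ℓ + 1) := by
      have := mul_le_mul ih ih (by positivity) hy0
      nlinarith
    have h4 : (M * p) * (M * x) ≤ (M * p) * (M * p) ^ (ℓ + 1) := by gcongr
    rw [pow_succ' (M * p) (ℓ + 1), mul_add]
    linarith

end DensityEvolution

/-! ### Graphs without short detours -/

namespace SimpleGraph

variable {V : Type*} {G K : SimpleGraph V} {r : ℕ}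

/-- All walks from `a` to `b` have length at least `r`. -/
def FarApart (G : SimpleGraph V) (a b : V) (r : ℕ) : Prop := ∀ p : G.Walk a b, r ≤ p.length

/-- The ends of every edge are far apart once the edge is deleted. -/
def LongDetours (G : SimpleGraph V) (r : ℕ) : Prop :=
  ∀ ⦃a b : V⦄, G.Adj a b → (G.deleteEdges {s(a, b)}).FarApart a b r

lemma FarApart.anti {a b : V} (h : G.FarApart a b r) (hKG : K ≤ G) : K.FarApart a b r := fun p => by
  simpa using h (p.mapLe hKG)

lemma FarApart.symm {a b : V} (h : G.FarApart a b r) : G.FarApart b a r := fun p => by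
  simpa using h p.reverse

lemma FarApart.of_adj {a b c : V} (h : G.FarApart a b (r + 1)) (hac : G.Adj a c) :
    G.FarApart c b r := fun p => by
  simpa using h (Walk.cons hac p)

lemma FarApart.not_adj {a b : V} (h : G.FarApart a b r) (hr : 2 ≤ r) : ¬ G.Adj a b := fun hab => by
  have := h hab.toWalk
  simp at this
  omega

lemma LongDetours.anti (h : G.LongDetours r) (hKG : K ≤ G) : K.LongDetours r := fun _ _ hab =>
  (h (hKG hab)).anti (deleteEdges_mono hKG)

lemma LongDetours.cyclesLongerThan (h : G.LongDetours r) : G.CyclesLongerThan r := by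
  intro u w hw
  cases w with
  | nil => simp at hw
  | cons hadj p =>
    rw [Walk.cons_isCycle_iff] at hw
    have := (h hadj).symm (p.toDeleteEdge _ hw.2)
    simp only [Walk.toDeleteEdge, Walk.toDeleteEdges, Walk.length_transfer] at this
    rw [Walk.length_cons]
    omega

/-- A walk that uses the new edge repeatedly can be shortened until it uses it at most once. -/
lemma exists_walk_of_walk_sup_edge {a b s t : V} (p : (K ⊔ edge a b).Walk s t) :
    (∃ q : K.Walk s t, q.length ≤ p.length) ∨
    (∃ (q₁ : K.Walk s a) (q₂ : K.Walk b t), q₁.length + 1 + q₂.length ≤ p.length) ∨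
    (∃ (q₁ : K.Walk s b) (q₂ : K.Walk a t), q₁.length + 1 + q₂.length ≤ p.length) := by
  induction p with
  | nil => exact Or.inl ⟨.nil, by simp⟩
  | @cons x y z h p ih =>
    rw [sup_adj, edge_adj] at h
    rcases h with h | ⟨⟨rfl, rfl⟩ | ⟨rfl, rfl⟩, -⟩
    · rcases ih with ⟨q, hq⟩ | ⟨q₁, q₂, hq⟩ | ⟨q₁, q₂, hq⟩
      · exact Or.inl ⟨.cons h q, by simpa using hq⟩
      · exact Or.inr (Or.inl ⟨.cons h q₁, q₂, by simp only [Walk.length_cons]; omega⟩)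
      · exact Or.inr (Or.inr ⟨.cons h q₁, q₂, by simp only [Walk.length_cons]; omega⟩)
    · rcases ih with ⟨q, hq⟩ | ⟨q₁, q₂, hq⟩ | ⟨q₁, q₂, hq⟩
      · exact Or.inr (Or.inl ⟨.nil, q, by simp only [Walk.length_cons, Walk.length_nil]; omega⟩)
      · exact Or.inr (Or.inl ⟨.nil, q₂, by simp only [Walk.length_cons, Walk.length_nil]; omega⟩)
      · exact Or.inl ⟨q₂, by simp only [Walk.length_cons]; omega⟩
    · rcases ih with ⟨q, hq⟩ | ⟨q₁, q₂, hq⟩ | ⟨q₁, q₂, hq⟩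
      · exact Or.inr (Or.inr ⟨.nil, q, by simp only [Walk.length_cons, Walk.length_nil]; omega⟩)
      · exact Or.inl ⟨q₂, by simp only [Walk.length_cons]; omega⟩
      · exact Or.inr (Or.inr ⟨.nil, q₂, by simp only [Walk.length_cons, Walk.length_nil]; omega⟩)

/-- A detour around an old edge `ab` through the new edge consists of two pieces of K; joined by
`ab` they form a walk from `x` to `w`, which is long by hypothesis. -/
lemma LongDetours.sup_edge {x w : V} (hK : K.LongDetours r) (hxw : K.FarApart x w r) :
    (K ⊔ edge x w).LongDetours r := by
  intro a b hab
  by_cases hs : s(a, b) = s(x, w)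
  · have hle : (K ⊔ edge x w).deleteEdges {s(a, b)} ≤ K := by
      intro c d hcd
      simp only [deleteEdges_adj, sup_adj, edge_adj, Set.mem_singleton_iff, hs] at hcd
      rcases hcd.1 with h | ⟨⟨rfl, rfl⟩ | ⟨rfl, rfl⟩, -⟩
      · exact h
      · exact absurd rfl hcd.2
      · exact absurd Sym2.eq_swap hcd.2
    rcases Sym2.eq_iff.mp hs with ⟨rfl, rfl⟩ | ⟨rfl, rfl⟩
    · exact hxw.anti hle
    · exact hxw.symm.anti hle
  · have hadj : K.Adj a b := by
      rw [sup_adj, edge_adj] at hab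
      rcases hab with h | ⟨⟨rfl, rfl⟩ | ⟨rfl, rfl⟩, -⟩
      · exact h
      · exact absurd rfl hs
      · exact absurd Sym2.eq_swap hs
    have hle : (K ⊔ edge x w).deleteEdges {s(a, b)} ≤ K.deleteEdges {s(a, b)} ⊔ edge x w := by
      intro c d hcd
      simp only [deleteEdges_adj, sup_adj] at hcd ⊢
      exact hcd.1.imp (fun h => ⟨h, hcd.2⟩) id
    have hdel : K.deleteEdges {s(a, b)} ≤ K := deleteEdges_le _
    refine FarApart.anti (fun p => ?_) hle
    rcases exists_walk_of_walk_sup_edge p with ⟨q, hq⟩ | ⟨q₁, q₂, hq⟩ | ⟨q₁, q₂, hq⟩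
    · exact (hK hadj q).trans hq
    · have := hxw ((q₁.mapLe hdel).reverse.append (Walk.cons hadj (q₂.mapLe hdel).reverse))
      simp only [Walk.length_append, Walk.length_cons, Walk.length_reverse, Walk.length_mapLe] at this
      omega
    · have := hxw.symm ((q₁.mapLe hdel).reverse.append (Walk.cons hadj (q₂.mapLe hdel).reverse))
      simp only [Walk.length_append, Walk.length_cons, Walk.length_reverse, Walk.length_mapLe] at this
      omega

end SimpleGraph

/-! ### Regular codes of large girth -/

section LargeGirth

variable {n m : ℕ}

/-- The Tanner graph with the given edges. -/
abbrev tannerOfEdges (E : Finset (Fin n × Fin m)) : Tanner where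
  n := n
  m := m
  H := fun c v => if (v, c) ∈ E then 1 else 0

/-- The bipartite graph with the given edges. -/
def edgesGraph (E : Finset (Fin n × Fin m)) : SimpleGraph (Fin n ⊕ Fin m) := (tannerOfEdges E).graph

variable {E : Finset (Fin n × Fin m)}

lemma edgesGraph_adj {a b : Fin n ⊕ Fin m} : (edgesGraph E).Adj a b ↔
    ∃ v c, (v, c) ∈ E ∧ (a = Sum.inl v ∧ b = Sum.inr c ∨ a = Sum.inr c ∧ b = Sum.inl v) := by
  simp only [edgesGraph, Tanner.graph, tannerOfEdges, SimpleGraph.fromRel_adj]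
  constructor
  · rintro ⟨-, ⟨v, c, rfl, rfl, h⟩ | ⟨v, c, rfl, rfl, h⟩⟩
    · exact ⟨v, c, by simpa using h, Or.inl ⟨rfl, rfl⟩⟩
    · exact ⟨v, c, by simpa using h, Or.inr ⟨rfl, rfl⟩⟩
  · rintro ⟨v, c, h, ⟨rfl, rfl⟩ | ⟨rfl, rfl⟩⟩
    · exact ⟨by simp, Or.inl ⟨v, c, rfl, rfl, by simpa using h⟩⟩
    · exact ⟨by simp, Or.inr ⟨v, c, rfl, rfl, by simpa using h⟩⟩

lemma edgesGraph_adj_inl_inr {v : Fin n} {c : Fin m} :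
    (edgesGraph E).Adj (Sum.inl v) (Sum.inr c) ↔ (v, c) ∈ E := by
  simp [edgesGraph_adj]

lemma edgesGraph_insert_le (v : Fin n) (c : Fin m) :
    edgesGraph (insert (v, c) E) ≤ edgesGraph E ⊔ SimpleGraph.edge (Sum.inl v) (Sum.inr c) := by
  intro a b hab
  rw [edgesGraph_adj] at hab
  obtain ⟨v', c', h, hab⟩ := hab
  rw [SimpleGraph.sup_adj]
  rcases Finset.mem_insert.mp h with h | h
  · right
    obtain ⟨rfl, rfl⟩ := Prod.mk.injEq .. ▸ h
    rcases hab with ⟨rfl, rfl⟩ | ⟨rfl, rfl⟩ <;> simp [SimpleGraph.edge_adj]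
  · left
    exact edgesGraph_adj.mpr ⟨v', c', h, hab⟩

lemma edgesGraph_erase_le (v : Fin n) (c : Fin m) :
    edgesGraph (E.erase (v, c)) ≤ (edgesGraph E).deleteEdges {s(Sum.inl v, Sum.inr c)} := by
  intro a b hab
  rw [edgesGraph_adj] at hab
  obtain ⟨v', c', h, hab⟩ := hab
  rw [SimpleGraph.deleteEdges_adj]
  refine ⟨edgesGraph_adj.mpr ⟨v', c', Finset.mem_of_mem_erase h, hab⟩, ?_⟩
  have hne := Finset.ne_of_mem_erase h
  have hne' : v' = v → ¬ c' = c := by simpa using hne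
  rcases hab with ⟨rfl, rfl⟩ | ⟨rfl, rfl⟩
  · simpa using hne'
  · simpa using fun h₁ h₂ => hne' h₂ h₁

/-- Number of edges at a variable node. -/
def varDeg (E : Finset (Fin n × Fin m)) (v : Fin n) : ℕ := ∑ a ∈ E, if a.1 = v then 1 else 0

/-- Number of edges at a check node. -/
def checkDeg (E : Finset (Fin n × Fin m)) (c : Fin m) : ℕ := ∑ a ∈ E, if a.2 = c then 1 else 0

lemma sum_varDeg (E : Finset (Fin n × Fin m)) : ∑ v, varDeg E v = E.card := by
  simp only [varDeg]
  rw [Finset.sum_comm]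
  simp

lemma sum_checkDeg (E : Finset (Fin n × Fin m)) : ∑ c, checkDeg E c = E.card := by
  simp only [checkDeg]
  rw [Finset.sum_comm]
  simp

lemma card_checksOf_tannerOfEdges (v : Fin n) :
    ((tannerOfEdges E).checksOf v).card = varDeg E v := by
  rw [varDeg, ← Finset.card_filter]
  refine Finset.card_bij (fun c _ => (v, c)) ?_ ?_ ?_
  · intro c hc
    rw [Tanner.mem_checksOf_iff] at hc
    simpa [tannerOfEdges] using hc
  · intro c _ c' _ h
    exact (Prod.mk.inj h).2
  · rintro ⟨v', c⟩ h
    simp only [Finset.mem_filter] at h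
    obtain ⟨h, rfl⟩ := h
    exact ⟨c, by rw [Tanner.mem_checksOf_iff]; simpa [tannerOfEdges] using h, rfl⟩

lemma card_varsOf_tannerOfEdges (c : Fin m) :
    ((tannerOfEdges E).varsOf c).card = checkDeg E c := by
  rw [checkDeg, ← Finset.card_filter]
  refine Finset.card_bij (fun v _ => (v, c)) ?_ ?_ ?_
  · intro v hv
    rw [Tanner.mem_varsOf_iff] at hv
    simpa [tannerOfEdges] using hv
  · intro v _ v' _ h
    exact (Prod.mk.inj h).1
  · rintro ⟨v, c'⟩ h
    simp only [Finset.mem_filter] at h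
    obtain ⟨h, rfl⟩ := h
    exact ⟨v, by rw [Tanner.mem_varsOf_iff]; simpa [tannerOfEdges] using h, rfl⟩

/-- The variable nodes at distance at most two from `S`. -/
def nextVars (E : Finset (Fin n × Fin m)) (S : Finset (Fin n)) : Finset (Fin n) :=
  S ∪ (E.filter fun a => a.1 ∈ S).biUnion fun a => (E.filter fun b => b.2 = a.2).image Prod.fst

/-- The variable nodes at distance at most `2 * j` from `S`. -/
def varBall (E : Finset (Fin n × Fin m)) : ℕ → Finset (Fin n) → Finset (Fin n)
  | 0, S => S
  | j + 1, S => varBall E j (nextVars E S)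

lemma subset_varBall (j : ℕ) (S : Finset (Fin n)) : S ⊆ varBall E j S := by
  induction j generalizing S with
  | zero => exact subset_rfl
  | succ j ih => exact Finset.subset_union_left.trans (ih _)

lemma card_nextVars_le {dv dc : ℕ} (hv : ∀ v, varDeg E v ≤ dv) (hc : ∀ c, checkDeg E c ≤ dc)
    (S : Finset (Fin n)) : (nextVars E S).card ≤ S.card * (1 + dv * dc) := by
  have h1 : (E.filter fun a => a.1 ∈ S).card ≤ S.card * dv := by
    rw [Finset.card_eq_sum_card_fiberwise (s := E.filter fun a => a.1 ∈ S) (f := Prod.fst) (t := S)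
      (fun a ha => by simpa using (Finset.mem_filter.mp (Finset.mem_coe.mp ha)).2), ← smul_eq_mul, ← Finset.sum_const]
    refine Finset.sum_le_sum fun v _ => le_trans ?_ (hv v)
    rw [varDeg, ← Finset.card_filter]
    exact Finset.card_le_card (Finset.filter_subset_filter _ (Finset.filter_subset _ _))
  have h2 : ((E.filter fun a => a.1 ∈ S).biUnion fun a =>
      (E.filter fun b => b.2 = a.2).image Prod.fst).card ≤ S.card * dv * dc := by
    refine Finset.card_biUnion_le_card_mul _ _ dc (fun a _ => ?_) |>.trans (Nat.mul_le_mul_right _ h1)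
    refine Finset.card_image_le.trans (le_trans ?_ (hc a.2))
    rw [checkDeg, ← Finset.card_filter]
  calc _ ≤ S.card + S.card * dv * dc := (Finset.card_union_le _ _).trans (by gcongr)
    _ = _ := by ring

lemma card_varBall_le {dv dc : ℕ} (hv : ∀ v, varDeg E v ≤ dv) (hc : ∀ c, checkDeg E c ≤ dc)
    (j : ℕ) (S : Finset (Fin n)) : (varBall E j S).card ≤ S.card * (1 + dv * dc) ^ j := by
  induction j generalizing S with
  | zero => simp [varBall]
  | succ j ih =>
    calc _ ≤ (nextVars E S).card * (1 + dv * dc) ^ j := ih _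
      _ ≤ S.card * (1 + dv * dc) * (1 + dv * dc) ^ j := by
          gcongr
          exact card_nextVars_le hv hc S
      _ = _ := by ring

/-- Odd length 2j + 1 costs nothing, since walks between variable nodes of a bipartite graph are
even. It makes the complement of the ball consist of nodes at distance at least 2j + 2. -/
lemma mem_varBall_of_walk {j : ℕ} {S : Finset (Fin n)} {x u : Fin n} (hx : x ∈ S)
    (p : (edgesGraph E).Walk (Sum.inl x) (Sum.inl u)) (hp : p.length ≤ 2 * j + 1) :
    u ∈ varBall E j S := by
  induction j generalizing S x with
  | zero =>
    match p, hp with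
    | .nil, _ => exact hx
    | .cons (v := Sum.inl _) h _, _ => simp [edgesGraph_adj] at h
    | .cons (v := Sum.inr _) _ (.cons _ _), hp =>
      simp only [SimpleGraph.Walk.length_cons] at hp
      omega
  | succ j ih =>
    match p, hp with
    | .nil, _ => exact subset_varBall _ _ hx
    | .cons (v := Sum.inl _) h _, _ => simp [edgesGraph_adj] at h
    | .cons (v := Sum.inr _) _ (.cons (v := Sum.inr _) h _), _ => simp [edgesGraph_adj] at h
    | .cons (v := Sum.inr c) h (.cons (v := Sum.inl x') h' q), hp =>
      simp only [SimpleGraph.Walk.length_cons] at hp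
      refine ih (x := x') ?_ q (by omega)
      rw [edgesGraph_adj_inl_inr] at h
      have h'' := edgesGraph_adj_inl_inr.mp h'.symm
      simp only [nextVars, Finset.mem_union, Finset.mem_biUnion, Finset.mem_filter,
        Finset.mem_image]
      exact Or.inr ⟨(x, c), ⟨h, hx⟩, (x', c), ⟨h'', rfl⟩, rfl⟩

lemma farApart_of_notMem_varBall {j : ℕ} {x u : Fin n} (hu : u ∉ varBall E j {x}) :
    (edgesGraph E).FarApart (Sum.inl u) (Sum.inl x) (2 * j + 2) := by
  refine SimpleGraph.FarApart.symm fun p => ?_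
  by_contra hp
  exact hu (mem_varBall_of_walk (by simp) p (by omega))

lemma farApart_of_notMem_varBall_check {j : ℕ} {y : Fin m} {u : Fin n}
    (hu : u ∉ varBall E j ((E.filter fun b => b.2 = y).image Prod.fst)) :
    (edgesGraph E).FarApart (Sum.inl u) (Sum.inr y) (2 * j + 2) := by
  refine SimpleGraph.FarApart.symm fun p => ?_
  by_contra hp
  match p, hp with
  | .cons (v := Sum.inr _) h _, _ => simp [edgesGraph_adj] at h
  | .cons (v := Sum.inl x) h q, hp =>
    simp only [SimpleGraph.Walk.length_cons] at hp
    refine hu (mem_varBall_of_walk (x := x) ?_ q (by omega))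
    have h' := edgesGraph_adj_inl_inr.mp h.symm
    simp only [Finset.mem_image, Finset.mem_filter]
    exact ⟨(x, y), ⟨h', rfl⟩, rfl⟩

/-- Degrees bounded by `dv` and `dc`, and no short cycles. -/
structure IsSparse (dv dc r : ℕ) (E : Finset (Fin n × Fin m)) : Prop where
  varDeg_le : ∀ v, varDeg E v ≤ dv
  checkDeg_le : ∀ c, checkDeg E c ≤ dc
  longDetours : (edgesGraph E).LongDetours r

/-- Choose a variable node `u` far from both `x` and `y`. If `u` has a free place, join it to `y`.
Otherwise replace an edge `uw` by `xw` and `uy`: the degrees of `u` and `w` are unchanged, those of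
`x` and `y` grow by one, and all new detours are long because `u` is far away. -/
lemma IsSparse.exists_card_succ {dv dc j : ℕ} (hE : IsSparse dv dc (2 * j) E) (hj : 1 ≤ j)
    (hdv : 0 < dv) (hn : (1 + dc) * (1 + dv * dc) ^ j < n) {x : Fin n} {y : Fin m}
    (hx : varDeg E x < dv) (hy : checkDeg E y < dc) :
    ∃ E' : Finset (Fin n × Fin m), IsSparse dv dc (2 * j) E' ∧ E'.card = E.card + 1 := by
  -- The ball around `x` starts from one variable node, the one around `y` from at most `dc`
  -- neighbours; this is the factor 1 + dc.
  have hcard : (varBall E j {x} ∪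
      varBall E j ((E.filter fun b => b.2 = y).image Prod.fst)).card < n := by
    refine lt_of_le_of_lt ((Finset.card_union_le _ _).trans (Nat.add_le_add
      (card_varBall_le hE.varDeg_le hE.checkDeg_le _ _)
      (card_varBall_le hE.varDeg_le hE.checkDeg_le _ _))) (lt_of_le_of_lt ?_ hn)
    rw [Finset.card_singleton, ← add_mul]
    gcongr
    refine Finset.card_image_le.trans (le_trans ?_ (hE.checkDeg_le y))
    rw [checkDeg, ← Finset.card_filter]
  obtain ⟨u, hu⟩ : ∃ u, u ∉ varBall E j {x} ∪
      varBall E j ((E.filter fun b => b.2 = y).image Prod.fst) := by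
    by_contra! h
    rw [Finset.eq_univ_iff_forall.mpr h, Finset.card_univ, Fintype.card_fin] at hcard
    exact lt_irrefl _ hcard
  rw [Finset.mem_union, not_or] at hu
  have hux := farApart_of_notMem_varBall hu.1
  have huy := farApart_of_notMem_varBall_check hu.2
  have huyE : (u, y) ∉ E := fun h =>
    huy.not_adj (by omega) (edgesGraph_adj_inl_inr.mpr h)
  rcases (hE.varDeg_le u).lt_or_eq with hdu | hdu
  · refine ⟨insert (u, y) E, ⟨fun v => ?_, fun c => ?_, ?_⟩, Finset.card_insert_of_notMem huyE⟩
    · have := hE.varDeg_le v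
      simp only [varDeg] at this hdu ⊢
      rw [Finset.sum_insert huyE]
      split_ifs with h
      · simp only at h; subst h; omega
      · omega
    · have := hE.checkDeg_le c
      simp only [checkDeg] at this hy ⊢
      rw [Finset.sum_insert huyE]
      split_ifs with h
      · simp only at h; subst h; omega
      · omega
    · exact (hE.longDetours.sup_edge fun p => by have := huy p; omega).anti
        (edgesGraph_insert_le u y)
  · obtain ⟨w, hw⟩ : ∃ w, (u, w) ∈ E := by
      by_contra! h
      have : varDeg E u = 0 := Finset.sum_eq_zero fun a ha => by
        rw [if_neg]
        rintro rfl
        exact h a.2 ha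
      omega
    have huw := edgesGraph_adj_inl_inr.mpr hw
    have hwx : (edgesGraph E).FarApart (Sum.inr w) (Sum.inl x) (2 * j) := fun p => by
      have := hux.of_adj huw p; omega
    have hwy : (edgesGraph E).FarApart (Sum.inr w) (Sum.inr y) (2 * j) := fun p => by
      have := huy.of_adj huw p; omega
    have hxwE : (x, w) ∉ E := fun h =>
      hwx.symm.not_adj (by omega) (edgesGraph_adj_inl_inr.mpr h)
    have hxu : x ≠ u := by
      rintro rfl
      have := hux .nil
      simp at this
    have h1 : (x, w) ∉ E.erase (u, w) := fun h => hxwE (Finset.mem_of_mem_erase h)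
    have h2 : (u, y) ∉ insert (x, w) (E.erase (u, w)) := by
      rw [Finset.mem_insert, not_or]
      exact ⟨fun h => hxu (Prod.mk.inj h).1.symm, fun h => huyE (Finset.mem_of_mem_erase h)⟩
    have hsum : ∀ f : Fin n × Fin m → ℕ,
        ∑ a ∈ insert (u, y) (insert (x, w) (E.erase (u, w))), f a + f (u, w) =
          f (u, y) + f (x, w) + ∑ a ∈ E, f a := fun f => by
      rw [Finset.sum_insert h2, Finset.sum_insert h1, ← Finset.add_sum_erase _ _ hw]
      ring
    have hdel := edgesGraph_erase_le (E := E) u w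
    have hle : edgesGraph (E.erase (u, w)) ≤ edgesGraph E :=
      hdel.trans (SimpleGraph.deleteEdges_le _)
    refine ⟨insert (u, y) (insert (x, w) (E.erase (u, w))), ⟨fun v => ?_, fun c => ?_, ?_⟩, ?_⟩
    · have h := hsum fun a => if a.1 = v then 1 else 0
      have := hE.varDeg_le v
      simp only [varDeg] at this hx ⊢
      simp only at h
      by_cases hv : x = v
      · subst hv; simp only [if_true] at h; omega
      · simp only [hv, if_false] at h; omega
    · have h := hsum fun a => if a.2 = c then 1 else 0
      have := hE.checkDeg_le c
      simp only [checkDeg] at this hy ⊢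
      simp only at h
      by_cases hv : y = c
      · subst hv; simp only [if_true] at h; omega
      · simp only [hv, if_false] at h; omega
    · have hd : (edgesGraph (insert (x, w) (E.erase (u, w)))).LongDetours (2 * j) :=
        ((hE.longDetours.anti hle).sup_edge (hwx.symm.anti hle)).anti (edgesGraph_insert_le x w)
      refine (hd.sup_edge (SimpleGraph.FarApart.anti (fun p => ?_) (edgesGraph_insert_le x w))).anti
        (edgesGraph_insert_le u y)
      -- A walk from `u` to `y` avoids the edge `xw`, or reaches `x` first, or reaches `w` first.
      -- The last case is long because `uw` was an edge without short detours and has been deleted.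
      rcases SimpleGraph.exists_walk_of_walk_sup_edge p with ⟨q, hq⟩ | ⟨q₁, q₂, hq⟩ | ⟨q₁, q₂, hq⟩
      · have := huy.anti hle q
        omega
      · have := hux.anti hle q₁
        omega
      · have := (hE.longDetours huw).anti hdel q₁
        omega
    · have h := hsum fun _ => 1
      simp only [Finset.sum_const, smul_eq_mul, mul_one] at h
      omega

/-- Take an admissible edge set of maximal size. With dc·t variable and dv·t check nodes both full
degree sums equal dc·t·dv, so a deficient node on one side forces one on the other, and the set
could be enlarged. -/
theorem exists_regular_cyclesLongerThan {dv dc j t : ℕ} (hdv : 0 < dv) (hj : 1 ≤ j)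
    (hn : (1 + dc) * (1 + dv * dc) ^ j < dc * t) :
    ∃ T : Tanner, T.n = dc * t ∧ T.Regular dv dc ∧ T.graph.CyclesLongerThan (2 * j) := by
  classical
  have hbot : IsSparse dv dc (2 * j) (∅ : Finset (Fin (dc * t) × Fin (dv * t))) :=
    ⟨fun v => by simp [varDeg], fun c => by simp [checkDeg], fun a b hab => by
      simp [edgesGraph_adj] at hab⟩
  obtain ⟨E, hE, hmax⟩ := Finset.exists_max_image
    ((Finset.univ : Finset (Finset (Fin (dc * t) × Fin (dv * t)))).filter (IsSparse dv dc (2 * j)))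
    Finset.card ⟨∅, by simpa using hbot⟩
  simp only [Finset.mem_filter, Finset.mem_univ, true_and] at hE hmax
  have hno : ∀ x y, varDeg E x < dv → checkDeg E y < dc → False := fun x y hx hy => by
    obtain ⟨E', hE', hc⟩ := hE.exists_card_succ hj hdv hn hx hy
    have := hmax E' hE'
    omega
  have hV : ∑ _v : Fin (dc * t), dv = dc * t * dv := by simp
  have hC : ∑ _c : Fin (dv * t), dc = dc * t * dv := by simp; ring
  have hsum := (sum_varDeg E).trans (sum_checkDeg E).symm
  refine ⟨tannerOfEdges E, rfl, ⟨by change 0 < dc * t; omega, fun v => ?_, fun c => ?_⟩,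
    hE.longDetours.cyclesLongerThan⟩
  · rw [card_checksOf_tannerOfEdges]
    by_contra hne
    have hlt : varDeg E v < dv := lt_of_le_of_ne (hE.varDeg_le v) hne
    have h1 := Finset.sum_lt_sum (fun v _ => hE.varDeg_le v) ⟨v, Finset.mem_univ _, hlt⟩
    rw [hV, hsum, ← hC] at h1
    obtain ⟨c, -, hc⟩ := Finset.exists_lt_of_sum_lt h1
    exact hno v c hlt hc
  · rw [card_varsOf_tannerOfEdges]
    by_contra hne
    have hlt : checkDeg E c < dc := lt_of_le_of_ne (hE.checkDeg_le c) hne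
    have h1 := Finset.sum_lt_sum (fun c _ => hE.checkDeg_le c) ⟨c, Finset.mem_univ _, hlt⟩
    rw [hC, ← hsum, ← hV] at h1
    obtain ⟨v, -, hv⟩ := Finset.exists_lt_of_sum_lt h1
    exact hno v c hv hlt

theorem exists_isConstruction {dv dc : ℕ} (hdv : 3 ≤ dv) (hdc : 3 ≤ dc) :
    ∃ C, IsConstruction dv dc (3 * Real.log (2 * (dv : ℝ) * (dc : ℝ) + 1)) C := by
  -- Cycles longer than 4N + 2 allow N iterations. The exponent 3N + 1 exceeds the 2N + 1 that is
  -- needed and makes the blocklength an exact multiple of e^(γN) at the upper endpoint of the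
  -- range.
  have hex : ∀ N : ℕ, ∃ T : Tanner, T.n = dc * (2 * (2 * dv * dc + 1) ^ (3 * N + 1)) ∧
      T.Regular dv dc ∧ T.graph.CyclesLongerThan (2 * (2 * N + 1)) := fun N => by
    refine exists_regular_cyclesLongerThan (by omega) (by omega) ?_
    have hpos : 0 < dv * dc := by positivity
    calc (1 + dc) * (1 + dv * dc) ^ (2 * N + 1) ≤ (dc * 2) * (1 + dv * dc) ^ (3 * N + 1) := by
          gcongr
          · omega
          · omega
          · omega
      _ < (dc * 2) * (2 * dv * dc + 1) ^ (3 * N + 1) := by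
          have : 1 + dv * dc < 2 * dv * dc + 1 := by rw [mul_assoc]; omega
          gcongr
      _ = _ := by ring
  choose C hn hC hcyc using hex
  refine ⟨C, fun N => ⟨hC N, (hC N).le_maxIter hdv hdc ((hcyc N).mono (by omega))⟩, ?_⟩
  have hval : ∀ N : ℕ, ((C N).n : ℝ) = (dc * 2 * (2 * dv * dc + 1)) *
      Real.exp (3 * Real.log (2 * (dv : ℝ) * (dc : ℝ) + 1) * N) := fun N => by
    rw [hn, show 3 * Real.log (2 * (dv : ℝ) * (dc : ℝ) + 1) * N =
      ((3 * N : ℕ) : ℝ) * Real.log (2 * (dv : ℝ) * (dc : ℝ) + 1) by push_cast; ring,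
      Real.exp_nat_mul, Real.exp_log (by positivity)]
    push_cast
    ring
  refine ⟨dc * 2 * (2 * dv * dc + 1), dc * 2 * (2 * dv * dc + 1), by positivity, fun N => ?_⟩
  rw [hval]
  exact ⟨le_rfl, le_rfl⟩

end LargeGirth

/-! ### Polylines on the tracks -/

namespace Cell

lemma Step.symm {p q : Cell} (h : Step p q) : Step q p := by
  rcases h with ⟨h1, h2, h3⟩ | ⟨h1, h2, h3⟩
  · exact Or.inl ⟨h2 ▸ h1, h2.symm, h3.symm⟩
  · exact Or.inr ⟨h2 ▸ h1, h2.symm, h3.symm⟩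

/-- The cells `p`, `p + d`, ..., `p + (k - 1) * d`. -/
def run (d : Cell) : ℕ → Cell → List Cell
  | 0, _ => []
  | k + 1, p => p :: run d k (p + d)

variable {d : Cell}

lemma mem_run {k : ℕ} {p q : Cell} : q ∈ run d k p ↔ ∃ i < k, q = p + i • d := by
  induction k generalizing p with
  | zero => simp [run]
  | succ k ih =>
    rw [run, List.mem_cons, ih]
    constructor
    · rintro (rfl | ⟨i, hi, rfl⟩)
      · exact ⟨0, by omega, by simp⟩
      · exact ⟨i + 1, by omega, by rw [succ_nsmul]; abel⟩
    · rintro ⟨i, hi, rfl⟩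
      rcases i with _ | i
      · simp
      · exact Or.inr ⟨i, by omega, by rw [succ_nsmul]; abel⟩

lemma nodup_run (hd : d ≠ 0) (k : ℕ) (p : Cell) : (run d k p).Nodup := by
  induction k generalizing p with
  | zero => simp [run]
  | succ k ih =>
    rw [run, List.nodup_cons]
    refine ⟨fun h => ?_, ih _⟩
    obtain ⟨i, -, h⟩ := mem_run.mp h
    rw [add_assoc, left_eq_add, ← succ_nsmul'] at h
    exact hd ((smul_eq_zero.mp h).resolve_left (by omega))

lemma exists_run_append_eq_cons (k : ℕ) (p : Cell) (l : List Cell) :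
    ∃ l', run d k p ++ (p + k • d) :: l = p :: l' := by
  cases k with
  | zero => exact ⟨l, by simp [run]⟩
  | succ k => exact ⟨_, rfl⟩

lemma isChain_run_append {k : ℕ} {p : Cell} {l : List Cell} (hd : ∀ i : ℕ, Step (p + i • d) (p + (i + 1) • d))
    (hl : List.IsChain Step ((p + k • d) :: l)) :
    List.IsChain Step (run d k p ++ (p + k • d) :: l) := by
  induction k generalizing p with
  | zero => simpa [run] using hl
  | succ k ih =>
    have he : p + (k + 1) • d = p + d + k • d := by rw [succ_nsmul]; abel
    rw [he] at hl ⊢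
    have := ih (p := p + d) (fun i => by
      have := hd (i + 1)
      rwa [show p + d + i • d = p + (i + 1) • d by rw [succ_nsmul]; abel,
        show p + d + (i + 1) • d = p + (i + 1 + 1) • d by rw [succ_nsmul d (i + 1)]; abel]) hl
    obtain ⟨l', hl'⟩ := exists_run_append_eq_cons (d := d) k (p + d) l
    rw [run, List.cons_append]
    rw [hl'] at this ⊢
    exact List.isChain_cons_cons.mpr ⟨by simpa using hd 0, this⟩

lemma triple_infix_run_append {k i : ℕ} {p : Cell} {l : List Cell} (hi : i + 1 < k) :
    [p + i • d, p + (i + 1) • d, p + (i + 2) • d] <:+: run d k p ++ (p + k • d) :: l := by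
  induction i generalizing k p with
  | zero =>
    obtain ⟨k, rfl⟩ := Nat.exists_eq_add_of_le' hi
    obtain ⟨l', hl'⟩ := exists_run_append_eq_cons (d := d) k (p + d + d) l
    have he : p + (k + (0 + 1 + 1)) • d = p + d + d + k • d := by
      rw [show k + (0 + 1 + 1) = k + 1 + 1 by ring, succ_nsmul, succ_nsmul]; abel
    rw [he]
    change _ <:+: p :: (p + d) :: (run d k (p + d + d) ++ (p + d + d + k • d) :: l)
    rw [hl']
    refine List.IsPrefix.isInfix ⟨l', ?_⟩
    simp [two_mul, add_assoc]
  | succ i ih =>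
    obtain ⟨k, rfl⟩ := Nat.exists_eq_add_of_le' (Nat.lt_of_le_of_lt (Nat.zero_le _) hi)
    have he : ∀ j : ℕ, p + (j + 1) • d = p + d + j • d := fun j => by rw [succ_nsmul]; abel
    have := ih (k := k) (p := p + d) (by omega)
    rw [show i + 1 + 2 = i + 2 + 1 by ring, he, he, he, he]
    exact this.trans (List.suffix_cons _ _).isInfix

/-- The cells of a horizontal track from `x` to `x'`, without the last one. -/
def hseg (x x' y : ℤ) : List Cell :=
  if x ≤ x' then run (1, 0) (x' - x).toNat (x, y) else run (-1, 0) (x - x').toNat (x, y)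

/-- The cells of a vertical track from `y` to `y'`, without the last one. -/
def vseg (x y y' : ℤ) : List Cell :=
  if y ≤ y' then run (0, 1) (y' - y).toNat (x, y) else run (0, -1) (y - y').toNat (x, y)

lemma mem_hseg {x x' y : ℤ} {p : Cell} :
    p ∈ hseg x x' y ↔ p.2 = y ∧ (x ≤ p.1 ∧ p.1 < x' ∨ x' < p.1 ∧ p.1 ≤ x) := by
  unfold hseg
  split_ifs with h <;> rw [mem_run]
  · constructor
    · rintro ⟨i, hi, rfl⟩
      simp
      omega
    · rintro ⟨h1, h2⟩
      refine ⟨(p.1 - x).toNat, by omega, ?_⟩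
      ext <;> (simp; try omega)
  · constructor
    · rintro ⟨i, hi, rfl⟩
      simp
      omega
    · rintro ⟨h1, h2⟩
      refine ⟨(x - p.1).toNat, by omega, ?_⟩
      ext <;> (simp; try omega)

lemma mem_vseg {x y y' : ℤ} {p : Cell} :
    p ∈ vseg x y y' ↔ p.1 = x ∧ (y ≤ p.2 ∧ p.2 < y' ∨ y' < p.2 ∧ p.2 ≤ y) := by
  unfold vseg
  split_ifs with h <;> rw [mem_run]
  · constructor
    · rintro ⟨i, hi, rfl⟩
      simp
      omega
    · rintro ⟨h1, h2⟩
      refine ⟨(p.2 - y).toNat, by omega, ?_⟩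
      ext <;> (simp; try omega)
  · constructor
    · rintro ⟨i, hi, rfl⟩
      simp
      omega
    · rintro ⟨h1, h2⟩
      refine ⟨(y - p.2).toNat, by omega, ?_⟩
      ext <;> (simp; try omega)

lemma nodup_hseg (x x' y : ℤ) : (hseg x x' y).Nodup := by
  unfold hseg
  split_ifs <;> exact nodup_run (by simp) _ _

lemma nodup_vseg (x y y' : ℤ) : (vseg x y y').Nodup := by
  unfold vseg
  split_ifs <;> exact nodup_run (by simp) _ _

/-- Both orientations become one `run`, so the chain and straightness properties are inherited from
there. Segments omit their last cell so that they concatenate to polylines without repetition. -/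
lemma hseg_append_eq {x x' y : ℤ} (l : List Cell) : ∃ (d : Cell) (k : ℕ),
    (d = (1, 0) ∨ d = (-1, 0)) ∧ (x', y) = (x, y) + k • d ∧
      hseg x x' y ++ (x', y) :: l = run d k (x, y) ++ ((x, y) + k • d) :: l := by
  by_cases h : x ≤ x'
  · have he : ((x', y) : Cell) = (x, y) + (x' - x).toNat • ((1, 0) : Cell) := by
      ext <;> (simp; try omega)
    exact ⟨(1, 0), (x' - x).toNat, Or.inl rfl, he, by rw [hseg, if_pos h, ← he]⟩
  · have he : ((x', y) : Cell) = (x, y) + (x - x').toNat • ((-1, 0) : Cell) := by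
      ext <;> (simp; try omega)
    exact ⟨(-1, 0), (x - x').toNat, Or.inr rfl, he, by rw [hseg, if_neg h, ← he]⟩

lemma vseg_append_eq {x y y' : ℤ} (l : List Cell) : ∃ (d : Cell) (k : ℕ),
    (d = (0, 1) ∨ d = (0, -1)) ∧ (x, y') = (x, y) + k • d ∧
      vseg x y y' ++ (x, y') :: l = run d k (x, y) ++ ((x, y) + k • d) :: l := by
  by_cases h : y ≤ y'
  · have he : ((x, y') : Cell) = (x, y) + (y' - y).toNat • ((0, 1) : Cell) := by
      ext <;> (simp; try omega)
    exact ⟨(0, 1), (y' - y).toNat, Or.inl rfl, he, by rw [vseg, if_pos h, ← he]⟩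
  · have he : ((x, y') : Cell) = (x, y) + (y - y').toNat • ((0, -1) : Cell) := by
      ext <;> (simp; try omega)
    exact ⟨(0, -1), (y - y').toNat, Or.inr rfl, he, by rw [vseg, if_neg h, ← he]⟩

lemma exists_hseg_append_eq_cons (x x' y : ℤ) (l : List Cell) :
    ∃ l', hseg x x' y ++ (x', y) :: l = (x, y) :: l' := by
  obtain ⟨d, k, -, -, h⟩ := hseg_append_eq (x := x) (x' := x') (y := y) l
  rw [h]
  exact exists_run_append_eq_cons k _ l

lemma exists_vseg_append_eq_cons (x y y' : ℤ) (l : List Cell) :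
    ∃ l', vseg x y y' ++ (x, y') :: l = (x, y) :: l' := by
  obtain ⟨d, k, -, -, h⟩ := vseg_append_eq (x := x) (y := y) (y' := y') l
  rw [h]
  exact exists_run_append_eq_cons k _ l

/-- A degenerate segment may lie in an odd row. This occurs for ports on the top side of a node of
even degree, whose wires go straight up. -/
lemma isChain_hseg_append {x x' y : ℤ} {l : List Cell} (hy : x = x' ∨ Even y)
    (hl : List.IsChain Step ((x', y) :: l)) : List.IsChain Step (hseg x x' y ++ (x', y) :: l) := by
  rcases hy with rfl | hy
  · simpa [hseg, run] using hl
  obtain ⟨d, k, hd, he, h⟩ := hseg_append_eq (x := x) (x' := x') (y := y) l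
  rw [h]
  refine isChain_run_append (fun i => Or.inr ?_) (he ▸ hl)
  rcases hd with rfl | rfl <;> simp [hy] <;> omega

lemma isChain_vseg_append {x y y' : ℤ} {l : List Cell} (hx : Even x)
    (hl : List.IsChain Step ((x, y') :: l)) : List.IsChain Step (vseg x y y' ++ (x, y') :: l) := by
  obtain ⟨d, k, hd, he, h⟩ := vseg_append_eq (x := x) (y := y) (y' := y') l
  rw [h]
  refine isChain_run_append (fun i => Or.inl ?_) (he ▸ hl)
  rcases hd with rfl | rfl <;> simp [hx] <;> omega

lemma straightH_hseg_append {x x' y : ℤ} {l : List Cell} {p : Cell} (hp : p.2 = y)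
    (h : x < p.1 ∧ p.1 < x' ∨ x' < p.1 ∧ p.1 < x) : StraightH (hseg x x' y ++ (x', y) :: l) p := by
  obtain ⟨d, k, hd, he, hl⟩ := hseg_append_eq (x := x) (x' := x') (y := y) l
  rw [hl]
  rcases hd with rfl | rfl
  · have hk : x' = x + k := by simpa using congrArg Prod.fst he
    left
    convert triple_infix_run_append (d := ((1, 0) : Cell)) (k := k) (i := (p.1 - x - 1).toNat)
      (p := (x, y)) (l := l) (by omega) using 2
    · ext <;> simp <;> omega
    · congr 1
      · ext <;> simp <;> omega
      · congr 1
        ext <;> (simp; try omega)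
  · have hk : x' = x - k := by simpa [sub_eq_add_neg] using congrArg Prod.fst he
    right
    convert triple_infix_run_append (d := ((-1, 0) : Cell)) (k := k) (i := (x - p.1 - 1).toNat)
      (p := (x, y)) (l := l) (by omega) using 2
    · ext <;> simp <;> omega
    · congr 1
      · ext <;> simp <;> omega
      · congr 1
        ext <;> (simp; try omega)

lemma straightV_vseg_append {x y y' : ℤ} {l : List Cell} {p : Cell} (hp : p.1 = x)
    (h : y < p.2 ∧ p.2 < y' ∨ y' < p.2 ∧ p.2 < y) : StraightV (vseg x y y' ++ (x, y') :: l) p := by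
  obtain ⟨d, k, hd, he, hl⟩ := vseg_append_eq (x := x) (y := y) (y' := y') l
  rw [hl]
  rcases hd with rfl | rfl
  · have hk : y' = y + k := by simpa using congrArg Prod.snd he
    left
    convert triple_infix_run_append (d := ((0, 1) : Cell)) (k := k) (i := (p.2 - y - 1).toNat)
      (p := (x, y)) (l := l) (by omega) using 2
    · ext <;> simp <;> omega
    · congr 1
      · ext <;> simp <;> omega
      · congr 1
        ext <;> (simp; try omega)
  · have hk : y' = y - k := by simpa [sub_eq_add_neg] using congrArg Prod.snd he
    right
    convert triple_infix_run_append (d := ((0, -1) : Cell)) (k := k) (i := (y - p.2 - 1).toNat)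
      (p := (x, y)) (l := l) (by omega) using 2
    · ext <;> simp <;> omega
    · congr 1
      · ext <;> simp <;> omega
      · congr 1
        ext <;> (simp; try omega)

lemma StraightH.of_infix {r r' : List Cell} {p : Cell} (h : StraightH r p) (hr : r <:+: r') :
    StraightH r' p := h.imp (fun h => h.trans hr) fun h => h.trans hr

lemma StraightV.of_infix {r r' : List Cell} {p : Cell} (h : StraightV r p) (hr : r <:+: r') :
    StraightV r' p := h.imp (fun h => h.trans hr) fun h => h.trans hr

lemma StraightV.reverse {r : List Cell} {p : Cell} (h : StraightV r p) : StraightV r.reverse p := by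
  rcases h with h | h
  · right
    simpa using List.reverse_infix.mpr h
  · left
    simpa using List.reverse_infix.mpr h

end Cell

/-! ### Ports of processing nodes -/

/-- Polyline `(a, b)`, `(a, d)`, `(X, d)`, `(X, Y)`, without the last cell. -/
def halfWire (a b d X Y : ℤ) : List Cell :=
  Cell.vseg a b d ++ (Cell.hseg a X d ++ Cell.vseg X d Y)

lemma mem_halfWire {a b d X Y : ℤ} (hdb : d ≤ b) (hdY : d < Y) {p : Cell} :
    p ∈ halfWire a b d X Y ↔ (p.1 = a ∧ d < p.2 ∧ p.2 ≤ b) ∨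
      (p.2 = d ∧ (a ≤ p.1 ∧ p.1 < X ∨ X < p.1 ∧ p.1 ≤ a)) ∨ (p.1 = X ∧ d ≤ p.2 ∧ p.2 < Y) := by
  rw [halfWire, List.mem_append, List.mem_append, Cell.mem_vseg, Cell.mem_hseg, Cell.mem_vseg]
  constructor <;> rintro (h | h | h) <;> omega

lemma halfWire_append (a b d X Y : ℤ) (l : List Cell) :
    ∃ l' l'', halfWire a b d X Y ++ (X, Y) :: l = Cell.vseg a b d ++ (a, d) :: l' ∧
      (a, d) :: l' = Cell.hseg a X d ++ (X, d) :: l'' ∧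
      (X, d) :: l'' = Cell.vseg X d Y ++ (X, Y) :: l := by
  obtain ⟨l'', h''⟩ := Cell.exists_vseg_append_eq_cons X d Y l
  obtain ⟨l', h'⟩ := Cell.exists_hseg_append_eq_cons a X d l''
  refine ⟨l', l'', ?_, h'.symm, h''.symm⟩
  rw [halfWire, ← h', ← h'']
  simp

lemma exists_halfWire_append_eq_cons (a b d X Y : ℤ) (l : List Cell) :
    ∃ l', halfWire a b d X Y ++ (X, Y) :: l = (a, b) :: l' := by
  obtain ⟨l', l'', h, -, -⟩ := halfWire_append a b d X Y l
  rw [h]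
  exact Cell.exists_vseg_append_eq_cons a b d l'

lemma isChain_halfWire_append {a b d X Y : ℤ} {l : List Cell} (ha : Even a)
    (hd : a = X ∨ Even d) (hX : Even X) (hl : List.IsChain Cell.Step ((X, Y) :: l)) :
    List.IsChain Cell.Step (halfWire a b d X Y ++ (X, Y) :: l) := by
  obtain ⟨l', l'', h, h', h''⟩ := halfWire_append a b d X Y l
  rw [h]
  refine Cell.isChain_vseg_append ha ?_
  rw [h']
  refine Cell.isChain_hseg_append hd ?_
  rw [h'']
  exact Cell.isChain_vseg_append hX hl

lemma straightV_halfWire_append {a b d X Y : ℤ} {l : List Cell} {p : Cell} (hp : p.1 = X)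
    (h : d < p.2) (h' : p.2 < Y) : Cell.StraightV (halfWire a b d X Y ++ (X, Y) :: l) p := by
  refine (Cell.straightV_vseg_append (l := l) hp (Or.inl ⟨h, h'⟩)).of_infix ?_
  rw [halfWire]
  refine List.IsSuffix.isInfix ⟨Cell.vseg a b d ++ Cell.hseg a X d, ?_⟩
  simp

lemma nodup_halfWire {a b d X Y : ℤ} (_hdb : d ≤ b) (hdY : d < Y)
    (h : a = X → d = b) : (halfWire a b d X Y).Nodup := by
  rw [halfWire, List.nodup_append', List.nodup_append']
  refine ⟨Cell.nodup_vseg _ _ _, ⟨Cell.nodup_hseg _ _ _, Cell.nodup_vseg _ _ _, ?_⟩, ?_⟩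
  · intro p h1 h2
    rw [Cell.mem_hseg] at h1
    rw [Cell.mem_vseg] at h2
    omega
  · intro p h1 h2
    rw [Cell.mem_vseg] at h1
    rw [List.mem_append, Cell.mem_hseg, Cell.mem_vseg] at h2
    omega

/-- First coordinate of the cell of port `i` of a processing node with `x` connections. -/
def portA (x i : ℕ) : ℤ := if x ≤ 4 then 0 else if i % 2 = 0 then i else i - 1

/-- Second coordinate of the cell of port `i`. -/
def portB (x i : ℕ) : ℤ := if x ≤ 4 then 0 else if i % 2 = 0 then x - 1 else 0

/-- The row in which the wire of port `i` reaches its column. -/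
def portD (x i : ℕ) : ℤ :=
  if x ≤ 4 then (if i = 3 then -2 else 0) else if i % 2 = 0 then x - 1 else 2 * i - 2 * x

/-- The column in which the wire of port `i` leaves the processing node upwards. -/
def portX (x i : ℕ) : ℤ :=
  if x ≤ 4 then (if i = 0 then 0 else if i = 1 then 2 else if i = 2 then -2 else 4)
  else if i % 2 = 0 then i else 4 * x - 2 * i

section Ports

variable {D x i : ℕ}

lemma even_portA : Even (portA x i) := by
  rw [Int.even_iff]; unfold portA; split_ifs <;> omega

lemma even_portX : Even (portX x i) := by
  rw [Int.even_iff]; unfold portX; split_ifs <;> omega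

lemma portA_eq_or_even_portD : portA x i = portX x i ∨ Even (portD x i) := by
  rw [Int.even_iff]; unfold portA portX portD; split_ifs <;> omega

lemma portD_le_portB (hi : i < x) : portD x i ≤ portB x i := by
  unfold portD portB; split_ifs <;> omega

lemma portD_eq_portB (hi : i < x) (h : portA x i = portX x i) : portD x i = portB x i := by
  revert h; unfold portD portB portA portX; split_ifs <;> omega

lemma port_bounds (hD : 4 ≤ D) (hx : x ≤ D) (hi : i < x) :
    (0 ≤ portA x i ∧ portA x i < nodeSide x) ∧ (0 ≤ portB x i ∧ portB x i < nodeSide x) ∧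
      (nodeSide x : ℤ) ≤ D ∧ -2 ≤ portX x i ∧ portX x i ≤ 4 * D ∧ -(2 * D) ≤ portD x i := by
  unfold portA portB portD portX nodeSide
  split_ifs <;> simp <;> omega

/-- Cells of the polyline of port `i`, relative to the processing node. -/
def PortCell (x i : ℕ) (Y : ℤ) (p q : ℤ) : Prop :=
  (p = portA x i ∧ portD x i < q ∧ q ≤ portB x i) ∨
    (q = portD x i ∧ (portA x i ≤ p ∧ p < portX x i ∨ portX x i < p ∧ p ≤ portA x i)) ∨
    (p = portX x i ∧ portD x i ≤ q ∧ q < Y)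

lemma PortCell.bounds {Y p q : ℤ} (hD : 4 ≤ D) (hx : x ≤ D) (hi : i < x)
    (h : PortCell x i Y p q) : -2 ≤ p ∧ p ≤ 4 * D ∧ -(2 * D) ≤ q := by
  obtain ⟨h1, h2, h3, h4, h5, h6⟩ := port_bounds hD hx hi
  unfold PortCell at h
  omega

lemma PortCell.outside {Y p q : ℤ} (hi : i < x) (h : PortCell x i Y p q)
    (hne : ¬ (p = portA x i ∧ q = portB x i)) :
    ¬ (0 ≤ p ∧ p < nodeSide x ∧ 0 ≤ q ∧ q < nodeSide x) := by
  revert h hne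
  unfold PortCell portA portB portD portX nodeSide
  split_ifs <;> simp <;> omega

/-- At a node of degree at most 4 the wires leave the single square upwards, to the right, to the
left, and downwards around the right. At a larger node even ports go straight up from the top side.
Odd ports leave the bottom side and turn right; a larger index turns in a higher row and rises in a
column further left, so these wires are nested U-shapes. -/
lemma PortCell.eq {i' : ℕ} {Y Y' p q : ℤ} (hi : i < x) (hi' : i' < x) (h : PortCell x i Y p q)
    (h' : PortCell x i' Y' p q) (hne : ¬ (p = portA x i ∧ q = portB x i))
    (hne' : ¬ (p = portA x i' ∧ q = portB x i')) : i = i' := by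
  revert h h' hne hne'
  unfold PortCell portA portB portD portX
  by_cases hx : x ≤ 4
  · simp only [hx, if_true]
    split_ifs <;> omega
  · simp only [hx, if_false]
    split_ifs <;> omega

end Ports

/-! ### Layouts of cubic area -/

lemma eq_of_mem_block {D : ℕ} {k k' : ℕ} {q : ℤ}
    (h : -2 ≤ q - (4 * D + 8) * (k : ℤ) ∧ q - (4 * D + 8) * (k : ℤ) ≤ 4 * D)
    (h' : -2 ≤ q - (4 * D + 8) * (k' : ℤ) ∧ q - (4 * D + 8) * (k' : ℤ) ≤ 4 * D) : k = k' := by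
  by_contra hne
  rcases Nat.lt_or_gt_of_ne hne with hlt | hlt
  · have : ((4 * D + 8 : ℕ) : ℤ) * ((k : ℤ) + 1) ≤ (4 * D + 8 : ℕ) * (k' : ℤ) :=
      mul_le_mul_of_nonneg_left (by omega) (by omega)
    push_cast at this
    rw [mul_add, mul_one] at this
    omega
  · have : ((4 * D + 8 : ℕ) : ℤ) * ((k' : ℤ) + 1) ≤ (4 * D + 8 : ℕ) * (k : ℤ) :=
      mul_le_mul_of_nonneg_left (by omega) (by omega)
    push_cast at this
    rw [mul_add, mul_one] at this
    omega

/-- Position of an element in a finite set. -/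
def rankIn {k : ℕ} (S : Finset (Fin k)) (c : Fin k) : ℕ := (S.filter (· < c)).card

lemma rankIn_lt {k : ℕ} {S : Finset (Fin k)} {c : Fin k} (hc : c ∈ S) : rankIn S c < S.card :=
  Finset.card_lt_card (Finset.filter_ssubset.mpr ⟨c, hc, lt_irrefl c⟩)

lemma rankIn_lt_rankIn {k : ℕ} {S : Finset (Fin k)} {c c' : Fin k} (hc : c ∈ S) (h : c < c') :
    rankIn S c < rankIn S c' := by
  refine Finset.card_lt_card (Finset.ssubset_iff_of_subset ?_ |>.mpr ⟨c, ?_, ?_⟩)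
  · intro a ha
    rw [Finset.mem_filter] at ha ⊢
    exact ⟨ha.1, ha.2.trans h⟩
  · simp [hc, h]
  · simp

lemma rankIn_inj {k : ℕ} {S : Finset (Fin k)} {c c' : Fin k} (hc : c ∈ S) (hc' : c' ∈ S)
    (h : rankIn S c = rankIn S c') : c = c' := by
  rcases lt_trichotomy c c' with hlt | heq | hgt
  · have := rankIn_lt_rankIn hc hlt; omega
  · exact heq
  · have := rankIn_lt_rankIn hc' hgt; omega

namespace Tanner

variable (T : Tanner) (D : ℕ)

/-- Index of a processing node in the row of all processing nodes. -/
def nodeIndex : Fin T.n ⊕ Fin T.m → ℕ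
  | Sum.inl v => v
  | Sum.inr c => T.n + c

lemma nodeIndex_injective : Function.Injective T.nodeIndex := by
  rintro (v | c) (v' | c') h <;> simp only [nodeIndex] at h
  · rw [Fin.ext h]
  · omega
  · omega
  · rw [Fin.ext (Nat.add_left_cancel h)]

lemma nodeIndex_lt (z : Fin T.n ⊕ Fin T.m) : T.nodeIndex z < T.n + T.m := by
  rcases z with v | c <;> simp only [nodeIndex] <;> omega

/-- Horizontal position of a processing node. -/
def nodeX (z : Fin T.n ⊕ Fin T.m) : ℤ := (4 * D + 8) * (T.nodeIndex z : ℤ)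

lemma even_nodeX (z : Fin T.n ⊕ Fin T.m) : Even (T.nodeX D z) :=
  Even.mul_right (by rw [Int.even_iff]; omega) _

/-- Polyline from port `i` of the node `z` up to row `Y`. -/
def portWire (z : Fin T.n ⊕ Fin T.m) (i : ℕ) (Y : ℤ) : List Cell :=
  halfWire (T.nodeX D z + portA (T.degree z) i) (portB (T.degree z) i) (portD (T.degree z) i)
    (T.nodeX D z + portX (T.degree z) i) Y

/-- The cell of port `i` of the node `z`. -/
def portSrc (z : Fin T.n ⊕ Fin T.m) (i : ℕ) : Cell :=
  (T.nodeX D z + portA (T.degree z) i, portB (T.degree z) i)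

variable {T D}

lemma mem_portWire {z : Fin T.n ⊕ Fin T.m} {i : ℕ} {Y : ℤ} {p : Cell} (hD : 4 ≤ D)
    (hz : T.degree z ≤ D) (hi : i < T.degree z) (hY : D < Y) :
    p ∈ T.portWire D z i Y ↔ PortCell (T.degree z) i Y (p.1 - T.nodeX D z) p.2 := by
  obtain ⟨h1, h2, h3, h4, h5, h6⟩ := port_bounds hD hz hi
  have h7 := portD_le_portB hi
  rw [portWire, mem_halfWire h7 (by omega), PortCell]
  constructor <;> rintro (h | h | h) <;> omega

lemma ne_portSrc_iff {z : Fin T.n ⊕ Fin T.m} {i : ℕ} {p : Cell} : p ≠ T.portSrc D z i ↔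
    ¬ (p.1 - T.nodeX D z = portA (T.degree z) i ∧ p.2 = portB (T.degree z) i) := by
  rw [portSrc, Ne, Prod.ext_iff]
  simp only
  constructor <;> intro h h' <;> exact h (by omega)

/-- Port wires stay within the block of their node, and blocks are disjoint. The attachment cells
are excluded because all ports of a small node share one cell. -/
lemma portWire_unique {z z' : Fin T.n ⊕ Fin T.m} {i i' : ℕ} {Y Y' : ℤ} {p : Cell} (hD : 4 ≤ D)
    (hz : T.degree z ≤ D) (hz' : T.degree z' ≤ D) (hi : i < T.degree z) (hi' : i' < T.degree z')
    (hY : D < Y) (hY' : D < Y') (h : p ∈ T.portWire D z i Y) (h' : p ∈ T.portWire D z' i' Y') :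
    z = z' ∧ (p ≠ T.portSrc D z i → p ≠ T.portSrc D z' i' → i = i') := by
  rw [mem_portWire hD hz hi hY] at h
  rw [mem_portWire hD hz' hi' hY'] at h'
  obtain ⟨h1, h2, -⟩ := h.bounds hD hz hi
  obtain ⟨h1', h2', -⟩ := h'.bounds hD hz' hi'
  have hzz : z = z' := T.nodeIndex_injective (eq_of_mem_block ⟨h1, h2⟩ ⟨h1', h2'⟩)
  subst hzz
  refine ⟨rfl, fun hne hne' => ?_⟩
  rw [ne_portSrc_iff] at hne hne'
  exact h.eq hi hi' h' hne hne'

lemma portX_unique {z z' : Fin T.n ⊕ Fin T.m} {i i' : ℕ} (hD : 4 ≤ D)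
    (hz : T.degree z ≤ D) (hz' : T.degree z' ≤ D) (hi : i < T.degree z) (hi' : i' < T.degree z')
    (h : T.nodeX D z + portX (T.degree z) i = T.nodeX D z' + portX (T.degree z') i') :
    z = z' ∧ i = i' := by
  obtain ⟨-, h2, h3, -⟩ := port_bounds hD hz hi
  obtain ⟨-, h2', h3', -⟩ := port_bounds hD hz' hi'
  have h7 := portD_le_portB hi
  have h7' := portD_le_portB hi'
  have hY : (D : ℤ) < D + 2 := by omega
  -- Row D + 1 lies above all nodes, so both wires are there in their exit columns; equal columns
  -- give a common cell.
  have hm : (T.nodeX D z + portX (T.degree z) i, (D : ℤ) + 1) ∈ T.portWire D z i (D + 2) := by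
    rw [mem_portWire hD hz hi hY]
    exact Or.inr (Or.inr ⟨by simp, by simp only; omega, by simp⟩)
  have hm' : (T.nodeX D z + portX (T.degree z) i, (D : ℤ) + 1) ∈ T.portWire D z' i' (D + 2) := by
    rw [mem_portWire hD hz' hi' hY]
    exact Or.inr (Or.inr ⟨by simp [h], by simp only; omega, by simp⟩)
  obtain ⟨h8, h9⟩ := portWire_unique hD hz hz' hi hi' hY hY hm hm'
  refine ⟨h8, h9 ?_ ?_⟩ <;> rw [ne_portSrc_iff] <;> rintro ⟨-, h⟩ <;> simp only at h <;> omega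

lemma mem_square_nodeX {z : Fin T.n ⊕ Fin T.m} {p : Cell} :
    p ∈ Cell.square (T.nodeX D z, 0) (nodeSide (T.degree z)) ↔
      0 ≤ p.1 - T.nodeX D z ∧ p.1 - T.nodeX D z < nodeSide (T.degree z) ∧ 0 ≤ p.2 ∧
        p.2 < nodeSide (T.degree z) := by
  simp only [Cell.square, Set.mem_ofPred_eq]
  constructor <;> rintro ⟨h1, h2, h3, h4⟩ <;> refine ⟨?_, ?_, ?_, ?_⟩ <;> omega

lemma nodeSide_le {x : ℕ} (hD : 4 ≤ D) (hx : x ≤ D) : nodeSide x ≤ D := by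
  unfold nodeSide; split_ifs <;> omega

lemma portWire_outside {z z' : Fin T.n ⊕ Fin T.m} {i : ℕ} {Y : ℤ} {p : Cell} (hD : 4 ≤ D)
    (hz : T.degree z ≤ D) (hz' : T.degree z' ≤ D) (hi : i < T.degree z) (hY : D < Y)
    (h : p ∈ T.portWire D z i Y) (hne : p ≠ T.portSrc D z i) :
    p ∉ Cell.square (T.nodeX D z', 0) (nodeSide (T.degree z')) := by
  intro hs
  rw [mem_portWire hD hz hi hY] at h
  rw [mem_square_nodeX] at hs
  obtain ⟨h1, h2, -⟩ := h.bounds hD hz hi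
  have hside := nodeSide_le hD hz'
  have hzz : z = z' := T.nodeIndex_injective
    (eq_of_mem_block (D := D) (q := p.1) ⟨h1, h2⟩ ⟨by unfold nodeX at hs; omega, by unfold nodeX at hs; omega⟩)
  subst hzz
  exact h.outside hi (ne_portSrc_iff.mp hne) hs

lemma portWire_high {z : Fin T.n ⊕ Fin T.m} {i : ℕ} {Y : ℤ} {p : Cell} (hD : 4 ≤ D)
    (hz : T.degree z ≤ D) (hi : i < T.degree z) (hY : D < Y) (h : p ∈ T.portWire D z i Y)
    (hp : D < p.2) :
    p.1 = T.nodeX D z + portX (T.degree z) i ∧ portD (T.degree z) i < p.2 ∧ p.2 < Y := by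
  rw [mem_portWire hD hz hi hY] at h
  obtain ⟨-, h2, h3, -⟩ := port_bounds hD hz hi
  have h7 := portD_le_portB hi
  unfold PortCell at h
  omega

lemma portWire_snd_lt {z : Fin T.n ⊕ Fin T.m} {i : ℕ} {Y : ℤ} {p : Cell} (hD : 4 ≤ D)
    (hz : T.degree z ≤ D) (hi : i < T.degree z) (hY : D < Y) (h : p ∈ T.portWire D z i Y) :
    p.2 < Y := by
  by_cases hp : (D : ℤ) < p.2
  · exact (portWire_high hD hz hi hY h hp).2.2
  · omega

end Tanner

lemma List.cons_tail_dropLast_append {α : Type*} {l l₁ l₂ : List α} {a b : α} (h₁ : l = a :: l₁)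
    (h₂ : l = l₂ ++ [b]) (hab : a ≠ b) : a :: (l.tail.dropLast ++ [b]) = l := by
  subst h₁
  cases l₂ with
  | nil =>
    simp only [List.nil_append, List.cons.injEq] at h₂
    exact absurd h₂.1 hab
  | cons c l₂ =>
    simp only [List.cons_append, List.cons.injEq] at h₂
    simp [h₂.2]

/-! ### Routes between two ports -/

namespace Tanner

variable (T : Tanner) (D : ℕ)

/-- The column of port `i` of the node `z`. -/
def portCol (z : Fin T.n ⊕ Fin T.m) (i : ℕ) : ℤ := T.nodeX D z + portX (T.degree z) i

/-- The route between two ports along the horizontal track in row `Y`. -/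
def route (z z' : Fin T.n ⊕ Fin T.m) (i i' : ℕ) (Y : ℤ) : List Cell :=
  T.portWire D z i Y ++ (Cell.hseg (T.portCol D z i) (T.portCol D z' i') Y ++
    (T.portWire D z' i' Y ++ [(T.portCol D z' i', Y)]).reverse)

variable {T D} {z z' : Fin T.n ⊕ Fin T.m} {i i' : ℕ} {Y : ℤ}

lemma route_eq_cons : ∃ l, T.route D z z' i i' Y = T.portSrc D z i :: l := by
  rw [route, List.reverse_append]
  simp only [List.reverse_cons, List.reverse_nil, List.nil_append, List.singleton_append]
  obtain ⟨l, hl⟩ := Cell.exists_hseg_append_eq_cons (T.portCol D z i) (T.portCol D z' i') Y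
    (T.portWire D z' i' Y).reverse
  rw [hl]
  exact exists_halfWire_append_eq_cons _ _ _ _ _ _

lemma route_eq_append : ∃ l, T.route D z z' i i' Y = l ++ [T.portSrc D z' i'] := by
  obtain ⟨l, hl⟩ := exists_halfWire_append_eq_cons (T.nodeX D z' + portA (T.degree z') i')
    (portB (T.degree z') i') (portD (T.degree z') i') (T.portCol D z' i') Y []
  refine ⟨T.portWire D z i Y ++ (Cell.hseg (T.portCol D z i) (T.portCol D z' i') Y ++ l.reverse), ?_⟩
  have hl' : T.portWire D z' i' Y ++ [(T.portCol D z' i', Y)] = T.portSrc D z' i' :: l := hl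
  rw [route, hl']
  simp

lemma mem_route {p : Cell} : p ∈ T.route D z z' i i' Y ↔ p ∈ T.portWire D z i Y ∨
    p ∈ Cell.hseg (T.portCol D z i) (T.portCol D z' i') Y ∨ p ∈ T.portWire D z' i' Y ∨
      p = (T.portCol D z' i', Y) := by
  rw [route, List.mem_append, List.mem_append, List.mem_reverse, List.mem_append,
    List.mem_singleton]

lemma isChain_route (hY : Even Y) : List.IsChain Cell.Step (T.route D z z' i i' Y) := by
  have hc : List.IsChain Cell.Step
      (T.portWire D z' i' Y ++ [(T.portCol D z' i', Y)]).reverse := by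
    rw [List.isChain_reverse]
    have := isChain_halfWire_append (a := T.nodeX D z' + portA (T.degree z') i')
      (b := portB (T.degree z') i') (d := portD (T.degree z') i') (X := T.portCol D z' i')
      (Y := Y) (l := []) ((T.even_nodeX D z').add even_portA)
      (portA_eq_or_even_portD.imp (fun h => by rw [h]; rfl) id)
      ((T.even_nodeX D z').add even_portX) (by simp)
    exact this.imp fun _ _ h => h.symm
  rw [List.reverse_append] at hc
  simp only [List.reverse_cons, List.reverse_nil, List.nil_append, List.singleton_append] at hc
  rw [route, List.reverse_append]
  simp only [List.reverse_cons, List.reverse_nil, List.nil_append, List.singleton_append]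
  have hh := Cell.isChain_hseg_append (x := T.portCol D z i) (Or.inr hY) hc
  obtain ⟨l, hl⟩ := Cell.exists_hseg_append_eq_cons (T.portCol D z i) (T.portCol D z' i') Y
    (T.portWire D z' i' Y).reverse
  rw [hl] at hh ⊢
  exact isChain_halfWire_append ((T.even_nodeX D z).add even_portA)
    (portA_eq_or_even_portD.imp (fun h => by rw [h]) id)
    ((T.even_nodeX D z).add even_portX) hh

lemma nodup_portWire (hD : 4 ≤ D) (hz : T.degree z ≤ D) (hi : i < T.degree z)
    (hY : D < Y) : (T.portWire D z i Y).Nodup := by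
  obtain ⟨-, h2, h3, -⟩ := port_bounds hD hz hi
  have h7 := portD_le_portB hi
  exact nodup_halfWire h7 (by omega) fun h => portD_eq_portB hi (by omega)

lemma nodup_route (hD : 4 ≤ D) (hz : T.degree z ≤ D) (hz' : T.degree z' ≤ D)
    (hi : i < T.degree z) (hi' : i' < T.degree z') (hY : D < Y) (hne : z ≠ z') : (T.route D z z' i i' Y).Nodup := by
  have h1 : ∀ p ∈ T.portWire D z i Y, p.2 < Y := fun p => portWire_snd_lt hD hz hi hY
  have h2 : ∀ p ∈ T.portWire D z' i' Y, p.2 < Y := fun p => portWire_snd_lt hD hz' hi' hY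
  rw [route, List.nodup_append', List.nodup_append', List.nodup_reverse, List.nodup_append']
  refine ⟨nodup_portWire hD hz hi hY, ⟨Cell.nodup_hseg _ _ _,
    ⟨nodup_portWire hD hz' hi' hY, by simp, ?_⟩, ?_⟩, ?_⟩
  · intro p hp hp'
    have := h2 p hp
    rw [List.mem_singleton.mp hp'] at this
    exact lt_irrefl _ this
  · intro p hp hp'
    rw [Cell.mem_hseg] at hp
    rw [List.mem_reverse, List.mem_append, List.mem_singleton] at hp'
    rcases hp' with hp' | hp'
    · have := h2 p hp'
      omega
    · rw [hp'] at hp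
      simp only at hp
      omega
  · intro p hp hp'
    rw [List.mem_append, Cell.mem_hseg, List.mem_reverse, List.mem_append, List.mem_singleton] at hp'
    have h3 := h1 p hp
    rcases hp' with hp' | hp' | hp'
    · omega
    · exact hne (portWire_unique hD hz hz' hi hi' hY hY hp hp').1
    · rw [hp'] at h3
      exact lt_irrefl _ h3

lemma portSrc_mem_square (hD : 4 ≤ D) (hz : T.degree z ≤ D) (hi : i < T.degree z) :
    T.portSrc D z i ∈ Cell.square (T.nodeX D z, 0) (nodeSide (T.degree z)) := by
  obtain ⟨h1, h2, -⟩ := port_bounds hD hz hi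
  rw [mem_square_nodeX, portSrc]
  refine ⟨?_, ?_, ?_, ?_⟩ <;> simp only <;> omega

lemma portSrc_snd_le (hD : 4 ≤ D) (hz : T.degree z ≤ D) (hi : i < T.degree z) : (T.portSrc D z i).2 ≤ D := by
  obtain ⟨-, h2, h3, -⟩ := port_bounds hD hz hi
  simp only [portSrc]
  omega

lemma disjoint_square_nodeX (hD : 4 ≤ D) (hz : T.degree z ≤ D) (hz' : T.degree z' ≤ D)
    (hne : z ≠ z') : Disjoint (Cell.square (T.nodeX D z, 0) (nodeSide (T.degree z)))
      (Cell.square (T.nodeX D z', 0) (nodeSide (T.degree z'))) := by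
  rw [Set.disjoint_left]
  intro p hp hp'
  rw [mem_square_nodeX] at hp hp'
  have h1 := nodeSide_le hD hz
  have h2 := nodeSide_le hD hz'
  unfold nodeX at hp hp'
  exact hne (T.nodeIndex_injective (eq_of_mem_block (D := D) (q := p.1)
    ⟨by omega, by omega⟩ ⟨by omega, by omega⟩))

lemma portSrc_ne (hD : 4 ≤ D) (hz : T.degree z ≤ D) (hz' : T.degree z' ≤ D)
    (hi : i < T.degree z) (hi' : i' < T.degree z') (hne : z ≠ z') : T.portSrc D z i ≠ T.portSrc D z' i' := fun h =>
  Set.disjoint_left.mp (disjoint_square_nodeX hD hz hz' hne) (portSrc_mem_square hD hz hi)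
    (h ▸ portSrc_mem_square hD hz' hi')

lemma route_eq (hD : 4 ≤ D) (hz : T.degree z ≤ D) (hz' : T.degree z' ≤ D)
    (hi : i < T.degree z) (hi' : i' < T.degree z') (hne : z ≠ z') :
    T.portSrc D z i :: ((T.route D z z' i i' Y).tail.dropLast ++ [T.portSrc D z' i']) = T.route D z z' i i' Y := by
  obtain ⟨l₁, h₁⟩ := route_eq_cons (T := T) (D := D) (z := z) (z' := z') (i := i) (i' := i') (Y := Y)
  obtain ⟨l₂, h₂⟩ := route_eq_append (T := T) (D := D) (z := z) (z' := z') (i := i) (i' := i') (Y := Y)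
  exact List.cons_tail_dropLast_append h₁ h₂ (portSrc_ne hD hz hz' hi hi' hne)

lemma mem_route_interior (hD : 4 ≤ D) (hz : T.degree z ≤ D) (hz' : T.degree z' ≤ D)
    (hi : i < T.degree z) (hi' : i' < T.degree z') (hY : D < Y) (hne : z ≠ z') {p : Cell} :
    p ∈ (T.route D z z' i i' Y).tail.dropLast ↔
      p ∈ T.route D z z' i i' Y ∧ p ≠ T.portSrc D z i ∧ p ≠ T.portSrc D z' i' := by
  have h := nodup_route hD hz hz' hi hi' hY hne
  have he := route_eq hD hz hz' hi hi' (Y := Y) hne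
  generalize (T.route D z z' i i' Y).tail.dropLast = w at he ⊢
  rw [← he] at h ⊢
  rw [List.nodup_cons, List.nodup_append'] at h
  obtain ⟨h1, h2, -, h3⟩ := h
  constructor
  · intro hp
    refine ⟨by simp [hp], ?_, ?_⟩
    · rintro rfl
      exact h1 (by simp [hp])
    · rintro rfl
      exact h3 hp (by simp)
  · rintro ⟨hp, hp1, hp2⟩
    simp only [List.mem_cons, List.mem_append, List.not_mem_nil, or_false] at hp
    rcases hp with hp | hp | hp
    · exact absurd hp hp1
    · exact hp
    · exact absurd hp hp2

lemma col_mem_route_interior (hD : 4 ≤ D) (hz : T.degree z ≤ D) (hz' : T.degree z' ≤ D)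
    (hi : i < T.degree z) (hi' : i' < T.degree z') (hY : D < Y) (hne : z ≠ z') :
    (T.portCol D z' i', Y) ∈ (T.route D z z' i i' Y).tail.dropLast := by
  rw [mem_route_interior hD hz hz' hi hi' hY hne, mem_route]
  have h1 := portSrc_snd_le hD hz hi
  have h2 := portSrc_snd_le hD hz' hi'
  refine ⟨by simp, ?_, ?_⟩
  · intro h
    rw [← h] at h1
    simp only at h1
    omega
  · intro h
    rw [← h] at h2
    simp only at h2
    omega

lemma straightV_route_left {p : Cell} (hp : p.1 = T.portCol D z i)
    (h : portD (T.degree z) i < p.2) (h' : p.2 < Y) :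
    Cell.StraightV (T.route D z z' i i' Y) p := by
  rw [route, List.reverse_append]
  simp only [List.reverse_cons, List.reverse_nil, List.nil_append, List.singleton_append]
  obtain ⟨l, hl⟩ := Cell.exists_hseg_append_eq_cons (T.portCol D z i) (T.portCol D z' i') Y
    (T.portWire D z' i' Y).reverse
  rw [hl]
  exact straightV_halfWire_append hp h h'

lemma straightV_route_right {p : Cell} (hp : p.1 = T.portCol D z' i')
    (h : portD (T.degree z') i' < p.2) (h' : p.2 < Y) :
    Cell.StraightV (T.route D z z' i i' Y) p := by
  rw [route, ← List.append_assoc]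
  exact (straightV_halfWire_append hp h h' (l := [])).reverse.of_infix
    (List.suffix_append _ _).isInfix

lemma straightH_route {p : Cell} (hp : p.2 = Y)
    (h : T.portCol D z i < p.1 ∧ p.1 < T.portCol D z' i' ∨
      T.portCol D z' i' < p.1 ∧ p.1 < T.portCol D z i) :
    Cell.StraightH (T.route D z z' i i' Y) p := by
  rw [route, List.reverse_append]
  simp only [List.reverse_cons, List.reverse_nil, List.nil_append, List.singleton_append]
  exact (Cell.straightH_hseg_append hp h).of_infix (List.suffix_append _ _).isInfix

end Tanner

/-! ### The layout with one row of nodes and its area -/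

namespace Tanner

variable {T : Tanner} {D : ℕ}

/-- A route is straight in vertical direction at each of its cells above the nodes and off its own
track. -/
lemma straightV_route {z z' : Fin T.n ⊕ Fin T.m} {i i' : ℕ} {Y : ℤ} {p : Cell} (hD : 4 ≤ D)
    (hz : T.degree z ≤ D) (hz' : T.degree z' ≤ D) (hi : i < T.degree z) (hi' : i' < T.degree z')
    (hY : D < Y) (hp : D < p.2)
    (h : p ∈ T.portWire D z i Y ∨ p ∈ T.portWire D z' i' Y) :
    Cell.StraightV (T.route D z z' i i' Y) p ∧
      (p.1 = T.portCol D z i ∨ p.1 = T.portCol D z' i') := by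
  rcases h with h | h
  · obtain ⟨h1, h2, h3⟩ := portWire_high hD hz hi hY h hp
    exact ⟨straightV_route_left h1 h2 h3, Or.inl h1⟩
  · obtain ⟨h1, h2, h3⟩ := portWire_high hD hz' hi' hY h hp
    exact ⟨straightV_route_right h1 h2 h3, Or.inr h1⟩

/-- The port index at the variable node of an edge. -/
def varPort (T : Tanner) (v : Fin T.n) (c : Fin T.m) : ℕ := rankIn (T.checksOf v) c

/-- The port index at the check node of an edge. -/
def checkPort (T : Tanner) (v : Fin T.n) (c : Fin T.m) : ℕ := rankIn (T.varsOf c) v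

/-- The track of an edge. -/
def edgeRow (T : Tanner) (D : ℕ) (v : Fin T.n) (c : Fin T.m) : ℤ :=
  2 * D + 4 + 2 * ((v * T.m + c : ℕ) : ℤ)

/-- The route of an edge. -/
def edgeRoute (T : Tanner) (D : ℕ) (v : Fin T.n) (c : Fin T.m) : List Cell :=
  T.route D (Sum.inl v) (Sum.inr c) (T.varPort v c) (T.checkPort v c) (T.edgeRow D v c)

lemma lt_edgeRow (v : Fin T.n) (c : Fin T.m) : (D : ℤ) < T.edgeRow D v c := by
  unfold edgeRow; omega

lemma even_edgeRow (v : Fin T.n) (c : Fin T.m) : Even (T.edgeRow D v c) := by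
  unfold edgeRow; rw [Int.even_iff]; omega

lemma edgeRow_inj {v v' : Fin T.n} {c c' : Fin T.m} (h : T.edgeRow D v c = T.edgeRow D v' c') :
    (v, c) = (v', c') := by
  have h1 : (v : ℕ) * T.m + c = v' * T.m + c' := by unfold edgeRow at h; omega
  have hv : (v : ℕ) = v' := by
    have h2 := congrArg (· / T.m) h1
    have hm : 0 < T.m := c.pos
    simp only [mul_comm _ T.m] at h2
    rwa [Nat.mul_add_div hm, Nat.mul_add_div hm, Nat.div_eq_of_lt c.2, Nat.div_eq_of_lt c'.2,
      add_zero, add_zero] at h2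
  rw [hv] at h1
  exact Prod.ext (Fin.ext hv) (Fin.ext (Nat.add_left_cancel h1))

lemma varPort_lt {v : Fin T.n} {c : Fin T.m} (h : (v, c) ∈ T.edges) :
    T.varPort v c < T.degree (Sum.inl v) :=
  rankIn_lt (T.mem_checksOf_iff.mpr (T.mem_edges_iff.mp h))

lemma checkPort_lt {v : Fin T.n} {c : Fin T.m} (h : (v, c) ∈ T.edges) :
    T.checkPort v c < T.degree (Sum.inr c) :=
  rankIn_lt (T.mem_varsOf_iff.mpr (T.mem_edges_iff.mp h))

lemma edge_eq_of_varPort_eq {v v' : Fin T.n} {c c' : Fin T.m} (h : (v, c) ∈ T.edges)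
    (h' : (v', c') ∈ T.edges)
    (he : (Sum.inl v : Fin T.n ⊕ Fin T.m) = Sum.inl v' ∧ T.varPort v c = T.varPort v' c') :
    (v, c) = (v', c') := by
  obtain ⟨h1, h2⟩ := he
  obtain rfl := Sum.inl_injective h1
  have hr : c = c' := rankIn_inj (T.mem_checksOf_iff.mpr (T.mem_edges_iff.mp h))
    (T.mem_checksOf_iff.mpr (T.mem_edges_iff.mp h')) h2
  rw [hr]

lemma edge_eq_of_checkPort_eq {v v' : Fin T.n} {c c' : Fin T.m} (h : (v, c) ∈ T.edges)
    (h' : (v', c') ∈ T.edges)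
    (he : (Sum.inr c : Fin T.n ⊕ Fin T.m) = Sum.inr c' ∧ T.checkPort v c = T.checkPort v' c') :
    (v, c) = (v', c') := by
  obtain ⟨h1, h2⟩ := he
  obtain rfl := Sum.inr_injective h1
  have hr : v = v' := rankIn_inj (T.mem_varsOf_iff.mpr (T.mem_edges_iff.mp h))
    (T.mem_varsOf_iff.mpr (T.mem_edges_iff.mp h')) h2
  rw [hr]

lemma edgeRoute_eq (hD : 4 ≤ D) (hdeg : ∀ z, T.degree z ≤ D) {v : Fin T.n} {c : Fin T.m}
    (h : (v, c) ∈ T.edges) :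
    T.portSrc D (Sum.inl v) (T.varPort v c) :: ((T.edgeRoute D v c).tail.dropLast ++
      [T.portSrc D (Sum.inr c) (T.checkPort v c)]) = T.edgeRoute D v c :=
  route_eq hD (hdeg _) (hdeg _) (varPort_lt h) (checkPort_lt h) (by simp)

/-- The interior of a route meets the wires of the two ports or the track. -/
lemma mem_edgeRoute_interior (hD : 4 ≤ D) (hdeg : ∀ z, T.degree z ≤ D) {v : Fin T.n} {c : Fin T.m}
    (h : (v, c) ∈ T.edges) {p : Cell} (hp : p ∈ (T.edgeRoute D v c).tail.dropLast) :
    (p ≠ T.portSrc D (Sum.inl v) (T.varPort v c) ∧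
        p ≠ T.portSrc D (Sum.inr c) (T.checkPort v c)) ∧
      ((p ∈ T.portWire D (Sum.inl v) (T.varPort v c) (T.edgeRow D v c) ∨
          p ∈ T.portWire D (Sum.inr c) (T.checkPort v c) (T.edgeRow D v c)) ∨
        (p.2 = T.edgeRow D v c ∧
          (T.portCol D (Sum.inl v) (T.varPort v c) ≤ p.1 ∧
              p.1 ≤ T.portCol D (Sum.inr c) (T.checkPort v c) ∨
            T.portCol D (Sum.inr c) (T.checkPort v c) ≤ p.1 ∧
              p.1 ≤ T.portCol D (Sum.inl v) (T.varPort v c)))) := by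
  rw [edgeRoute, mem_route_interior hD (hdeg _) (hdeg _) (varPort_lt h) (checkPort_lt h)
    (lt_edgeRow v c) (by simp), mem_route] at hp
  refine ⟨hp.2, ?_⟩
  rcases hp.1 with h1 | h1 | h1 | h1
  · exact Or.inl (Or.inl h1)
  · right
    rw [Cell.mem_hseg] at h1
    exact ⟨h1.1, by omega⟩
  · exact Or.inl (Or.inr h1)
  · right
    rw [h1]
    exact ⟨rfl, by simp only; omega⟩

lemma not_both_portWires (hD : 4 ≤ D) (hdeg : ∀ z, T.degree z ≤ D) {v v' : Fin T.n}
    {c c' : Fin T.m} (h : (v, c) ∈ T.edges) (h' : (v', c') ∈ T.edges) (hne : (v, c) ≠ (v', c'))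
    {p : Cell}
    (hs : p ≠ T.portSrc D (Sum.inl v) (T.varPort v c) ∧
      p ≠ T.portSrc D (Sum.inr c) (T.checkPort v c))
    (hs' : p ≠ T.portSrc D (Sum.inl v') (T.varPort v' c') ∧
      p ≠ T.portSrc D (Sum.inr c') (T.checkPort v' c'))
    (hp : p ∈ T.portWire D (Sum.inl v) (T.varPort v c) (T.edgeRow D v c) ∨
      p ∈ T.portWire D (Sum.inr c) (T.checkPort v c) (T.edgeRow D v c))
    (hp' : p ∈ T.portWire D (Sum.inl v') (T.varPort v' c') (T.edgeRow D v' c') ∨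
      p ∈ T.portWire D (Sum.inr c') (T.checkPort v' c') (T.edgeRow D v' c')) : False := by
  have hY := lt_edgeRow (D := D) v c
  have hY' := lt_edgeRow (D := D) v' c'
  rcases hp with hp | hp <;> rcases hp' with hp' | hp'
  · obtain ⟨h1, h2⟩ := portWire_unique hD (hdeg _) (hdeg _) (varPort_lt h) (varPort_lt h') hY hY' hp hp'
    exact hne (edge_eq_of_varPort_eq h h' ⟨h1, h2 hs.1 hs'.1⟩)
  · have := (portWire_unique hD (hdeg _) (hdeg _) (varPort_lt h) (checkPort_lt h') hY hY' hp hp').1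
    simp at this
  · have := (portWire_unique hD (hdeg _) (hdeg _) (checkPort_lt h) (varPort_lt h') hY hY' hp hp').1
    simp at this
  · obtain ⟨h1, h2⟩ :=
      portWire_unique hD (hdeg _) (hdeg _) (checkPort_lt h) (checkPort_lt h') hY hY' hp hp'
    exact hne (edge_eq_of_checkPort_eq h h' ⟨h1, h2 hs.2 hs'.2⟩)

lemma portCol_ne (hD : 4 ≤ D) (hdeg : ∀ z, T.degree z ≤ D) {v v' : Fin T.n}
    {c c' : Fin T.m} (h : (v, c) ∈ T.edges) (h' : (v', c') ∈ T.edges) (hne : (v, c) ≠ (v', c'))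
    {x : ℤ} (hx : x = T.portCol D (Sum.inl v) (T.varPort v c) ∨
      x = T.portCol D (Sum.inr c) (T.checkPort v c)) :
    x ≠ T.portCol D (Sum.inl v') (T.varPort v' c') ∧
      x ≠ T.portCol D (Sum.inr c') (T.checkPort v' c') := by
  rcases hx with rfl | rfl <;> refine ⟨fun he => ?_, fun he => ?_⟩
  · exact hne (edge_eq_of_varPort_eq h h'
      (portX_unique hD (hdeg _) (hdeg _) (varPort_lt h) (varPort_lt h') he))
  · have := (portX_unique hD (hdeg _) (hdeg _) (varPort_lt h) (checkPort_lt h') he).1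
    simp at this
  · have := (portX_unique hD (hdeg _) (hdeg _) (checkPort_lt h) (varPort_lt h') he).1
    simp at this
  · exact hne (edge_eq_of_checkPort_eq h h'
      (portX_unique hD (hdeg _) (hdeg _) (checkPort_lt h) (checkPort_lt h') he))

/-- A port wire meeting a foreign track above the nodes does so in its exit column. Exit columns of
different edges differ, so the common cell is strictly between the ends of the track and both wires
pass straight through. -/
lemma edgeRoute_cross (hD : 4 ≤ D) (hdeg : ∀ z, T.degree z ≤ D) {v v' : Fin T.n}
    {c c' : Fin T.m} (h : (v, c) ∈ T.edges) (h' : (v', c') ∈ T.edges) (hne : (v, c) ≠ (v', c'))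
    {p : Cell}
    (hp : p ∈ T.portWire D (Sum.inl v) (T.varPort v c) (T.edgeRow D v c) ∨
      p ∈ T.portWire D (Sum.inr c) (T.checkPort v c) (T.edgeRow D v c))
    (hp' : p.2 = T.edgeRow D v' c' ∧
      (T.portCol D (Sum.inl v') (T.varPort v' c') ≤ p.1 ∧
          p.1 ≤ T.portCol D (Sum.inr c') (T.checkPort v' c') ∨
        T.portCol D (Sum.inr c') (T.checkPort v' c') ≤ p.1 ∧
          p.1 ≤ T.portCol D (Sum.inl v') (T.varPort v' c'))) :
    Cell.StraightV (T.edgeRoute D v c) p ∧ Cell.StraightH (T.edgeRoute D v' c') p := by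
  have hY' := lt_edgeRow (D := D) v' c'
  obtain ⟨h1, h2⟩ := straightV_route hD (hdeg _) (hdeg _) (varPort_lt h) (checkPort_lt h)
    (lt_edgeRow v c) (by omega) hp
  obtain ⟨h3, h4⟩ := portCol_ne hD hdeg h h' hne h2
  exact ⟨h1, straightH_route hp'.1 (by omega)⟩

/-- A layout with all processing nodes in one row and a separate track for each edge. -/
def rowLayout (T : Tanner) (D : ℕ) (hD : 4 ≤ D) (hdeg : ∀ z, T.degree z ≤ D) : T.Layout where
  pos z := (T.nodeX D z, 0)
  pos_contact z := ⟨T.even_nodeX D z, by simp⟩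
  nodes_disjoint z z' hne := disjoint_square_nodeX hD (hdeg z) (hdeg z') hne
  wire v c := (T.edgeRoute D v c).tail.dropLast
  src v c := T.portSrc D (Sum.inl v) (T.varPort v c)
  dst v c := T.portSrc D (Sum.inr c) (T.checkPort v c)
  src_mem v c h := portSrc_mem_square hD (hdeg _) (varPort_lt h)
  dst_mem v c h := portSrc_mem_square hD (hdeg _) (checkPort_lt h)
  wire_ne_nil v c h := List.ne_nil_of_mem (col_mem_route_interior hD (hdeg _) (hdeg _)
    (varPort_lt h) (checkPort_lt h) (lt_edgeRow v c) (by simp))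
  wire_nodup v c h := (nodup_route hD (hdeg _) (hdeg _) (varPort_lt h) (checkPort_lt h)
    (lt_edgeRow v c) (by simp)).sublist
      ((List.dropLast_sublist _).trans (List.tail_sublist _))
  wire_chain v c h := by
    rw [edgeRoute_eq hD hdeg h]
    exact isChain_route (even_edgeRow v c)
  wire_avoids v c h p hp z := by
    obtain ⟨hs, hp⟩ := mem_edgeRoute_interior hD hdeg h hp
    have hY := lt_edgeRow (D := D) v c
    rcases hp with (hp | hp) | hp
    · exact portWire_outside hD (hdeg _) (hdeg _) (varPort_lt h) hY hp hs.1
    · exact portWire_outside hD (hdeg _) (hdeg _) (checkPort_lt h) hY hp hs.2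
    · rw [mem_square_nodeX]
      have := nodeSide_le hD (hdeg z)
      omega
  wire_cross v c v' c' h h' hne p hp hp' := by
    rw [edgeRoute_eq hD hdeg h, edgeRoute_eq hD hdeg h']
    obtain ⟨hs, hp⟩ := mem_edgeRoute_interior hD hdeg h hp
    obtain ⟨hs', hp'⟩ := mem_edgeRoute_interior hD hdeg h' hp'
    -- Two port wires never meet, two tracks lie in different rows, and a port wire crosses a track
    -- orthogonally.
    rcases hp with hp | hp <;> rcases hp' with hp' | hp'
    · exact (not_both_portWires hD hdeg h h' hne hs hs' hp hp').elim
    · exact Or.inr (edgeRoute_cross hD hdeg h h' hne hp hp')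
    · exact Or.inl (edgeRoute_cross hD hdeg h' h hne.symm hp' hp).symm
    · exact absurd (edgeRow_inj (hp.1.symm.trans hp'.1)) hne

lemma portWire_mem_box {z : Fin T.n ⊕ Fin T.m} {i : ℕ} {Y : ℤ} {p : Cell} (hD : 4 ≤ D)
    (hz : T.degree z ≤ D) (hi : i < T.degree z) (hY : D < Y) (hp : p ∈ T.portWire D z i Y) :
    (-2 ≤ p.1 ∧ p.1 ≤ (4 * D + 8) * (T.n + T.m : ℕ)) ∧ -(2 * D) ≤ p.2 ∧ p.2 < Y := by
  have h2 := portWire_snd_lt hD hz hi hY hp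
  rw [mem_portWire hD hz hi hY] at hp
  obtain ⟨h3, h4, h5⟩ := hp.bounds hD hz hi
  have h6 : (0 : ℤ) ≤ (4 * D + 8) * (T.nodeIndex z : ℤ) := by positivity
  have h7 : (4 * (D : ℤ) + 8) * ((T.nodeIndex z : ℤ) + 1) ≤ (4 * D + 8) * (T.n + T.m : ℕ) :=
    mul_le_mul_of_nonneg_left (by have := T.nodeIndex_lt z; omega) (by omega)
  rw [mul_add, mul_one] at h7
  unfold nodeX at h3 h4
  omega

lemma portCol_bounds {z : Fin T.n ⊕ Fin T.m} {i : ℕ} (hD : 4 ≤ D)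
    (hz : T.degree z ≤ D) (hi : i < T.degree z) :
    -2 ≤ T.portCol D z i ∧ T.portCol D z i ≤ (4 * D + 8) * (T.n + T.m : ℕ) := by
  obtain ⟨-, h2, h3, h4, h5, -⟩ := port_bounds hD hz hi
  have h6 : (0 : ℤ) ≤ (4 * D + 8) * (T.nodeIndex z : ℤ) := by positivity
  have h7 : (4 * (D : ℤ) + 8) * ((T.nodeIndex z : ℤ) + 1) ≤ (4 * D + 8) * (T.n + T.m : ℕ) :=
    mul_le_mul_of_nonneg_left (by have := T.nodeIndex_lt z; omega) (by omega)
  rw [mul_add, mul_one] at h7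
  unfold portCol nodeX
  omega

lemma edgeRow_le (v : Fin T.n) (c : Fin T.m) :
    T.edgeRow D v c ≤ 2 * D + 4 + 2 * (T.n * T.m : ℕ) := by
  have h1 : ((v : ℕ) + 1) * T.m ≤ T.n * T.m := Nat.mul_le_mul_right _ v.2
  have h2 : (v : ℕ) * T.m + c ≤ T.n * T.m := by
    rw [add_mul, one_mul] at h1
    have := c.2
    omega
  unfold edgeRow
  omega

/-- All wires lie in a box whose width is linear in the number of nodes and whose height is
determined by the n·m reserved tracks; its cells are simply counted. -/
lemma exists_layout_card_le (hD : 4 ≤ D) (hdeg : ∀ z, T.degree z ≤ D) : ∃ L : T.Layout,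
    (T.edges.biUnion fun a => (L.wire a.1 a.2).toFinset).card ≤
      ((4 * D + 8) * (T.n + T.m) + 3) * (4 * D + 5 + 2 * (T.n * T.m)) := by
  refine ⟨T.rowLayout D hD hdeg, ?_⟩
  have hsub : (T.edges.biUnion fun a => ((T.rowLayout D hD hdeg).wire a.1 a.2).toFinset) ⊆
      Finset.Icc (-2 : ℤ) ((4 * D + 8) * (T.n + T.m : ℕ)) ×ˢ
        Finset.Icc (-(2 * D) : ℤ) (2 * D + 4 + 2 * (T.n * T.m : ℕ)) := by
    intro p hp
    simp only [Finset.mem_biUnion, List.mem_toFinset] at hp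
    obtain ⟨⟨v, c⟩, h, hp⟩ := hp
    obtain ⟨-, hp⟩ := mem_edgeRoute_interior hD hdeg h hp
    have hY := lt_edgeRow (D := D) v c
    have hY' := edgeRow_le (D := D) v c
    rw [Finset.mem_product, Finset.mem_Icc, Finset.mem_Icc]
    rcases hp with (hp | hp) | hp
    · have := portWire_mem_box hD (hdeg _) (varPort_lt h) hY hp
      exact ⟨this.1, this.2.1, by omega⟩
    · have := portWire_mem_box hD (hdeg _) (checkPort_lt h) hY hp
      exact ⟨this.1, this.2.1, by omega⟩
    · have h1 := portCol_bounds hD (hdeg _) (varPort_lt h)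
      have h2 := portCol_bounds hD (hdeg _) (checkPort_lt h)
      exact ⟨⟨by omega, by omega⟩, by omega, by omega⟩
  refine (Finset.card_le_card hsub).trans ?_
  rw [Finset.card_product, Int.card_Icc, Int.card_Icc]
  refine Nat.mul_le_mul ?_ ?_
  · rw [show ((4 * D + 8) * ((T.n + T.m : ℕ) : ℤ) + 1 - -2) =
      (((4 * D + 8) * (T.n + T.m) + 3 : ℕ) : ℤ) by push_cast; ring, Int.toNat_natCast]
  · rw [show (2 * (D : ℤ) + 4 + 2 * ((T.n * T.m : ℕ) : ℤ) + 1 - -(2 * D)) =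
      ((4 * D + 5 + 2 * (T.n * T.m) : ℕ) : ℤ) by push_cast; ring, Int.toNat_natCast]

end Tanner

/-! ### Wire area of regular codes -/

namespace Tanner

variable {T : Tanner} {dv dc : ℕ}

lemma Regular.n_mul_eq (h : T.Regular dv dc) : T.n * dv = T.m * dc := by
  have h1 : ∑ v, (T.checksOf v).card = T.n * dv := by simp [h.2.1]
  have h2 : ∑ c, (T.varsOf c).card = T.m * dc := by simp [h.2.2]
  rw [← h1, ← h2]
  simp only [checksOf, varsOf, Finset.card_filter]
  exact Finset.sum_comm

lemma Regular.m_le_n (h : T.Regular dv dc) (hdv : 0 < dv) (hlt : dv < dc) : T.m ≤ T.n := by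
  have h1 := h.n_mul_eq
  have h2 : T.n * dv ≤ T.n * dc := Nat.mul_le_mul_left _ hlt.le
  rw [h1] at h2
  exact Nat.le_of_mul_le_mul_right h2 (by omega)

lemma Regular.exists_layout (h : T.Regular dv dc) (hdv : 3 ≤ dv) (hlt : dv < dc) (lam : ℝ) :
    ∃ L : T.Layout, L.wireArea lam ≤
      lam ^ 2 * (((8 * dc + 19) * (4 * dc + 7) : ℕ) * (T.n : ℝ) ^ 3) := by
  have hdeg : ∀ z, T.degree z ≤ dc := by
    rintro (v | c)
    · exact (h.2.1 v).le.trans hlt.le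
    · exact (h.2.2 c).le
  obtain ⟨L, hL⟩ := exists_layout_card_le (by omega) hdeg
  refine ⟨L, ?_⟩
  rw [Layout.wireArea]
  refine mul_le_mul_of_nonneg_left ?_ (sq_nonneg _)
  have hm := h.m_le_n (by omega) hlt
  have hn := h.1
  have h1 : (4 * dc + 8) * (T.n + T.m) + 3 ≤ (8 * dc + 19) * T.n := by nlinarith
  have h2 : 4 * dc + 5 + 2 * (T.n * T.m) ≤ (4 * dc + 7) * T.n ^ 2 := by
    have h3 : T.n * T.m ≤ T.n ^ 2 := by rw [sq]; exact Nat.mul_le_mul_left _ hm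
    have h4 : 1 ≤ T.n ^ 2 := Nat.one_le_pow _ _ hn
    nlinarith
  have h5 := hL.trans (Nat.mul_le_mul h1 h2)
  calc _ ≤ (((8 * dc + 19) * T.n * ((4 * dc + 7) * T.n ^ 2) : ℕ) : ℝ) := by exact_mod_cast h5
    _ = _ := by push_cast; ring

/-- Each variable node selects the first cell of one of its wires. A cell has four neighbours, and
the attachment cells lie in disjoint squares, so at most four nodes select the same cell. -/
lemma Regular.n_le_card_wires (h : T.Regular dv dc) (hdv : 0 < dv) (L : T.Layout) :
    T.n ≤ 4 * (T.edges.biUnion fun a => (L.wire a.1 a.2).toFinset).card := by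
  have hex : ∀ v : Fin T.n, ∃ (c : Fin T.m) (p : Cell), (v, c) ∈ T.edges ∧ p ∈ L.wire v c ∧
      Cell.Step (L.src v c) p := by
    intro v
    obtain ⟨c, hc⟩ := Finset.card_pos.mp ((h.2.1 v).symm ▸ hdv)
    have he : (v, c) ∈ T.edges := T.mem_edges_iff.mpr (T.mem_checksOf_iff.mp hc)
    have hch := L.wire_chain v c he
    obtain ⟨p, l, hl⟩ := List.exists_cons_of_ne_nil (L.wire_ne_nil v c he)
    rw [hl, List.cons_append, List.isChain_cons_cons] at hch
    exact ⟨c, p, he, by simp [hl], hch.1⟩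
  choose c p he hp hstep using hex
  have hinj : Function.Injective fun v => L.src v (c v) := by
    intro v v' hvv
    by_contra hne
    refine Set.disjoint_left.mp (L.nodes_disjoint (Sum.inl v) (Sum.inl v') (by simpa using hne))
      (L.src_mem v (c v) (he v)) ?_
    have : L.src v (c v) = L.src v' (c v') := hvv
    rw [this]
    exact L.src_mem v' (c v') (he v')
  have := Finset.card_le_mul_card_image_of_maps_to (s := (Finset.univ : Finset (Fin T.n))) (f := p)
    (t := T.edges.biUnion fun a => (L.wire a.1 a.2).toFinset) ?_ 4 ?_
  · simpa using this
  · intro v _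
    simp only [Finset.mem_biUnion, List.mem_toFinset]
    exact ⟨(v, c v), he v, hp v⟩
  · intro q _
    refine le_trans (Finset.card_le_card_of_injOn (fun v => L.src v (c v))
      (t := {(q.1, q.2 + 1), (q.1, q.2 - 1), (q.1 + 1, q.2), (q.1 - 1, q.2)}) ?_
      hinj.injOn) Finset.card_le_four
    intro v hv
    have hv : p v = q := by simpa using hv
    have hs := hstep v
    rw [hv] at hs
    simp only
    generalize L.src v (c v) = r at hs ⊢
    simp only [Finset.coe_insert, Finset.coe_singleton, Set.mem_insert_iff, Set.mem_singleton_iff,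
      Prod.ext_iff]
    rcases hs with ⟨-, h1, h2⟩ | ⟨-, h1, h2⟩ <;> omega

lemma Layout.wireArea_nonneg (L : T.Layout) (lam : ℝ) : 0 ≤ L.wireArea lam := by
  unfold Layout.wireArea; positivity

lemma Regular.le_wireArea (h : T.Regular dv dc) (hdv : 0 < dv) (L : T.Layout) (lam : ℝ) :
    lam ^ 2 * (T.n / 4) ≤ L.wireArea lam := by
  rw [Layout.wireArea]
  refine mul_le_mul_of_nonneg_left ?_ (sq_nonneg _)
  have : (T.n : ℝ) ≤ 4 * ((T.edges.biUnion fun a => (L.wire a.1 a.2).toFinset).card : ℝ) := by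
    exact_mod_cast h.n_le_card_wires hdv L
  linarith

end Tanner

/-! ### Lower bounds on the total power -/

section LowerBounds

variable {dv dc : ℕ} {lam ξ η Pe PT P : ℝ}

lemma exp_log_mul_nat {a : ℝ} (ha : 0 < a) (k : ℕ) : Real.exp (Real.log a * k) = a ^ k := by
  rw [mul_comm, Real.exp_nat_mul, Real.exp_log ha]

lemma exists_of_mem_totalPowersAt (hdv : 3 ≤ dv) (hlt : dv < dc) (hξ : 0 < ξ) (hη : 0 < η)
    (hPT : 0 ≤ PT) (hP : P ∈ totalPowersAt (regularCodes dv dc) lam ξ η Pe PT) :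
    ∃ ℓ : ℕ, flipProb η PT ^ (ℓ + 1) ≤ Pe ∧
      PT + ξ * lam ^ 2 / 4 * Real.exp (Real.log (((dv : ℝ) - 1) * ((dc : ℝ) - 1)) * ℓ) ≤ P := by
  obtain ⟨T, hT, ℓ, hℓ, L, herr, rfl⟩ := hP
  have hT : T.Regular dv dc := hT
  rw [hT.bitErrorProb_eq (by omega) _ hℓ] at herr
  refine ⟨ℓ, ((densityEvolution_mem (flipProb_pos hη hPT).le (flipProb_le_half hη hPT)
    (by omega) (by omega) ℓ).1).trans herr, ?_⟩
  have hn := hT.pow_le_n (by omega) (Tanner.cyclesLongerThan_of_le_maxIter hℓ)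
  have hn' : (((dv : ℝ) - 1) * ((dc : ℝ) - 1)) ^ ℓ ≤ T.n := by
    have : ((((dv - 1) * (dc - 1)) ^ ℓ : ℕ) : ℝ) ≤ T.n := by exact_mod_cast hn
    rwa [Nat.cast_pow, Nat.cast_mul, Nat.cast_sub (by omega), Nat.cast_sub (by omega),
      Nat.cast_one] at this
  have h3 : (3 : ℝ) ≤ dv := by exact_mod_cast hdv
  have h4 : (3 : ℝ) ≤ dc := by exact_mod_cast (by omega : 3 ≤ dc)
  rw [exp_log_mul_nat (mul_pos (by linarith) (by linarith))]
  have harea := mul_le_mul_of_nonneg_left (hT.le_wireArea (by omega) L lam) hξ.le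
  have h5 := mul_le_mul_of_nonneg_left hn' (by positivity : 0 ≤ ξ * lam ^ 2 / 4)
  linarith

lemma tendsto_log_one_div : Tendsto (fun Pe : ℝ => Real.log (1 / Pe)) (𝓝[>] 0) atTop := by
  simp only [one_div]
  exact Real.tendsto_log_atTop.comp tendsto_inv_nhdsGT_zero

lemma log_branching_pos (hdv : 3 ≤ dv) (hlt : dv < dc) :
    0 < Real.log (((dv : ℝ) - 1) * ((dc : ℝ) - 1)) := by
  have h3 : (3 : ℝ) ≤ dv := by exact_mod_cast hdv
  have h4 : (3 : ℝ) ≤ dc := by exact_mod_cast (by omega : 3 ≤ dc)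
  exact Real.log_pos (by nlinarith)

lemma log_one_div_le_mul {p : ℝ} {k : ℕ} (hp : 0 < p) (h : p ^ k ≤ Pe) :
    Real.log (1 / Pe) ≤ k * Real.log (1 / p) := by
  have := Real.log_le_log (pow_pos hp k) h
  rw [Real.log_pow] at this
  rw [one_div, one_div, Real.log_inv, Real.log_inv]
  linarith

/-- Either the area term is at least log(1/Pe), which dominates the scale, or it is smaller and
limits ℓ to about log log(1/Pe)/β, so that the transmit power must supply the error exponent. -/
lemma eventually_le_of_mem_totalPowersAt (hdv : 3 ≤ dv) (hlt : dv < dc) (hlam : 0 < lam)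
    (hξ : 0 < ξ) (hη : 0 < η) :
    ∀ᶠ Pe in 𝓝[>] (0 : ℝ), ∀ PT, 0 ≤ PT → ∀ P ∈ totalPowersAt (regularCodes dv dc) lam ξ η Pe PT,
      1 / 8 * powerScale (Real.log (((dv : ℝ) - 1) * ((dc : ℝ) - 1))) η Pe ≤ P := by
  have hβ := log_branching_pos hdv hlt
  generalize hβdef : Real.log (((dv : ℝ) - 1) * ((dc : ℝ) - 1)) = β at hβ ⊢
  set s : ℝ := ξ * lam ^ 2 / 4 with hs
  have hs0 : 0 < s := by positivity
  -- The factor β/8 absorbs the additive 2 in the exponent of the flip probability: 4y ≤ βx/2 leaves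
  -- βx/2 ≤ 4y · ηP_T, which is the constant 1/8.
  have hlogo : ∀ᶠ x : ℝ in atTop, Real.log x ≤ β / 8 * x := by
    have := Real.isLittleO_log_id_atTop.bound (by positivity : 0 < β / 8)
    filter_upwards [this, eventually_ge_atTop 1] with x hx hx1
    simpa [abs_of_nonneg (Real.log_nonneg hx1), abs_of_nonneg (zero_le_one.trans hx1)] using hx
  filter_upwards [tendsto_log_one_div.eventually hlogo,
    tendsto_log_one_div.eventually (eventually_gt_atTop 0),
    (Real.tendsto_log_atTop.comp tendsto_log_one_div).eventually (eventually_gt_atTop 0),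
    (Real.tendsto_log_atTop.comp tendsto_log_one_div).eventually
      (eventually_ge_atTop (β / (8 * η))),
    (Real.tendsto_log_atTop.comp tendsto_log_one_div).eventually
      (eventually_ge_atTop (β - Real.log s))] with Pe h1 h2 h3 h4 h5 PT hPT P hP
  simp only [Function.comp_apply] at h3 h4 h5
  obtain ⟨ℓ, hℓ, hle⟩ := exists_of_mem_totalPowersAt hdv hlt hξ hη hPT hP
  rw [hβdef, ← hs] at hle
  have hlog := log_one_div_le_mul (flipProb_pos hη hPT) hℓ
  rw [powerScale]
  generalize Real.log (1 / Pe) = x at *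
  have hflip : Real.log (1 / flipProb η PT) ≤ 2 * (η * PT) + 2 := by
    rw [one_div, Real.log_inv]
    have := (Real.le_log_iff_exp_le (flipProb_pos hη hPT)).mpr (le_flipProb hη hPT)
    linarith
  have hx : x ≤ (ℓ + 1) * (2 * (η * PT) + 2) := by
    refine hlog.trans ?_
    push_cast
    gcongr
  have hexp0 := Real.exp_pos (β * ℓ)
  generalize hy : Real.log x = y at *
  rcases le_or_gt x (s * Real.exp (β * ℓ)) with hc | hc
  · have : 1 / 8 * (β / η * x / y) ≤ x := by
      rw [show 1 / 8 * (β / η * x / y) = (β / (8 * η)) * x / y by field_simp, div_le_iff₀ h3]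
      nlinarith
    linarith
  · have h6 : β * ℓ ≤ y - Real.log s := by
      rw [← hy, ← Real.log_div h2.ne' hs0.ne', Real.le_log_iff_exp_le (by positivity),
        le_div_iff₀ hs0]
      linarith
    have h7 : β * (ℓ + 1) ≤ 2 * y := by linarith
    have hPTη : 0 ≤ η * PT := by positivity
    have h8 : β * x ≤ 2 * y * (2 * (η * PT) + 2) := by
      calc β * x ≤ β * ((ℓ + 1) * (2 * (η * PT) + 2)) := by gcongr
        _ = β * (ℓ + 1) * (2 * (η * PT) + 2) := by ring
        _ ≤ _ := by gcongr
    have h9 : 1 / 8 * (β / η * x / y) ≤ PT := by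
      rw [show 1 / 8 * (β / η * x / y) = (β * x / 8) / (η * y) by field_simp,
        div_le_iff₀ (by positivity)]
      nlinarith
    have h10 : 0 < s * Real.exp (β * ℓ) := by positivity
    linarith

lemma totalPower_nonneg {𝒞 : Set Tanner} (hξ : 0 < ξ) (hPT : 0 ≤ PT)
    (hP : P ∈ totalPowersAt 𝒞 lam ξ η Pe PT) : 0 ≤ P := by
  obtain ⟨T, -, ℓ, -, L, -, rfl⟩ := hP
  have := L.wireArea_nonneg lam
  positivity

lemma totalPowerMin_le {𝒞 : Set Tanner} (hξ : 0 < ξ) (hPT : 0 ≤ PT)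
    (hP : P ∈ totalPowersAt 𝒞 lam ξ η Pe PT) : totalPowerMin 𝒞 lam ξ η Pe ≤ P :=
  csInf_le ⟨0, fun _ ⟨_, h, h'⟩ => totalPower_nonneg hξ h h'⟩ ⟨PT, hPT, hP⟩

lemma totalPowersAt_mono {𝒞 𝒞' : Set Tanner} (h : 𝒞 ⊆ 𝒞') :
    totalPowersAt 𝒞 lam ξ η Pe PT ⊆ totalPowersAt 𝒞' lam ξ η Pe PT :=
  fun _ ⟨T, hT, h'⟩ => ⟨T, h hT, h'⟩

/-- At fixed flip probability p, reaching Pe forces ℓ + 1 ≥ log(1/Pe)/log(1/p), and the area grows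
like e^(βℓ). -/
lemma fixedPower_lower_bound (hdv : 3 ≤ dv) (hlt : dv < dc) (hlam : 0 < lam)
    (hξ : 0 < ξ) (hη : 0 < η) (hPT : 0 ≤ PT) :
    ∃ a k : ℝ, 0 < a ∧ 0 < k ∧ ∀ᶠ Pe in 𝓝[>] (0 : ℝ),
      ∀ P ∈ totalPowersAt (regularCodes dv dc) lam ξ η Pe PT, k * (1 / Pe) ^ a ≤ P := by
  have hβ := log_branching_pos hdv hlt
  have hp0 := flipProb_pos hη hPT
  have hp : 0 < Real.log (1 / flipProb η PT) := Real.log_pos (by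
    rw [lt_div_iff₀ hp0]; linarith [flipProb_le_half hη hPT])
  refine ⟨Real.log (((dv : ℝ) - 1) * ((dc : ℝ) - 1)) / Real.log (1 / flipProb η PT),
    ξ * lam ^ 2 / 4 * Real.exp (-Real.log (((dv : ℝ) - 1) * ((dc : ℝ) - 1))), by positivity,
    by positivity, ?_⟩
  filter_upwards [self_mem_nhdsWithin] with Pe hPe P hP
  have hPe : 0 < Pe := hPe
  obtain ⟨ℓ, hℓ, hle⟩ := exists_of_mem_totalPowersAt hdv hlt hξ hη hPT hP
  generalize Real.log (((dv : ℝ) - 1) * ((dc : ℝ) - 1)) = β at *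
  have hlog := log_one_div_le_mul hp0 hℓ
  generalize Real.log (1 / flipProb η PT) = b at *
  have h1 : β / b * Real.log (1 / Pe) ≤ β * (ℓ + 1) := by
    rw [div_mul_eq_mul_div, div_le_iff₀ hp]
    push_cast at hlog
    calc β * Real.log (1 / Pe) ≤ β * ((ℓ + 1) * b) := by gcongr
      _ = _ := by ring
  refine le_trans ?_ (le_trans (le_add_of_nonneg_left hPT) hle)
  rw [mul_assoc, Real.rpow_def_of_pos (by positivity), ← Real.exp_add]
  gcongr
  linarith

lemma fixedPower_exp_lower_bound (hdv : 3 ≤ dv) (hlt : dv < dc) (hlam : 0 < lam)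
    (hξ : 0 < ξ) (hη : 0 < η) (hPT : 0 ≤ PT) :
    ∃ b : ℝ, 0 < b ∧ ∀ᶠ Pe in 𝓝[>] (0 : ℝ),
      ∀ P ∈ totalPowersAt (regularCodes dv dc) lam ξ η Pe PT,
        Real.exp (b * uncodedPower η Pe) ≤ P := by
  obtain ⟨a, k, ha, hk, h⟩ := fixedPower_lower_bound hdv hlt hlam hξ hη hPT
  -- Since uncoded power is at most log(1/Pe)/η, the value aη would match the polynomial bound; half
  -- of it leaves room for the constant `k`.
  refine ⟨a * η / 2, by positivity, ?_⟩
  filter_upwards [h, Ioo_mem_nhdsGT (zero_lt_one' ℝ),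
    tendsto_log_one_div.eventually (eventually_ge_atTop (-Real.log k * (2 / a)))]
    with Pe h1 h2 h3 P hP
  refine le_trans ?_ (h1 P hP)
  have h4 := uncodedPower_le hη h2.1 h2.2
  have h5 : 0 < 1 / Pe := one_div_pos.mpr h2.1
  rw [Real.rpow_def_of_pos h5, ← Real.exp_log hk, ← Real.exp_add, Real.exp_le_exp]
  have h6 : a * η / 2 * uncodedPower η Pe ≤ a / 2 * Real.log (1 / Pe) := by
    calc _ ≤ a * η / 2 * (Real.log (1 / Pe) / η) := by gcongr
      _ = _ := by field_simp
  have h7 : -Real.log k ≤ a / 2 * Real.log (1 / Pe) := by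
    calc -Real.log k = a / 2 * (-Real.log k * (2 / a)) := by field_simp
      _ ≤ _ := by gcongr
  linarith

end LowerBounds

/-! ### Upper bounds on the total power -/

section UpperBounds

variable {dv dc : ℕ} {lam ξ η : ℝ}

/-- The parameter `u` is the error exponent gained per iteration: the assumed power makes Mp ≤
e^(-u). -/
lemma bitErrorProb_le_exp {T : Tanner} (hT : T.Regular dv dc) (hdv : 3 ≤ dv) (hlt : dv < dc)
    (hη : 0 < η) {N : ℕ} (hN : N ≤ T.maxIter) {u : ℝ} (hu : 0 ≤ u) {PT : ℝ}
    (hPT : (u + Real.log (2 * ((dv : ℝ) * dc) ^ 2)) / η ≤ PT) :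
    0 ≤ PT ∧ T.bitErrorProb (flipProb η PT) N ≤ Real.exp (-(u * (N + 1))) := by
  have h3 : (3 : ℝ) ≤ dv := by exact_mod_cast hdv
  have h4 : (3 : ℝ) ≤ dc := by exact_mod_cast (by omega : 3 ≤ dc)
  have h5 : (1 : ℝ) ≤ dv * dc := by nlinarith
  have hM : (1 : ℝ) ≤ 2 * ((dv : ℝ) * dc) ^ 2 := by nlinarith [one_le_pow₀ h5 (n := 2)]
  rw [hT.bitErrorProb_eq (by omega) _ hN]
  have hle := densityEvolution_le (p := flipProb η PT) (dv := dv) (dc := dc)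
  generalize 2 * ((dv : ℝ) * dc) ^ 2 = M at *
  have hlog := Real.log_nonneg hM
  have hPT0 : 0 ≤ PT := le_trans (by positivity) hPT
  rw [div_le_iff₀ hη] at hPT
  have hp : M * flipProb η PT ≤ Real.exp (-u) := by
    have h6 := flipProb_le hη hPT0
    have h7 : Real.exp (-(η * PT)) ≤ Real.exp (-u) / M := by
      rw [le_div_iff₀ (by linarith), ← Real.exp_log (by linarith : 0 < M), ← Real.exp_add,
        Real.exp_le_exp]
      linarith
    have h8 := Real.exp_pos (-(η * PT))
    rw [le_div_iff₀ (by linarith)] at h7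
    nlinarith
  refine ⟨hPT0, (hle (flipProb_pos hη hPT0).le hdv (by omega)
    (hp.trans (Real.exp_le_one_iff.mpr (by linarith))) N).trans ?_⟩
  calc (M * flipProb η PT) ^ (N + 1) ≤ Real.exp (-u) ^ (N + 1) := by
        have := (flipProb_pos hη hPT0).le
        gcongr
    _ = _ := by
        rw [← Real.exp_nat_mul]
        congr 1
        push_cast
        ring

lemma exists_mem_totalPowersAt_le {γ : ℝ} {C : ℕ → Tanner} (hdv : 3 ≤ dv) (hlt : dv < dc)
    (hlam : 0 < lam) (hξ : 0 < ξ) (hη : 0 < η) (hγ : 0 < γ) (hC : IsConstruction dv dc γ C) :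
    ∀ᶠ Pe in 𝓝[>] (0 : ℝ), ∃ PT, 0 ≤ PT ∧ ∃ P ∈ totalPowersAt (Set.range C) lam ξ η Pe PT,
      P ≤ 7 * powerScale γ η Pe := by
  obtain ⟨hreg, a, A, ha, hA⟩ := hC
  have hA0 : 0 < A := by
    have := (hA 0).1.trans (hA 0).2
    simp at this
    linarith
  set M : ℝ := 2 * ((dv : ℝ) * dc) ^ 2 with hM
  set K : ℝ := ξ * (lam ^ 2 * (((8 * dc + 19) * (4 * dc + 7) : ℕ) * A ^ 3)) with hK
  have hK0 : 0 < K := by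
    have : (0 : ℝ) < (((8 * dc + 19) * (4 * dc + 7) : ℕ) : ℝ) := by positivity
    positivity
  set B : ℝ := |Real.log M / η| + K with hB
  have hB0 : 0 < B := by positivity
  have htend := Real.tendsto_log_atTop.comp tendsto_log_one_div
  have hexp : Tendsto (fun y : ℝ => Real.exp (y / 4)) atTop atTop :=
    Real.tendsto_exp_atTop.comp (tendsto_id.atTop_div_const (by norm_num))
  filter_upwards [htend.eventually (eventually_gt_atTop 0),
    tendsto_log_one_div.eventually (eventually_gt_atTop 0),
    (hexp.comp htend).eventually (eventually_ge_atTop (4 * B * η / γ)),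
    self_mem_nhdsWithin] with Pe h1 h2 h3 h4
  simp only [Function.comp_apply] at h1 h3
  have hPe : 0 < Pe := h4
  have hPe' : Pe = Real.exp (-Real.log (1 / Pe)) := by
    rw [one_div, Real.log_inv, neg_neg, Real.exp_log hPe]
  rw [powerScale]
  generalize Real.log (1 / Pe) = x at *
  have hx : x = Real.exp (Real.log x) := (Real.exp_log h2).symm
  generalize Real.log x = y at *
  -- The area is of order n³, hence e^(3γN) ≤ e^(y/2), the square root of log(1/Pe). The main part
  -- of the transmit power is then at most 6 times the scale.
  set N := ⌊y / (6 * γ)⌋₊ with hN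
  have hN1 : (N : ℝ) ≤ y / (6 * γ) := Nat.floor_le (by positivity)
  have hN2 : y / (6 * γ) < N + 1 := Nat.lt_floor_add_one _
  obtain ⟨hT, hmax⟩ := hreg N
  obtain ⟨L, hL⟩ := hT.exists_layout hdv hlt lam
  obtain ⟨hPT, herr⟩ := bitErrorProb_le_exp hT hdv hlt hη hmax (u := x / (N + 1))
    (by positivity) le_rfl
  refine ⟨_, hPT, _, ⟨C N, ⟨N, rfl⟩, N, hmax, L, ?_, rfl⟩, ?_⟩
  · rw [div_mul_cancel₀ _ (by positivity : (N : ℝ) + 1 ≠ 0)] at herr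
    rwa [hPe']
  · have hP1 : x / (N + 1) / η ≤ 6 * (γ / η * x / y) := by
      rw [show 6 * (γ / η * x / y) = x / (y / (6 * γ)) / η by field_simp]
      gcongr
    have harea : ξ * L.wireArea lam ≤ K * Real.exp (y / 2) := by
      calc ξ * L.wireArea lam
          ≤ ξ * (lam ^ 2 * (((8 * dc + 19) * (4 * dc + 7) : ℕ) * ((C N).n : ℝ) ^ 3)) := by gcongr
        _ ≤ ξ * (lam ^ 2 * (((8 * dc + 19) * (4 * dc + 7) : ℕ) *
              (A * Real.exp (γ * N)) ^ 3)) := by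
            gcongr
            exact (hA N).2
        _ = K * Real.exp (3 * (γ * N)) := by
            rw [hK, mul_pow, ← Real.exp_nat_mul]
            push_cast
            ring
        _ ≤ _ := by
            gcongr
            rw [le_div_iff₀ (by positivity)] at hN1
            linarith
    -- The offset of the transmit power and the area together cost at most one more unit of the
    -- scale, giving 7. The spare factor e^(y/2) = e^(y/4) e^(y/4) pays for y and for the constant
    -- B.
    have hsmall : Real.log M / η + K * Real.exp (y / 2) ≤ γ / η * x / y := by
      have h5 : Real.log M / η + K * Real.exp (y / 2) ≤ B * Real.exp (y / 2) := by
        have h6 : 1 ≤ Real.exp (y / 2) := Real.one_le_exp (by positivity)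
        have h7 := le_abs_self (Real.log M / η)
        have h8 := abs_nonneg (Real.log M / η)
        rw [hB]
        nlinarith
      refine h5.trans ?_
      rw [le_div_iff₀ h1]
      have h6 : y ≤ 4 * Real.exp (y / 4) := by linarith [Real.add_one_le_exp (y / 4)]
      have h7 : x = Real.exp (y / 2) * (Real.exp (y / 4) * Real.exp (y / 4)) := by
        rw [hx, ← Real.exp_add, ← Real.exp_add]
        congr 1
        ring
      have h8 : 4 * B ≤ γ / η * Real.exp (y / 4) := by
        rw [div_le_iff₀ hγ] at h3
        rw [div_mul_eq_mul_div, le_div_iff₀ hη]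
        linarith
      have h9 := Real.exp_pos (y / 4)
      have h10 := Real.exp_pos (y / 2)
      calc B * Real.exp (y / 2) * y ≤ B * Real.exp (y / 2) * (4 * Real.exp (y / 4)) := by gcongr
        _ = (4 * B) * (Real.exp (y / 2) * Real.exp (y / 4)) := by ring
        _ ≤ (γ / η * Real.exp (y / 4)) * (Real.exp (y / 2) * Real.exp (y / 4)) := by gcongr
        _ = γ / η * x := by rw [h7]; ring
    rw [add_div]
    linarith

/-- With exponent 1 per iteration the threshold does not depend on Pe, and about log(1/Pe)
iterations suffice. -/
lemma exists_fixedPower_reaches_all (hdv : 3 ≤ dv) (hlt : dv < dc) (hη : 0 < η) (lam ξ : ℝ) :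
    ∃ Δ : ℝ, ∀ PT, Δ ≤ PT → ∀ Pe : ℝ, 0 < Pe →
      (totalPowersAt (regularCodes dv dc) lam ξ η Pe PT).Nonempty := by
  obtain ⟨C, hreg, -⟩ := exists_isConstruction hdv (by omega : 3 ≤ dc)
  refine ⟨(1 + Real.log (2 * ((dv : ℝ) * dc) ^ 2)) / η, fun PT hPT Pe hPe => ?_⟩
  obtain ⟨N, hN⟩ := exists_nat_ge (-Real.log Pe)
  obtain ⟨hT, hmax⟩ := hreg N
  obtain ⟨L, -⟩ := hT.exists_layout hdv hlt lam
  refine ⟨_, C N, hT, N, hmax, L, ?_, rfl⟩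
  refine (bitErrorProb_le_exp hT hdv hlt hη hmax zero_le_one hPT).2.trans ?_
  rw [← Real.le_log_iff_exp_le hPe]
  linarith

end UpperBounds

/-! ### The main theorem -/

section Main

variable {dv dc : ℕ}

/-- With a = (dv - 1)(dc - 1) ≥ 6 one has dv dc ≤ 2a, hence 2 dv dc + 1 ≤ 4a + 1 ≤ a³. -/
lemma gammaRange_upper_le (hdv : 3 ≤ dv) (hlt : dv < dc) :
    3 * Real.log (2 * (dv : ℝ) * (dc : ℝ) + 1) ≤
      9 * Real.log (((dv : ℝ) - 1) * ((dc : ℝ) - 1)) := by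
  have h3 : (3 : ℝ) ≤ dv := by exact_mod_cast hdv
  have h4 : (4 : ℝ) ≤ dc := by exact_mod_cast (by omega : 4 ≤ dc)
  have h5 : (6 : ℝ) ≤ ((dv : ℝ) - 1) * ((dc : ℝ) - 1) := by nlinarith
  have h6 : (dv : ℝ) * dc ≤ 2 * (((dv : ℝ) - 1) * ((dc : ℝ) - 1)) := by nlinarith
  have h7 : 2 * (dv : ℝ) * dc + 1 ≤ (((dv : ℝ) - 1) * ((dc : ℝ) - 1)) ^ 3 := by
    generalize ((dv : ℝ) - 1) * ((dc : ℝ) - 1) = a at *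
    have h8 : 36 ≤ a ^ 2 := by nlinarith
    have h9 : a ^ 3 = a ^ 2 * a := by ring
    nlinarith
  have h8 := Real.log_le_log (by positivity) h7
  rw [Real.log_pow] at h8
  push_cast at h8
  linarith

lemma log_branching_le_upper (hdv : 3 ≤ dv) (hlt : dv < dc) :
    Real.log (((dv : ℝ) - 1) * ((dc : ℝ) - 1)) ≤ 3 * Real.log (2 * (dv : ℝ) * (dc : ℝ) + 1) := by
  have h3 : (3 : ℝ) ≤ dv := by exact_mod_cast hdv
  have h4 : (4 : ℝ) ≤ dc := by exact_mod_cast (by omega : 4 ≤ dc)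
  have h5 : Real.log (((dv : ℝ) - 1) * ((dc : ℝ) - 1)) ≤ Real.log (2 * (dv : ℝ) * (dc : ℝ) + 1) :=
    Real.log_le_log (by nlinarith) (by nlinarith)
  have h6 := log_branching_pos hdv hlt
  linarith

lemma powerScale_eq (γ η Pe : ℝ) : powerScale γ η Pe = γ * powerScale 1 η Pe := by
  unfold powerScale; ring

lemma eventually_powerScale_pos {η : ℝ} (hη : 0 < η) :
    ∀ᶠ Pe in 𝓝[>] (0 : ℝ), 0 < powerScale 1 η Pe := by
  filter_upwards [tendsto_log_one_div.eventually (eventually_gt_atTop 0),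
    (Real.tendsto_log_atTop.comp tendsto_log_one_div).eventually (eventually_gt_atTop 0)]
    with Pe h1 h2
  simp only [Function.comp_apply] at h2
  unfold powerScale
  positivity

/-- Bounds on the optimal total power for a class of regular codes that contains a construction. -/
lemma totalPowerMin_bounds {γ lam ξ η : ℝ} {C : ℕ → Tanner} {𝒞 : Set Tanner} (hdv : 3 ≤ dv)
    (hlt : dv < dc) (hlam : 0 < lam) (hξ : 0 < ξ) (hη : 0 < η) (hγ : 0 < γ)
    (hC : IsConstruction dv dc γ C) (hC𝒞 : Set.range C ⊆ 𝒞) (h𝒞 : 𝒞 ⊆ regularCodes dv dc) :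
    ∀ᶠ Pe in 𝓝[>] (0 : ℝ),
      1 / 8 * powerScale (Real.log (((dv : ℝ) - 1) * ((dc : ℝ) - 1))) η Pe ≤
        totalPowerMin 𝒞 lam ξ η Pe ∧
      totalPowerMin 𝒞 lam ξ η Pe ≤ 7 * powerScale γ η Pe := by
  filter_upwards [eventually_le_of_mem_totalPowersAt hdv hlt hlam hξ hη,
    exists_mem_totalPowersAt_le hdv hlt hlam hξ hη hγ hC] with Pe hlow ⟨PT, hPT, P, hP, hle⟩
  have hP' := totalPowersAt_mono hC𝒞 hP
  refine ⟨le_csInf ⟨P, PT, hPT, hP'⟩ ?_, (totalPowerMin_le hξ hPT hP').trans hle⟩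
  rintro Q ⟨PT', hPT', hQ⟩
  exact hlow PT' hPT' Q (totalPowersAt_mono h𝒞 hQ)

end Main

theorem mainTheorem3 :
    -- absolute constants of the order-of-growth claims
    ∃ c₁ c₂ : ℝ, 0 < c₁ ∧ c₁ ≤ c₂ ∧ ∀ dv dc : ℕ, 3 ≤ dv → dv < dc →
      -- there are code constructions with a growth rate in the stated range
      (∃ γ ∈ gammaRange dv dc, ∃ C, IsConstruction dv dc γ C) ∧
      -- optimal total power over all regular codes
      (∀ lam ξ η : ℝ, 0 < lam → 0 < ξ → 0 < η → ∀ γ ∈ gammaRange dv dc,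
        ∀ᶠ Pe in 𝓝[>] (0 : ℝ),
          c₁ * powerScale γ η Pe ≤ totalPowerMin (regularCodes dv dc) lam ξ η Pe ∧
          totalPowerMin (regularCodes dv dc) lam ξ η Pe ≤ c₂ * powerScale γ η Pe) ∧
      -- optimal total power for a code construction with growth rate `γ`
      (∀ lam ξ η : ℝ, 0 < lam → 0 < ξ → 0 < η → ∀ γ ∈ gammaRange dv dc,
        ∀ C, IsConstruction dv dc γ C → ∀ᶠ Pe in 𝓝[>] (0 : ℝ),
          c₁ * powerScale γ η Pe ≤ totalPowerMin (Set.range C) lam ξ η Pe ∧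
          totalPowerMin (Set.range C) lam ξ η Pe ≤ c₂ * powerScale γ η Pe) ∧
      -- uncoded transmission needs more power by a factor of order `log log (1 / Pe)`
      (∃ k₁ k₂ : ℝ, 0 < k₁ ∧ k₁ ≤ k₂ ∧ ∀ lam ξ η : ℝ, 0 < lam → 0 < ξ → 0 < η →
        ∀ᶠ Pe in 𝓝[>] (0 : ℝ),
          k₁ * Real.log (Real.log (1 / Pe)) * totalPowerMin (regularCodes dv dc) lam ξ η Pe
              ≤ uncodedPower η Pe ∧
          uncodedPower η Pe
              ≤ k₂ * Real.log (Real.log (1 / Pe)) *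
                totalPowerMin (regularCodes dv dc) lam ξ η Pe) ∧
      -- fixed transmit power: polynomial growth in `1 / Pe`, exponential in the uncoded power
      (∀ lam ξ η PT : ℝ, 0 < lam → 0 < ξ → 0 < η → 0 ≤ PT →
        (∃ a k : ℝ, 0 < a ∧ 0 < k ∧ ∀ᶠ Pe in 𝓝[>] (0 : ℝ),
          ∀ P ∈ totalPowersAt (regularCodes dv dc) lam ξ η Pe PT, k * (1 / Pe) ^ a ≤ P) ∧
        (∃ b : ℝ, 0 < b ∧ ∀ᶠ Pe in 𝓝[>] (0 : ℝ),
          ∀ P ∈ totalPowersAt (regularCodes dv dc) lam ξ η Pe PT,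
            Real.exp (b * uncodedPower η Pe) ≤ P)) ∧
      -- every sufficiently large fixed transmit power reaches every bit-error probability
      (∀ lam ξ η : ℝ, 0 < lam → 0 < ξ → 0 < η → ∃ Δ : ℝ, ∀ PT, Δ ≤ PT → ∀ Pe : ℝ, 0 < Pe →
        (totalPowersAt (regularCodes dv dc) lam ξ η Pe PT).Nonempty) := by
  -- These are (1/8)/9 and 7 · 9, where 9 bounds the ratio of the endpoints of the range.
  refine ⟨1 / 72, 63, by norm_num, by norm_num, fun dv dc hdv hlt => ?_⟩
  have hβ := log_branching_pos hdv hlt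
  have hup := gammaRange_upper_le hdv hlt
  have hlow := log_branching_le_upper hdv hlt
  obtain ⟨C₀, hC₀⟩ := exists_isConstruction hdv (by omega : 3 ≤ dc)
  have hrange : ∀ {γ : ℝ} {C : ℕ → Tanner}, IsConstruction dv dc γ C →
      Set.range C ⊆ regularCodes dv dc := by
    rintro γ C hC _ ⟨N, rfl⟩
    exact (hC.1 N).1
  have hall : ∀ lam ξ η : ℝ, 0 < lam → 0 < ξ → 0 < η → ∀ γ ∈ gammaRange dv dc,
      ∀ᶠ Pe in 𝓝[>] (0 : ℝ),
        1 / 72 * powerScale γ η Pe ≤ totalPowerMin (regularCodes dv dc) lam ξ η Pe ∧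
        totalPowerMin (regularCodes dv dc) lam ξ η Pe ≤ 63 * powerScale γ η Pe := by
    intro lam ξ η hlam hξ hη γ ⟨hγ1, hγ2⟩
    -- For the class of all regular codes the one construction at the upper endpoint serves every γ
    -- in the range, at the cost of the factor 9.
    filter_upwards [totalPowerMin_bounds hdv hlt hlam hξ hη (by linarith) hC₀ (hrange hC₀)
      subset_rfl, eventually_powerScale_pos hη] with Pe ⟨h1, h2⟩ h3
    rw [powerScale_eq] at h1 h2 ⊢
    constructor
    · refine le_trans ?_ h1
      nlinarith
    · refine h2.trans ?_
      nlinarith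
  refine ⟨⟨_, ⟨hlow, le_rfl⟩, C₀, hC₀⟩, hall, ?_, ?_, ?_, ?_⟩
  · intro lam ξ η hlam hξ hη γ ⟨hγ1, hγ2⟩ C hC
    filter_upwards [totalPowerMin_bounds hdv hlt hlam hξ hη (by linarith) hC subset_rfl
      (hrange hC), eventually_powerScale_pos hη] with Pe ⟨h1, h2⟩ h3
    rw [powerScale_eq] at h1 h2 ⊢
    constructor
    · refine le_trans ?_ h1
      nlinarith
    · refine h2.trans ?_
      nlinarith
  · have hmem : 3 * Real.log (2 * (dv : ℝ) * (dc : ℝ) + 1) ∈ gammaRange dv dc := ⟨hlow, le_rfl⟩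
    generalize 3 * Real.log (2 * (dv : ℝ) * (dc : ℝ) + 1) = γ at *
    have hγ : 0 < γ := by linarith
    -- Here γ is the upper endpoint, so both constants depend only on the degrees. The 63 and 72
    -- cancel the constants of `hall`; the 4 comes from (x - 2)/(2η) ≥ x/(4η) for x ≥ 4.
    refine ⟨1 / (4 * 63 * γ), 72 / γ, by positivity, ?_, fun lam ξ η hlam hξ hη => ?_⟩
    · rw [div_le_div_iff₀ (by positivity) hγ]
      linarith
    filter_upwards [hall lam ξ η hlam hξ hη γ hmem, Ioo_mem_nhdsGT (zero_lt_one' ℝ),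
      tendsto_log_one_div.eventually (eventually_ge_atTop 4),
      (Real.tendsto_log_atTop.comp tendsto_log_one_div).eventually (eventually_gt_atTop 0)]
      with Pe ⟨h1, h2⟩ h3 h4 h5
    simp only [Function.comp_apply] at h5
    have h6 := uncodedPower_le hη h3.1 h3.2
    have h7 := le_uncodedPower hη h3.1 h3.2
    rw [powerScale] at h1 h2
    generalize Real.log (1 / Pe) = x at *
    generalize Real.log x = y at *
    constructor
    · calc 1 / (4 * 63 * γ) * y * totalPowerMin (regularCodes dv dc) lam ξ η Pe
          ≤ 1 / (4 * 63 * γ) * y * (63 * (γ / η * x / y)) := by gcongr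
        _ = x / 2 / (2 * η) := by field_simp; norm_num
        _ ≤ (x - 2) / (2 * η) := by gcongr; linarith
        _ ≤ _ := h7
    · calc uncodedPower η Pe ≤ x / η := h6
        _ = 72 / γ * y * (1 / 72 * (γ / η * x / y)) := by field_simp
        _ ≤ _ := by gcongr
  · exact fun lam ξ η PT hlam hξ hη hPT =>
      ⟨fixedPower_lower_bound hdv hlt hlam hξ hη hPT,
        fixedPower_exp_lower_bound hdv hlt hlam hξ hη hPT⟩
  · exact fun lam ξ η _ _ hη => exists_fixedPower_reaches_all hdv hlt hη lam ξ
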